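/- **Setting.** Let $\Omega\subseteq\mathbb R^d$ be convex with $\|x-y\|\le D$ for $x,y\in\Omega$, let $r:\Omega\to[0,C]$ be convex, let $f_1,\dots,f_T$ be differentiable on $\Omega$ with $\|\nabla f_t\|\le G$ on $\Omega$ ($G,D>0$), and let $F_t=f_t+r$. Fix a starting point $o\in\Omega$ and put $\rho=r(o)-\inf_\Omega r\in[0,C]$. A function $h$ is $\alpha$-exp-concave ($\alpha>0$) if $e^{-\alpha h}$ is concave on $\Omega$, and $\lambda$-strongly convex ($\lambda>0$) if $h(y)\ge h(x)+\langle\nabla h(x),y-x\rangle+\frac\lambda2\|y-x\|^2$ on $\Omega$. **Optimistic-Adapt-ML-Prod** with sleeping experts. Expert $i$ has a constant $\kappa_i$, an initial potential $x_{\cdot,i}$ and $L_{\cdot,i}=0$ before its first round. In round $t$ with awake set $\mathcal A_t$ and expert outputs $y_{t,i}$, let $\Delta_{t-1,i}=\min\{\frac14,\sqrt{\kappa_i/(1+L_{t-1,i})}\}$; weights and optimism solve $$m_{t,i}=\tfrac1{GD}\Big(\sum_{j\in\mathcal A_t}p_{t,j}r(y_{t,j})-r(y_{t,i})\Big),\qquad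 p_{t,i}=\frac{\Delta_{t-1,i}x_{t-1,i}e^{\Delta_{t-1,i}m_{t,i}}}{\sum_{j\in\mathcal A_t}\Delta_{t-1,j}x_{t-1,j}e^{\Delta_{t-1,j}m_{t,j}}}.$$ The decision is $z_t=\sum_i p_{t,i}y_{t,i}$; with $\ell_{t,i}=\frac1{GD}(\langle\nabla f_t(z_t),y_{t,i}-z_t\rangle+r(y_{t,i}))$ and $\ell_t=\sum_ip_{t,i}\ell_{t,i}$ the updates are $L_{t,i}=L_{t-1,i}+(\ell_t-\ell_{t,i}-m_{t,i})^2$ and $$x_{t,i}=\Big(x_{t-1,i}\exp\big(\Delta_{t-1,i}(\ell_t-\ell_{t,i})-(\Delta_{t-1,i}(\ell_t-\ell_{t,i}-m_{t,i}))^2\big)\Big)^{\Delta_{t,i}/\Delta_{t-1,i}} .$$ **UMS-Comp** tuned for $n$ rounds applies this, with all experts of a finite set $\mathcal E$ always awake, $\kappa_i=\ln|\mathcal E|$ and initial potentials $1/|\mathcal E|$, to the following experts, all started at $o$; $u_t$ denotes the decision of UMS-Comp and $g_t=\nabla f_t(u_t)$. (a) FOBOS on $f_t+r$: $\tilde u_{t+1}\in\arg\min_{u\in\Omega}\frac12\|u-(\tilde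 u_t-s\nabla f_t(\tilde u_t))\|^2+s\,r(u)$ with $s=D/(G\sqrt{7n})$. For every $\eta=2^{-i}/(5DG)$, $0\le i\le\lceil\frac12\log_2n\rceil$: (b) ProxONS on $h_t+\eta r$ with $h_t(u)=-\eta\langle g_t,u_t-u\rangle+\eta^2\langle g_t,u_t-u\rangle^2$: with $v_t=\nabla h_t(u_t^\eta)$ and $A_t=A_{t-1}+v_tv_t^\top$, $u^\eta_{t+1}\in\arg\min_{u\in\Omega}\langle v_t,u\rangle+\eta r(u)+\frac{\beta_0}2(u-u^\eta_t)^\top A_t(u-u^\eta_t)$, where $A_0=\frac1{\beta_0^2D^2}I$ and $\beta_0=\frac12\min\{\frac{1}{4G'D},1\}$ with $G'=\frac2{5D}$. (c) FOBOS on $\hat h_t+\eta r$ with $\hat h_t(u)=-\eta\langle g_t,u_t-u\rangle+\eta^2G^2\|u_t-u\|^2$: with $s_k=1/(2\eta^2G^2k)$ in the $k$-th round of the instance, $\hat u_{t+1}\in\arg\min_{u\in\Omega}\frac12\|u-(\hat u_t-s_k\nabla\hat h_t(\hat u_t))\|^2+s_k\eta\,r(u)$. **UMA-Comp.** For each geometric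 covering interval $I=[i2^k,(i+1)2^k-1]$ ($i\ge1,k\ge0$) a separate instance of UMS-Comp, tuned for $n=2^k$, runs on the rounds of $I$. The decisions $\mathbf w_t$ of UMA-Comp are those of the sleeping Optimistic-Adapt-ML-Prod whose experts are these instances (that of $I=[a,s]$ is awake exactly during $I$), with $\kappa_I=\ln(4s^2)$ and initial potential $1$. **Theorem.** There is an absolute constant $K$ such that for every run of UMA-Comp, all $1\le p\le q\le T$ and all $\mathbf w\in\Omega$ the regret $R=\sum_{t=p}^qF_t(\mathbf w_t)-\sum_{t=p}^qF_t(\mathbf w)$ satisfies the following. Let $n=q-p+1$, $b=2\lceil\log_2(q-p+2)\rceil$, $c=32\ln(2q)$, $N=3+\lceil\log_2n\rceil$, $M=\ln\big(1+\frac Ne(1+\ln(n+1))\big)$, $\phi_1=\frac14(\ln N+M)^2$, $\phi_2=19\ln N+\frac14M$, $\phi_3=\sqrt7+\ln N+M$. 1. If $f_p,\dots,f_q$ are $\alpha$-exp-concave and $\beta=\frac12\min\{\frac1{4GD},\alpha\}$, then $$R\le\Big(GD+\frac1{2\beta}\Big)c\,b+\Big[\Big(\frac9{8\beta}+10GD\Big)\big(4d\ln(q-p+2)+\phi_1+4\big)+2GD\phi_2\Big]b+\rho\,b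 ,$$ and, if $q-p\ge2$, $R\le K\,(GD+C+\frac1\alpha)\,d\,\log q\,\log(q-p)$; that is, $R=O\big(\frac{d\log q\log(q-p)}\alpha\big)$ for fixed $G,D,C$ and $\alpha$ bounded above. 2. If $f_p,\dots,f_q$ are $\lambda$-strongly convex, then $$R\le\Big(GD+\frac{G^2}{2\lambda}\Big)c\,b+\Big[\Big(\frac{9G^2}\lambda+10GD\Big)\big(7\ln(q-p+1)+\phi_1+8\big)+2GD\phi_2\Big]b+\rho\,b ,$$ and, if $q-p\ge2$, $R\le K\,(GD+C+\frac{G^2}\lambda)\log q\,\log(q-p)$; that is, $R=O\big(\frac{\log q\log(q-p)}\lambda\big)$ for fixed $G,D,C$ and $\lambda$ bounded above. 3. If $f_p,\dots,f_q$ are convex, then $$R\le GD\,(c+\phi_2+1)\,b+7GD\,(\sqrt c+\phi_3)\sqrt{q-p+1}+\rho\,b ,$$ and, if $q>p$, $R\le K\,(GD+C)\sqrt{(q-p)\log q}$; that is, $R=O\big(\sqrt{(q-p)\log q}\big)$ for fixed $G,D,C$. If $o$ minimizes $r$ over $\Omega$, then $\rho=0$. -/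

import Mathlib

open scoped Matrix

noncomputable section

namespace UMAComp

/-- The ambient space `ℝ^d` with its Euclidean norm. -/
abbrev Space (d : ℕ) := EuclideanSpace ℝ (Fin d)

/-! ### Function classes -/

/-- `λ`-strong convexity of `h` on `Ω`, where `h'` is the gradient of `h`. -/
def StronglyConvexWith {d : ℕ} (lam : ℝ) (Ω : Set (Space d)) (h : Space d → ℝ)
    (h' : Space d → Space d) : Prop :=
  ∀ x ∈ Ω, ∀ y ∈ Ω, h x + inner ℝ (h' x) (y - x) + lam / 2 * ‖y - x‖ ^ 2 ≤ h y

/-- `α`-exp-concavity of `h` on `Ω`. -/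
def ExpConcaveOn {d : ℕ} (α : ℝ) (Ω : Set (Space d)) (h : Space d → ℝ) : Prop :=
  ConcaveOn ℝ Ω (fun x => Real.exp (-α * h x))

/-! ### The meta-algorithm: Optimistic-Adapt-ML-Prod with sleeping experts

The state before round `t` is stored at time index `t`: `x t i` and `L t i` are the quantities
that are usually written `x_{t-1,i}` and `L_{t-1,i}`. -/

/-- The learning rate `min {1/4, √(κ / (1 + L))}`. -/
def learningRate (κ L : ℝ) : ℝ := min (1 / 4) (Real.sqrt (κ / (1 + L)))

/-- The sequences `w, x, L, p, m, ℓ, ℓbar` (decisions, expert potentials, cumulative squared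
deviations, weights, optimism, normalized linearized losses, meta losses) are produced by
Optimistic-Adapt-ML-Prod in the rounds `first, …, last`.

`g t` is the gradient map of the loss function of round `t`, `active t` the set of experts that
are awake in round `t`, `birth i` the first round of expert `i`, `κ i` the constant in its
learning rate, `x₀ i` its initial potential, `y t i` its output in round `t`.
The optimism depends on the weights and conversely: the pair of equations `weight` and
`optimism` says that `∑ j, p t j * r (y t j)` solves the fixed-point equation. -/
structure IsOptAdaptMLProd {d : ℕ} {ι : Type} (G D : ℝ) (r : Space d → ℝ)
    (g : ℕ → Space d → Space d) (active : ℕ → Finset ι) (birth : ι → ℕ) (κ x₀ : ι → ℝ)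
    (first last : ℕ) (y : ℕ → ι → Space d)
    (w : ℕ → Space d) (x L p m ℓ : ℕ → ι → ℝ) (ℓbar : ℕ → ℝ) : Prop where
  x_init : ∀ i, x (birth i) i = x₀ i
  L_init : ∀ i, L (birth i) i = 0
  optimism : ∀ t ∈ Finset.Icc first last, ∀ i ∈ active t,
    m t i = 1 / (G * D) * ((∑ j ∈ active t, p t j * r (y t j)) - r (y t i))
  weight : ∀ t ∈ Finset.Icc first last, ∀ i ∈ active t,
    p t i =
      learningRate (κ i) (L t i) * (x t i * Real.exp (learningRate (κ i) (L t i) * m t i)) /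
      ∑ j ∈ active t,
        learningRate (κ j) (L t j) * (x t j * Real.exp (learningRate (κ j) (L t j) * m t j))
  decision : ∀ t ∈ Finset.Icc first last, w t = ∑ i ∈ active t, p t i • y t i
  loss : ∀ t ∈ Finset.Icc first last, ∀ i ∈ active t,
    ℓ t i = 1 / (G * D) * (inner ℝ (g t (w t)) (y t i - w t) + r (y t i))
  metaLoss : ∀ t ∈ Finset.Icc first last, ℓbar t = ∑ i ∈ active t, p t i * ℓ t i
  L_next : ∀ t ∈ Finset.Icc first last, ∀ i ∈ active t,
    L (t + 1) i = L t i + (ℓbar t - ℓ t i - m t i) ^ 2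
  x_next : ∀ t ∈ Finset.Icc first last, ∀ i ∈ active t,
    x (t + 1) i =
      (x t i * Real.exp (learningRate (κ i) (L t i) * (ℓbar t - ℓ t i) -
        (learningRate (κ i) (L t i) * (ℓbar t - ℓ t i - m t i)) ^ 2)) ^
      (learningRate (κ i) (L (t + 1) i) / learningRate (κ i) (L t i))

/-! ### Base algorithms -/

/-- One step of FOBOS on the domain `Ω` with regularizer `R`, step size `s`, gradient `v` at the
current point `z`; the new point is `z'`. -/
def IsFobosStep {d : ℕ} (Ω : Set (Space d)) (R : Space d → ℝ) (s : ℝ) (v z z' : Space d) : Prop :=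
  z' ∈ Ω ∧ IsMinOn (fun u => 1 / 2 * ‖u - (z - s • v)‖ ^ 2 + s * R u) Ω z'

/-- The quadratic form `vᵀ A v`. -/
def quadForm {d : ℕ} (A : Matrix (Fin d) (Fin d) ℝ) (v : Space d) : ℝ :=
  WithLp.ofLp v ⬝ᵥ (A *ᵥ WithLp.ofLp v)

/-- The rank-one matrix `v vᵀ`. -/
def outerSelf {d : ℕ} (v : Space d) : Matrix (Fin d) (Fin d) ℝ :=
  Matrix.vecMulVec (WithLp.ofLp v) (WithLp.ofLp v)

/-- One step of ProxONS with regularizer `R`, parameter `β`, gradient `v` at the current point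
`z` and (already updated) matrix `A`; the new point is `z'`. -/
def IsProxONSStep {d : ℕ} (Ω : Set (Space d)) (R : Space d → ℝ) (β : ℝ)
    (A : Matrix (Fin d) (Fin d) ℝ) (v z z' : Space d) : Prop :=
  z' ∈ Ω ∧ IsMinOn (fun u => inner ℝ v u + R u + β / 2 * quadForm A (u - z)) Ω z'

/-- The parameter `β` of ProxONS, and of the analysis of exp-concave functions:
`β = ½ min {1 / (4 G D), α}`. -/
def onsBeta (G D α : ℝ) : ℝ := 1 / 2 * min (1 / (4 * G * D)) α

/-- The smooth part of the surrogate loss for exp-concave functions; `v` is the gradient at the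
decision `c`. -/
def expSurrogate {d : ℕ} (η : ℝ) (v c u : Space d) : ℝ :=
  -η * inner ℝ v (c - u) + η ^ 2 * inner ℝ v (c - u) ^ 2

/-- The smooth part of the surrogate loss for strongly convex functions; `v` is the gradient at
the decision `c`. -/
def strSurrogate {d : ℕ} (G η : ℝ) (v c u : Space d) : ℝ :=
  -η * inner ℝ v (c - u) + η ^ 2 * G ^ 2 * ‖c - u‖ ^ 2

/-! ### The universal algorithm UMS-Comp for static composite regret -/

/-- The largest exponent `⌈½ log₂ n⌉` of the grid of learning rates for a game of `n` rounds. -/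
def gridSize (n : ℕ) : ℕ := ⌈1 / 2 * Real.logb 2 n⌉₊

/-- The learning rates `2^{-i} / (5 D G)`, `0 ≤ i ≤ gridSize n`. -/
def gridEta (G D : ℝ) (i : ℕ) : ℝ := (2 : ℝ)⁻¹ ^ i / (5 * D * G)

/-- The experts of UMS-Comp: one FOBOS instance on the original composite loss, and for each
learning rate a ProxONS and a FOBOS instance on the surrogate losses. -/
abbrev UMSExpert (n : ℕ) : Type := Unit ⊕ (Fin (gridSize n + 1) ⊕ Fin (gridSize n + 1))

namespace UMSExpert

/-- FOBOS on the original composite loss. -/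
abbrev cvx {n : ℕ} : UMSExpert n := Sum.inl ()

/-- ProxONS on the surrogate for exp-concave losses. -/
abbrev exp {n : ℕ} (i : Fin (gridSize n + 1)) : UMSExpert n := Sum.inr (Sum.inl i)

/-- FOBOS on the surrogate for strongly convex losses. -/
abbrev str {n : ℕ} (i : Fin (gridSize n + 1)) : UMSExpert n := Sum.inr (Sum.inr i)

end UMSExpert

/-- The parameter `β` of the ProxONS instances: the smooth parts of the surrogates are
`1`-exp-concave and their gradients are bounded by `2 / (5 D)`. -/
def surrogateBeta (D : ℝ) : ℝ := onsBeta (2 / (5 * D)) D 1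

/-- A run of UMS-Comp that is tuned for a game of `n` rounds, starts in round `a` and is executed
up to round `e`. All experts start at the point `o`. Time index `t` of `u` is the output in round
`t`; `A t i` is the ProxONS matrix before round `t`. -/
structure UMSCompRun {d : ℕ} (Ω : Set (Space d)) (G D : ℝ) (r : Space d → ℝ)
    (g : ℕ → Space d → Space d) (o : Space d) (a e n : ℕ) where
  /-- outputs of the experts -/
  u : ℕ → UMSExpert n → Space d
  /-- the decisions -/
  out : ℕ → Space d
  /-- matrices of the ProxONS experts -/
  A : ℕ → Fin (gridSize n + 1) → Matrix (Fin d) (Fin d) ℝ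
  /-- potentials -/
  x : ℕ → UMSExpert n → ℝ
  /-- cumulative squared deviations -/
  L : ℕ → UMSExpert n → ℝ
  /-- weights -/
  p : ℕ → UMSExpert n → ℝ
  /-- optimism -/
  m : ℕ → UMSExpert n → ℝ
  /-- normalized linearized losses -/
  ℓ : ℕ → UMSExpert n → ℝ
  /-- meta losses -/
  ℓbar : ℕ → ℝ
  isMeta : IsOptAdaptMLProd G D r g (fun _ => Finset.univ) (fun _ => a)
    (fun _ => Real.log (Fintype.card (UMSExpert n)))
    (fun _ => 1 / (Fintype.card (UMSExpert n) : ℝ)) a e u out x L p m ℓ ℓbar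
  u_init : ∀ i, u a i = o
  A_init : ∀ i, A a i = (1 / (surrogateBeta D ^ 2 * D ^ 2)) • (1 : Matrix (Fin d) (Fin d) ℝ)
  cvx_step : ∀ t ∈ Finset.Icc a e,
    IsFobosStep Ω r (D / (G * Real.sqrt (7 * n)))
      (g t (u t UMSExpert.cvx)) (u t UMSExpert.cvx) (u (t + 1) UMSExpert.cvx)
  A_next : ∀ t ∈ Finset.Icc a e, ∀ i : Fin (gridSize n + 1),
    A (t + 1) i = A t i + outerSelf
      (gradient (expSurrogate (gridEta G D i) (g t (out t)) (out t)) (u t (UMSExpert.exp i)))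
  exp_step : ∀ t ∈ Finset.Icc a e, ∀ i : Fin (gridSize n + 1),
    IsProxONSStep Ω (fun v => gridEta G D i * r v) (surrogateBeta D) (A (t + 1) i)
      (gradient (expSurrogate (gridEta G D i) (g t (out t)) (out t)) (u t (UMSExpert.exp i)))
      (u t (UMSExpert.exp i)) (u (t + 1) (UMSExpert.exp i))
  /-- The smooth part of the surrogate is `2 η² G²`-strongly convex, and the step size in the
  `k`-th round of the instance is `1 / (2 η² G² k)`. -/
  str_step : ∀ t ∈ Finset.Icc a e, ∀ i : Fin (gridSize n + 1),
    IsFobosStep Ω (fun v => gridEta G D i * r v)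
      (1 / (2 * gridEta G D i ^ 2 * G ^ 2 * ((t : ℝ) - a + 1)))
      (gradient (strSurrogate G (gridEta G D i) (g t (out t)) (out t)) (u t (UMSExpert.str i)))
      (u t (UMSExpert.str i)) (u (t + 1) (UMSExpert.str i))

/-! ### Geometric covering intervals and UMA-Comp -/

/-- The pair `(k, i)` stands for the geometric covering interval
`[(i + 1) 2^k, (i + 2) 2^k - 1]`. -/
abbrev GCInterval : Type := ℕ × ℕ

/-- The number of rounds of a GC interval. -/
def gcLength (I : GCInterval) : ℕ := 2 ^ I.1

/-- The first round of a GC interval. -/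
def gcStart (I : GCInterval) : ℕ := (I.2 + 1) * 2 ^ I.1

/-- The last round of a GC interval. -/
def gcEnd (I : GCInterval) : ℕ := (I.2 + 2) * 2 ^ I.1 - 1

/-- The GC intervals that contain the round `t`. -/
def gcActive (t : ℕ) : Finset GCInterval :=
  (Finset.range t ×ˢ Finset.range t).filter (fun I => gcStart I ≤ t ∧ t ≤ gcEnd I)

theorem mem_gcActive {t : ℕ} {I : GCInterval} :
    I ∈ gcActive t ↔ gcStart I ≤ t ∧ t ≤ gcEnd I := by
  obtain ⟨k, i⟩ := I
  simp only [gcActive, Finset.mem_filter, Finset.mem_product, Finset.mem_range,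
    and_iff_right_iff_imp]
  rintro ⟨h, -⟩
  simp only [gcStart] at h
  have h1 : k < 2 ^ k := Nat.lt_two_pow_self
  constructor <;> nlinarith

/-- A run of UMA-Comp over the rounds `1, …, T`: for every GC interval `I` an instance of UMS-Comp
runs during `I` (it is tuned for the length of `I`, and cut off after round `T`), and the awake
instances are aggregated by the sleeping Optimistic-Adapt-ML-Prod with `γ_I = ln (4 s²)`, where
`s` is the last round of `I`, and initial potential `1`. -/
structure UMACompRun {d : ℕ} (Ω : Set (Space d)) (G D : ℝ) (r : Space d → ℝ)
    (g : ℕ → Space d → Space d) (o : Space d) (T : ℕ) where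
  /-- the expert of each GC interval -/
  expert : ∀ I : GCInterval,
    UMSCompRun Ω G D r g o (gcStart I) (min (gcEnd I) T) (gcLength I)
  /-- the decisions -/
  w : ℕ → Space d
  /-- potentials -/
  x : ℕ → GCInterval → ℝ
  /-- cumulative squared deviations -/
  L : ℕ → GCInterval → ℝ
  /-- weights -/
  p : ℕ → GCInterval → ℝ
  /-- optimism -/
  m : ℕ → GCInterval → ℝ
  /-- normalized linearized losses -/
  ℓ : ℕ → GCInterval → ℝ
  /-- meta losses -/
  ℓbar : ℕ → ℝ
  isMeta : IsOptAdaptMLProd G D r g gcActive gcStart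
    (fun I => Real.log (4 * (gcEnd I : ℝ) ^ 2)) (fun _ => 1) 1 T
    (fun t I => (expert I).out t) w x L p m ℓ ℓbar

/-! ### Regret and the quantities in the bounds -/

/-- The composite regret over the rounds `p, …, q` against the fixed comparator `v`. -/
def compositeRegret {d : ℕ} (f : ℕ → Space d → ℝ) (r : Space d → ℝ) (w : ℕ → Space d)
    (p q : ℕ) (v : Space d) : ℝ :=
  (∑ t ∈ Finset.Icc p q, (f t (w t) + r (w t))) - ∑ t ∈ Finset.Icc p q, (f t v + r v)

/-- `r(o) - inf_Ω r`; it vanishes when `o` minimizes `r` over `Ω`. -/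
def initGap {d : ℕ} (Ω : Set (Space d)) (r : Space d → ℝ) (o : Space d) : ℝ :=
  r o - sInf (r '' Ω)

/-- `b(p,q) = 2 ⌈log₂ (q - p + 2)⌉`. -/
def boundB (p q : ℕ) : ℝ := 2 * (⌈Real.logb 2 ((q : ℝ) - p + 2)⌉ : ℝ)

/-- `c(q) = 32 ln (2 q)`. -/
def boundC (q : ℕ) : ℝ := 32 * Real.log (2 * q)

/-- `3 + ⌈log₂ n⌉`. -/
def expertCount (n : ℝ) : ℝ := 3 + (⌈Real.logb 2 n⌉ : ℝ)

/-- `ln (1 + (3 + ⌈log₂ n⌉) / e * (1 + ln (n + 1)))`. -/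
def logFactor (n : ℝ) : ℝ :=
  Real.log (1 + expertCount n / Real.exp 1 * (1 + Real.log (n + 1)))

/-- `φ₁ = ¼ (ln (3 + ⌈log₂ n⌉) + ln (1 + (3 + ⌈log₂ n⌉) / e * (1 + ln (n + 1))))²`. -/
def phi1 (n : ℝ) : ℝ := 1 / 4 * (Real.log (expertCount n) + logFactor n) ^ 2

/-- `φ₂ = 19 ln (3 + ⌈log₂ n⌉) + ¼ ln (1 + (3 + ⌈log₂ n⌉) / e * (1 + ln (n + 1)))`. -/
def phi2 (n : ℝ) : ℝ := 19 * Real.log (expertCount n) + 1 / 4 * logFactor n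

/-- `φ₃ = √7 + ln (3 + ⌈log₂ n⌉) + ln (1 + (3 + ⌈log₂ n⌉) / e * (1 + ln (n + 1)))`. -/
def phi3 (n : ℝ) : ℝ := Real.sqrt 7 + Real.log (expertCount n) + logFactor n

/-- `φ(p,q) = (9 / (8 β) + 10 G D) (4 d ln (q - p + 2) + φ₁ + 4) + 2 G D φ₂`, where `φ₁, φ₂`
are taken at the length `q - p + 1`. -/
def boundExp (d : ℕ) (G D β : ℝ) (p q : ℕ) : ℝ :=
  (9 / (8 * β) + 10 * G * D) *
    (4 * d * Real.log ((q : ℝ) - p + 2) + phi1 ((q : ℝ) - p + 1) + 4) +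
  2 * G * D * phi2 ((q : ℝ) - p + 1)

/-- `φ̂(p,q) = (9 G² / λ + 10 G D) (7 ln (q - p + 1) + φ₁ + 8) + 2 G D φ₂`, where `φ₁, φ₂`
are taken at the length `q - p + 1`. -/
def boundStr (G D lam : ℝ) (p q : ℕ) : ℝ :=
  (9 * G ^ 2 / lam + 10 * G * D) *
    (7 * Real.log ((q : ℝ) - p + 1) + phi1 ((q : ℝ) - p + 1) + 8) +
  2 * G * D * phi2 ((q : ℝ) - p + 1)

/-! ### The algorithm is well defined: runs exist -/

/-- The fixed-point equation for weights and optimism is solvable. -/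
theorem exists_weights_optimism {ι : Type} (s : Finset ι) (a b R : ι → ℝ) (c : ℝ)
    (ha : ∀ i, 0 < a i) (hb : ∀ i, 0 < b i) :
    ∃ p m : ι → ℝ, (∀ i ∈ s, m i = c * ((∑ j ∈ s, p j * R j) - R i)) ∧
      (∀ i ∈ s, p i = a i * (b i * Real.exp (a i * m i)) /
        ∑ j ∈ s, a j * (b j * Real.exp (a j * m j))) := by
  rcases s.eq_empty_or_nonempty with rfl | hs
  · exact ⟨0, 0, by simp, by simp⟩
  let W : ι → ℝ → ℝ := fun j y => a j * (b j * Real.exp (a j * (c * (y - R j))))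
  have hW : ∀ j y, 0 < W j y := fun j y => by
    have := ha j; have := hb j; positivity
  have hS : ∀ y, 0 < ∑ j ∈ s, W j y := fun y => Finset.sum_pos (fun j _ => hW j y) hs
  let F : ℝ → ℝ := fun y => (∑ j ∈ s, W j y * R j) / ∑ j ∈ s, W j y
  have hF : Continuous F := by
    apply Continuous.div
    · fun_prop
    · fun_prop
    · exact fun y => (hS y).ne'
  let lo := s.inf' hs R
  let hi := s.sup' hs R
  have hlo : ∀ j ∈ s, lo ≤ R j := fun j hj => Finset.inf'_le _ hj
  have hhi : ∀ j ∈ s, R j ≤ hi := fun j hj => Finset.le_sup' _ hj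
  have hle : lo ≤ hi := by
    obtain ⟨j, hj⟩ := hs
    exact (hlo j hj).trans (hhi j hj)
  have hmap : Set.MapsTo F (Set.Icc lo hi) (Set.Icc lo hi) := by
    intro y _
    constructor
    · rw [le_div_iff₀ (hS y), Finset.mul_sum]
      exact Finset.sum_le_sum fun j hj => by nlinarith [hlo j hj, hW j y]
    · rw [div_le_iff₀ (hS y), Finset.mul_sum]
      exact Finset.sum_le_sum fun j hj => by nlinarith [hhi j hj, hW j y]
  obtain ⟨y, -, hy⟩ := exists_mem_Icc_isFixedPt_of_mapsTo hF.continuousOn hle hmap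
  refine ⟨fun j => W j y / ∑ k ∈ s, W k y, fun j => c * (y - R j), ?_, fun i _ => rfl⟩
  intro i _
  have : ∑ j ∈ s, W j y / (∑ k ∈ s, W k y) * R j = y := by
    conv_rhs => rw [← hy]
    simp only [F, Finset.sum_div]
    exact Finset.sum_congr rfl fun j _ => by ring
  simp only [this]

theorem learningRate_pos {κ L : ℝ} (hκ : 0 < κ) (hL : 0 ≤ L) : 0 < learningRate κ L := by
  unfold learningRate
  have : 0 < κ / (1 + L) := by positivity
  exact lt_min (by norm_num) (Real.sqrt_pos.2 this)

theorem exists_optAdaptMLProd {d : ℕ} {ι : Type} (G D : ℝ) (r : Space d → ℝ)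
    (g : ℕ → Space d → Space d) (active : ℕ → Finset ι) (birth : ι → ℕ) (κ x₀ : ι → ℝ)
    (first last : ℕ) (hb : ∀ t, ∀ i ∈ active t, birth i ≤ t) (hκ : ∀ i, 0 < κ i)
    (hx : ∀ i, 0 < x₀ i) {Z : Type} (z0 : Z) (Y : ℕ → Z → ι → Space d)
    (Rel : ℕ → Space d → Z → Z → Prop) (hR : ∀ t w z, ∃ z', Rel t w z z') :
    ∃ (z : ℕ → Z) (w : ℕ → Space d) (x L p m ℓ : ℕ → ι → ℝ) (ℓbar : ℕ → ℝ),
      IsOptAdaptMLProd G D r g active birth κ x₀ first last (fun t => Y t (z t)) w x L p m ℓ ℓbar ∧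
      z 0 = z0 ∧ ∀ t, Rel t (w t) (z t) (z (t + 1)) := by
  classical
  let S := {s : Z × (ι → ℝ) × (ι → ℝ) // ∀ i, 0 < s.2.1 i ∧ 0 ≤ s.2.2 i}
  have fp : ∀ (t : ℕ) (s : S), ∃ pm : (ι → ℝ) × (ι → ℝ),
      (∀ i ∈ active t, pm.2 i = 1 / (G * D) * ((∑ j ∈ active t, pm.1 j * r (Y t s.1.1 j)) -
        r (Y t s.1.1 i))) ∧
      (∀ i ∈ active t, pm.1 i = learningRate (κ i) (s.1.2.2 i) *
        (s.1.2.1 i * Real.exp (learningRate (κ i) (s.1.2.2 i) * pm.2 i)) /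
        ∑ j ∈ active t, learningRate (κ j) (s.1.2.2 j) *
        (s.1.2.1 j * Real.exp (learningRate (κ j) (s.1.2.2 j) * pm.2 j))) := by
    intro t s
    obtain ⟨p, m, h1, h2⟩ := exists_weights_optimism (active t) (fun i => learningRate (κ i) (s.1.2.2 i))
      s.1.2.1 (fun i => r (Y t s.1.1 i)) (1 / (G * D)) (fun i => learningRate_pos (hκ i) (s.2 i).2)
      (fun i => (s.2 i).1)
    exact ⟨(p, m), h1, h2⟩
  choose pm hpm1 hpm2 using fp
  let W : ℕ → S → Space d := fun t s => ∑ i ∈ active t, (pm t s).1 i • Y t s.1.1 i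
  let ell : ℕ → S → ι → ℝ := fun t s i =>
    1 / (G * D) * (inner ℝ (g t (W t s)) (Y t s.1.1 i - W t s) + r (Y t s.1.1 i))
  let lb : ℕ → S → ℝ := fun t s => ∑ i ∈ active t, (pm t s).1 i * ell t s i
  let Ln : ℕ → S → ι → ℝ := fun t s i =>
    if birth i = t + 1 then 0 else s.1.2.2 i + (lb t s - ell t s i - (pm t s).2 i) ^ 2
  let xn : ℕ → S → ι → ℝ := fun t s i =>
    if birth i = t + 1 then x₀ i else
      (s.1.2.1 i * Real.exp (learningRate (κ i) (s.1.2.2 i) * (lb t s - ell t s i) -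
        (learningRate (κ i) (s.1.2.2 i) * (lb t s - ell t s i - (pm t s).2 i)) ^ 2)) ^
      (learningRate (κ i) (Ln t s i) / learningRate (κ i) (s.1.2.2 i))
  choose zn hzn using hR
  let next : ℕ → S → S := fun t s => ⟨(zn t (W t s) s.1.1, xn t s, Ln t s), by
    intro i
    constructor
    · change 0 < xn t s i
      simp only [xn]
      split_ifs
      · exact hx i
      · exact Real.rpow_pos_of_pos (mul_pos (s.2 i).1 (Real.exp_pos _)) _
    · change 0 ≤ Ln t s i
      simp only [Ln]
      split_ifs
      · exact le_rfl
      · have := (s.2 i).2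
        positivity⟩
  let st : ℕ → S := fun t => Nat.rec ⟨(z0, x₀, fun _ => 0), fun i => ⟨hx i, le_rfl⟩⟩ next t
  have hst : ∀ t, st (t + 1) = next t (st t) := fun t => rfl
  have hne : ∀ t, ∀ i ∈ active t, birth i ≠ t + 1 := fun t i hi => by
    have := hb t i hi; omega
  refine ⟨fun t => (st t).1.1, fun t => W t (st t), fun t => (st t).1.2.1, fun t => (st t).1.2.2,
    fun t => (pm t (st t)).1, fun t => (pm t (st t)).2, fun t => ell t (st t),
    fun t => lb t (st t), ⟨?_, ?_, ?_, ?_, ?_, ?_, ?_, ?_, ?_⟩, rfl, fun t => hzn t _ _⟩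
  · intro i
    rcases h : birth i with _ | t
    · rfl
    · change xn t (st t) i = _
      simp [xn, h]
  · intro i
    rcases h : birth i with _ | t
    · rfl
    · change Ln t (st t) i = _
      simp [Ln, h]
  · exact fun t _ => hpm1 t _
  · exact fun t _ => hpm2 t _
  · exact fun t _ => rfl
  · exact fun t _ i _ => rfl
  · exact fun t _ => rfl
  · intro t _ i hi
    change Ln t (st t) i = _
    simp only [Ln, if_neg (hne t i hi)]
  · intro t _ i hi
    change xn t (st t) i = _
    simp only [xn, if_neg (hne t i hi)]
    rfl

theorem exists_fobosStep {d : ℕ} {Ω : Set (Space d)} (hc : IsCompact Ω) (hn : Ω.Nonempty)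
    {R : Space d → ℝ} (hR : LowerSemicontinuousOn R Ω) {s : ℝ} (hs : 0 ≤ s) (v z : Space d) :
    ∃ z', IsFobosStep Ω R s v z z' := by
  have h1 : LowerSemicontinuousOn (fun u => 1 / 2 * ‖u - (z - s • v)‖ ^ 2) Ω :=
    (Continuous.continuousOn (by fun_prop)).lowerSemicontinuousOn
  have h2 : LowerSemicontinuousOn (fun u => s * R u) Ω :=
    Continuous.comp_lowerSemicontinuousOn (continuous_const_mul s) hR
      (monotone_mul_left_of_nonneg hs)
  obtain ⟨z', h, h'⟩ := (h1.add h2).exists_isMinOn hn hc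
  exact ⟨z', h, h'⟩

theorem exists_proxONSStep {d : ℕ} {Ω : Set (Space d)} (hc : IsCompact Ω) (hn : Ω.Nonempty)
    {R : Space d → ℝ} (hR : LowerSemicontinuousOn R Ω) (β : ℝ)
    (A : Matrix (Fin d) (Fin d) ℝ) (v z : Space d) :
    ∃ z', IsProxONSStep Ω R β A v z z' := by
  have h1 : LowerSemicontinuousOn (fun u => inner ℝ v u) Ω :=
    (Continuous.continuousOn (by fun_prop)).lowerSemicontinuousOn
  have h2 : LowerSemicontinuousOn (fun u => β / 2 * quadForm A (u - z)) Ω := by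
    apply ContinuousOn.lowerSemicontinuousOn
    apply Continuous.continuousOn
    unfold quadForm dotProduct Matrix.mulVec dotProduct
    fun_prop
  obtain ⟨z', h, h'⟩ := ((h1.add hR).add h2).exists_isMinOn hn hc
  exact ⟨z', h, h'⟩

theorem nonempty_umsCompRun {d : ℕ} {Ω : Set (Space d)} (hc : IsCompact Ω) (hn : Ω.Nonempty)
    {G D : ℝ} (hG : 0 < G) (hD : 0 < D) {r : Space d → ℝ} (hr : LowerSemicontinuousOn r Ω)
    (g : ℕ → Space d → Space d) (o : Space d) (a e n : ℕ) :
    Nonempty (UMSCompRun Ω G D r g o a e n) := by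
  have heta : ∀ i, 0 ≤ gridEta G D i := fun i => by unfold gridEta; positivity
  have hrη : ∀ i, LowerSemicontinuousOn (fun v => gridEta G D i * r v) Ω := fun i =>
    Continuous.comp_lowerSemicontinuousOn (continuous_const_mul _) hr
      (monotone_mul_left_of_nonneg (heta i))
  let Z := (UMSExpert n → Space d) × (Fin (gridSize n + 1) → Matrix (Fin d) (Fin d) ℝ)
  let z0 : Z := (fun _ => o, fun _ => (1 / (surrogateBeta D ^ 2 * D ^ 2)) • 1)
  let Rel : ℕ → Space d → Z → Z → Prop := fun t c z z' =>
    (t < a → z' = z) ∧ (a ≤ t →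
      IsFobosStep Ω r (D / (G * Real.sqrt (7 * n)))
        (g t (z.1 UMSExpert.cvx)) (z.1 UMSExpert.cvx) (z'.1 UMSExpert.cvx) ∧
      (∀ i : Fin (gridSize n + 1), z'.2 i = z.2 i + outerSelf
        (gradient (expSurrogate (gridEta G D i) (g t c) c) (z.1 (UMSExpert.exp i)))) ∧
      (∀ i : Fin (gridSize n + 1),
        IsProxONSStep Ω (fun v => gridEta G D i * r v) (surrogateBeta D) (z'.2 i)
          (gradient (expSurrogate (gridEta G D i) (g t c) c) (z.1 (UMSExpert.exp i)))
          (z.1 (UMSExpert.exp i)) (z'.1 (UMSExpert.exp i))) ∧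
      (∀ i : Fin (gridSize n + 1),
        IsFobosStep Ω (fun v => gridEta G D i * r v)
          (1 / (2 * gridEta G D i ^ 2 * G ^ 2 * ((t : ℝ) - a + 1)))
          (gradient (strSurrogate G (gridEta G D i) (g t c) c) (z.1 (UMSExpert.str i)))
          (z.1 (UMSExpert.str i)) (z'.1 (UMSExpert.str i))))
  have hRel : ∀ t c z, ∃ z', Rel t c z z' := by
    intro t c z
    by_cases hta : t < a
    · exact ⟨z, fun _ => rfl, fun h => by omega⟩
    · have hta' : (0 : ℝ) ≤ (t : ℝ) - a := by
        have : (a : ℝ) ≤ t := by exact_mod_cast not_lt.1 hta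
        linarith
      obtain ⟨c1, h1⟩ := exists_fobosStep hc hn hr (s := D / (G * Real.sqrt (7 * n))) (by positivity)
        (g t (z.1 UMSExpert.cvx)) (z.1 UMSExpert.cvx)
      choose c2 h2 using fun i : Fin (gridSize n + 1) => exists_proxONSStep hc hn (hrη i) (surrogateBeta D)
        (z.2 i + outerSelf (gradient (expSurrogate (gridEta G D i) (g t c) c)
          (z.1 (UMSExpert.exp i))))
        (gradient (expSurrogate (gridEta G D i) (g t c) c) (z.1 (UMSExpert.exp i)))
        (z.1 (UMSExpert.exp i))
      choose c3 h3 using fun i : Fin (gridSize n + 1) => exists_fobosStep hc hn (hrη i)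
        (s := 1 / (2 * gridEta G D i ^ 2 * G ^ 2 * ((t : ℝ) - a + 1))) (by positivity)
        (gradient (strSurrogate G (gridEta G D i) (g t c) c) (z.1 (UMSExpert.str i)))
        (z.1 (UMSExpert.str i))
      exact ⟨(Sum.elim (fun _ => c1) (Sum.elim c2 c3), _), fun h => absurd h hta,
        fun _ => ⟨h1, fun _ => rfl, h2, h3⟩⟩
  have hcard : 3 ≤ Fintype.card (UMSExpert n) := by
    simp only [Fintype.card_sum, Fintype.card_unit, Fintype.card_fin]; omega
  have hcard' : (3 : ℝ) ≤ Fintype.card (UMSExpert n) := by exact_mod_cast hcard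
  obtain ⟨z, w, x, L, p, m, ℓ, ℓbar, h, hz0, hz⟩ := exists_optAdaptMLProd G D r g
    (fun t => if t < a then ∅ else (Finset.univ : Finset (UMSExpert n))) (fun _ => a)
    (fun _ => Real.log (Fintype.card (UMSExpert n)))
    (fun _ => 1 / (Fintype.card (UMSExpert n) : ℝ)) a e
    (by
      intro t i hi
      split_ifs at hi with hh
      · simp at hi
      · omega)
    (fun _ => Real.log_pos (by linarith)) (fun _ => by positivity) z0 (fun _ z => z.1) Rel hRel
  have hza : ∀ t ≤ a, z t = z0 := by
    intro t
    induction t with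
    | zero => exact fun _ => hz0
    | succ t ih => exact fun ht => ((hz t).1 (by omega)).trans (ih (by omega))
  have hact : ∀ t ∈ Finset.Icc a e,
      (if t < a then ∅ else (Finset.univ : Finset (UMSExpert n))) = Finset.univ := by
    intro t ht
    rw [if_neg (not_lt.2 (Finset.mem_Icc.1 ht).1)]
  have hI : ∀ t ∈ Finset.Icc a e, a ≤ t := fun t ht => (Finset.mem_Icc.1 ht).1
  refine ⟨⟨fun t => (z t).1, w, fun t => (z t).2, x, L, p, m, ℓ, ℓbar, ?_, ?_, ?_, ?_, ?_, ?_, ?_⟩⟩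
  · constructor
    · exact h.x_init
    · exact h.L_init
    · intro t ht; have := h.optimism t ht; rwa [hact t ht] at this
    · intro t ht; have := h.weight t ht; rwa [hact t ht] at this
    · intro t ht; have := h.decision t ht; rwa [hact t ht] at this
    · intro t ht; have := h.loss t ht; rwa [hact t ht] at this
    · intro t ht; have := h.metaLoss t ht; rwa [hact t ht] at this
    · intro t ht; have := h.L_next t ht; rwa [hact t ht] at this
    · intro t ht; have := h.x_next t ht; rwa [hact t ht] at this
  · intro i; simp only [hza a le_rfl]; rfl
  · intro i; simp only [hza a le_rfl]; rfl
  · exact fun t ht => ((hz t).2 (hI t ht)).1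
  · exact fun t ht => ((hz t).2 (hI t ht)).2.1
  · exact fun t ht => ((hz t).2 (hI t ht)).2.2.1
  · exact fun t ht => ((hz t).2 (hI t ht)).2.2.2

/-- The algorithm is well defined: on a compact domain and with a lower semicontinuous
regularizer, there is a run against every sequence of losses. -/
theorem nonempty_umaCompRun {d : ℕ} {Ω : Set (Space d)} (hc : IsCompact Ω) (hn : Ω.Nonempty)
    {G D : ℝ} (hG : 0 < G) (hD : 0 < D) {r : Space d → ℝ} (hr : LowerSemicontinuousOn r Ω)
    (g : ℕ → Space d → Space d) (o : Space d) (T : ℕ) :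
    Nonempty (UMACompRun Ω G D r g o T) := by
  have E : ∀ I : GCInterval,
      Nonempty (UMSCompRun Ω G D r g o (gcStart I) (min (gcEnd I) T) (gcLength I)) :=
    fun I => nonempty_umsCompRun hc hn hG hD hr g o _ _ _
  let E' := fun I => (E I).some
  have hend : ∀ I : GCInterval, 1 ≤ gcEnd I := by
    intro I
    have : 1 ≤ 2 ^ I.1 := Nat.one_le_two_pow
    unfold gcEnd
    have h2 : 2 * 1 ≤ (I.2 + 2) * 2 ^ I.1 := Nat.mul_le_mul (by omega) this
    omega
  obtain ⟨z, w, x, L, p, m, ℓ, ℓbar, h, -, -⟩ := exists_optAdaptMLProd G D r g gcActive gcStart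
    (fun I => Real.log (4 * (gcEnd I : ℝ) ^ 2)) (fun _ => 1) 1 T
    (fun t i hi => (mem_gcActive.1 hi).1)
    (fun I => Real.log_pos (by
      have : (1 : ℝ) ≤ gcEnd I := by exact_mod_cast hend I
      nlinarith)) (fun _ => one_pos) ()
    (fun t _ I => (E' I).out t) (fun _ _ _ _ => True) (fun _ _ _ => ⟨(), trivial⟩)
  exact ⟨⟨E', w, x, L, p, m, ℓ, ℓbar, h⟩⟩

end UMAComp

end

/-!
The regret of UMA-Comp on an interval is bounded in three layers.

*Meta-algorithm* (`IsSleepingRun`). Both UMS-Comp and UMA-Comp are runs of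
Optimistic-Adapt-ML-Prod. The optimism is the regularizer itself, so it cancels in the deviation
`ℓbar - ℓ - m`, which equals the normalized linearized loss (`deviation_eq`) and is at most `1`. The
fixed-point equation for the weights makes the first-order terms of the potential cancel
(`sum_potential_step`); the total potential grows only through the decay of the learning rates, also
when experts fall asleep (`sum_frozen_potential_le`). Taking logarithms, the regret against an
expert is a constant plus a multiple of `√V`, where `V` is the sum of the squared linearized losses.

*UMS-Comp on one covering interval* (`UMSCompRun`). On the surrogate with learning rate `η` the
meta regret is absorbed by the quadratic term of the surrogate up to a constant
(`surrogate_meta_le`), and ProxONS and FOBOS have logarithmic regret (`proxONS_regret`,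
`fobos_strong_regret`). Dividing by `η` gives a bound `A / η + η S` with some `η` of the grid
balancing the two terms (`exists_grid_bound`), and `S` is absorbed by the curvature of the losses
(`first_order_of_expConcaveOn` or the definition of strong convexity). The constants in the theorem
are those of `3 + ⌈log₂ n⌉` experts, while the algorithm may have one expert more. The difference is
paid for by the slack between the regret `log (1 + n / 64)` of ProxONS and `log (n + 1)`
(`ons_slack`), and, in games of at most `32` rounds, by the learning rates being constant.

*From covering intervals to all intervals.* Every interval splits into two families of geometric
covering intervals with distinct lengths (`exists_cover`), hence into at most `b` of them. Summation
of the bounds for the covering intervals gives the explicit bounds. The logarithmic asymptotic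
bounds are then numerical consequences. For convex losses this would leave a term
`log q log (q - p)`, so the asymptotic bound is proved on each covering interval separately: if the
length `x` is at most `c`, then the trivial bound `x (G D + C)` is of order `√(x log q)`, and
otherwise `c ≤ √(c x)` (`UMACompRun.interval_regret_sqrt`).
-/

open scoped Matrix

noncomputable section

namespace UMAComp

/-! ### Scalar inequalities -/

/-- The inequality behind Prod-type updates. -/
theorem exp_sub_sq_le {x : ℝ} (hx : |x| ≤ 1 / 4) : Real.exp (x - x ^ 2) ≤ 1 + x := by
  have hx' := abs_le.1 hx
  have h := Real.abs_log_sub_add_sum_range_le (x := -x) (by rw [abs_neg]; linarith) 2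
  simp only [Finset.sum_range_succ, Finset.sum_range_zero, abs_neg] at h
  have h1 : |x| ^ (2 + 1) / (1 - |x|) ≤ x ^ 2 / 3 := by
    rw [div_le_iff₀ (by linarith), ← sq_abs]
    nlinarith [abs_nonneg x, sq_nonneg |x|, mul_nonneg (sq_nonneg |x|) (sub_nonneg.2 hx)]
  have h2 := (abs_le.1 (h.trans h1)).1
  have h3 : x - x ^ 2 ≤ Real.log (1 + x) := by
    norm_num at h2
    nlinarith [sq_nonneg x]
  calc Real.exp (x - x ^ 2) ≤ Real.exp (Real.log (1 + x)) := Real.exp_le_exp.2 h3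
    _ = 1 + x := Real.exp_log (by linarith)

/-- A second-order bound that turns exp-concavity into a quadratic lower bound. -/
theorem add_sq_div_four_le_neg_log {z : ℝ} (hz : |z| ≤ 1 / 4) :
    z + z ^ 2 / 4 ≤ -Real.log (1 - z) := by
  have hz' := abs_le.1 hz
  have h := Real.abs_log_sub_add_sum_range_le (x := z) (by linarith) 3
  simp only [Finset.sum_range_succ, Finset.sum_range_zero] at h
  have h1 : |z| ^ (3 + 1) / (1 - |z|) ≤ z ^ 2 / 12 := by
    rw [div_le_iff₀ (by linarith), ← sq_abs]
    have := abs_nonneg z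
    have h5 : |z| ^ (3 + 1) ≤ |z| ^ 2 * (1 / 16) := by
      rw [show |z| ^ (3 + 1) = |z| ^ 2 * |z| ^ 2 by ring]
      gcongr
      nlinarith
    nlinarith [sq_nonneg |z|]
  have h2 := (abs_le.1 (h.trans h1)).2
  norm_num at h2
  nlinarith [sq_nonneg z, mul_nonneg (sq_nonneg z) (by linarith : 0 ≤ z + 1 / 4)]

/-- The perturbation of a potential by a decreasing learning rate costs at most `(a - 1) / e`. -/
theorem le_rpow_add {x a : ℝ} (hx : 0 < x) (ha : 1 ≤ a) :
    x ≤ x ^ a + (a - 1) / Real.exp 1 := by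
  have h1 : x ^ a = x * Real.exp (Real.log x * (a - 1)) := by
    rw [← Real.rpow_def_of_pos hx, Real.rpow_sub_one hx.ne']
    field_simp
  have h2 := Real.add_one_le_exp (Real.log x * (a - 1))
  have h3 : -(x * Real.log x) ≤ 1 / Real.exp 1 := by
    have := Real.add_one_le_exp (-Real.log x - 1)
    rw [sub_eq_add_neg, Real.exp_add, Real.exp_neg, Real.exp_log hx, Real.exp_neg] at this
    have h4 : x * (-Real.log x) ≤ x * (x⁻¹ * (Real.exp 1)⁻¹) :=
      mul_le_mul_of_nonneg_left (by linarith) hx.le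
    rw [← mul_assoc, mul_inv_cancel₀ hx.ne', one_mul] at h4
    rw [one_div]; linarith
  rw [h1]
  have h5 : x * (1 + Real.log x * (a - 1)) ≤ x * Real.exp (Real.log x * (a - 1)) := by
    gcongr; linarith
  have h6 : (a - 1) * (-(x * Real.log x)) ≤ (a - 1) * (1 / Real.exp 1) :=
    mul_le_mul_of_nonneg_left h3 (by linarith)
  have h7 : (a - 1) / Real.exp 1 = (a - 1) * (1 / Real.exp 1) := by ring
  rw [h7]
  nlinarith

/-- The multiplicative update is dominated by a linear one. -/
theorem exp_optimistic_le {η ρ m : ℝ} (h : |η * (ρ - m)| ≤ 1 / 4) :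
    Real.exp (η * ρ - (η * (ρ - m)) ^ 2) ≤ 1 + η * Real.exp (η * m) * ρ := by
  have h1 := exp_sub_sq_le h
  have h2 : Real.exp (η * ρ - (η * (ρ - m)) ^ 2) =
      Real.exp (η * m) * Real.exp (η * (ρ - m) - (η * (ρ - m)) ^ 2) := by
    rw [← Real.exp_add]; ring_nf
  have h3 : Real.exp (η * m) * (1 - η * m) ≤ 1 := by
    have := Real.add_one_le_exp (-(η * m))
    rw [Real.exp_neg] at this
    calc Real.exp (η * m) * (1 - η * m) ≤ Real.exp (η * m) * (Real.exp (η * m))⁻¹ := by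
          gcongr; linarith
      _ = 1 := mul_inv_cancel₀ (Real.exp_pos _).ne'
  rw [h2]
  nlinarith [mul_le_mul_of_nonneg_left h1 (Real.exp_pos (η * m)).le]

theorem learningRate_le {κ L : ℝ} : learningRate κ L ≤ 1 / 4 := min_le_left _ _

theorem inv_learningRate_le {κ L : ℝ} (hκ : 0 < κ) (hL : 0 ≤ L) :
    1 / learningRate κ L ≤ 4 + Real.sqrt ((1 + L) / κ) := by
  have h : 0 < Real.sqrt (κ / (1 + L)) := Real.sqrt_pos.2 (by positivity)
  have h0 := Real.sqrt_nonneg ((1 + L) / κ)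
  unfold learningRate
  rcases min_choice (1 / 4) (Real.sqrt (κ / (1 + L))) with h1 | h1 <;> rw [h1]
  · linarith
  · rw [one_div, ← Real.sqrt_inv, inv_div]; linarith

theorem learningRate_anti {κ L L' : ℝ} (hκ : 0 < κ) (hL : 0 ≤ L) (h : L ≤ L') :
    learningRate κ L' ≤ learningRate κ L := by
  unfold learningRate
  gcongr

/-- The decay of the learning rate in one round. -/
theorem learningRate_div_le {κ L L' : ℝ} (hκ : 0 < κ) (hL : 0 ≤ L) (h : L ≤ L') :
    learningRate κ L / learningRate κ L' - 1 ≤ (L' - L) / (2 * (1 + L)) := by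
  have hL' : 0 ≤ L' := hL.trans h
  set s := Real.sqrt ((1 + L') / (1 + L)) with hs
  have hs1 : 1 ≤ s := by
    rw [hs, Real.one_le_sqrt, le_div_iff₀ (by positivity)]; linarith
  have h1 : learningRate κ L ≤ s * learningRate κ L' := by
    unfold learningRate
    rw [mul_min_of_nonneg _ _ (by linarith)]
    refine min_le_min (by linarith) ?_
    rw [hs, ← Real.sqrt_mul (by positivity)]
    apply Real.sqrt_le_sqrt
    apply le_of_eq
    field_simp
  have h2 : learningRate κ L / learningRate κ L' ≤ s := by
    rwa [div_le_iff₀ (learningRate_pos hκ hL')]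
  have h3 : s ≤ 1 + (L' - L) / (2 * (1 + L)) := by
    apply Real.sqrt_le_iff.2
    have : 0 ≤ (L' - L) / (2 * (1 + L)) := div_nonneg (by linarith) (by positivity)
    refine ⟨by linarith, ?_⟩
    have h4 : (1 + L') / (1 + L) = 1 + 2 * ((L' - L) / (2 * (1 + L))) := by
      field_simp; ring
    rw [h4]; nlinarith
  linarith

/-- The decay of the learning rates telescopes to a logarithm. The constant is `3 / 4` instead of
the asymptotic `1 / 2`, because one step of `L` may be as large as `1`. -/
theorem div_le_log_sub_log {L L' : ℝ} (hL : 0 ≤ L) (h : L ≤ L') (h1 : L' ≤ L + 1) :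
    (L' - L) / (2 * (1 + L)) ≤ 3 / 4 * (Real.log (1 + L') - Real.log (1 + L)) := by
  have h2 : 0 ≤ (L' - L) / (1 + L) := div_nonneg (by linarith) (by positivity)
  have h3 : (L' - L) / (1 + L) ≤ 1 := by rw [div_le_one (by positivity)]; linarith
  have h4 := Real.le_log_one_add_of_nonneg h2
  have h5 : 1 + (L' - L) / (1 + L) = (1 + L') / (1 + L) := by field_simp; ring
  rw [h5, Real.log_div (by linarith) (by linarith)] at h4
  set a := (L' - L) / (1 + L) with ha
  have h6 : (L' - L) / (2 * (1 + L)) = a / 2 := by rw [ha]; field_simp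
  rw [h6]
  have h7 : 2 / 3 * a ≤ 2 * a / (a + 2) := by
    rw [le_div_iff₀ (by linarith)]; nlinarith
  linarith

/-- The second-order terms telescope to a square root. -/
theorem learningRate_mul_le {κ L L' : ℝ} (hκ : 0 < κ) (hL : 0 ≤ L) (h : L ≤ L')
    (h1 : L' ≤ L + 1) :
    learningRate κ L * (L' - L) ≤ 2 * Real.sqrt κ * (Real.sqrt L' - Real.sqrt L) := by
  have hL' : 0 ≤ L' := hL.trans h
  have h2 : learningRate κ L ≤ Real.sqrt (κ / (1 + L)) := min_le_right _ _
  have h3 : L' - L = (Real.sqrt L' - Real.sqrt L) * (Real.sqrt L' + Real.sqrt L) := by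
    nlinarith [Real.sq_sqrt hL, Real.sq_sqrt hL']
  have h4 : Real.sqrt L ≤ Real.sqrt L' := Real.sqrt_le_sqrt h
  have h5 : Real.sqrt (κ / (1 + L)) * Real.sqrt L' ≤ Real.sqrt κ := by
    rw [← Real.sqrt_mul (by positivity)]
    apply Real.sqrt_le_sqrt
    rw [div_mul_eq_mul_div, div_le_iff₀ (by positivity)]
    gcongr
    linarith
  have h6 : 0 ≤ Real.sqrt (κ / (1 + L)) := Real.sqrt_nonneg _
  calc learningRate κ L * (L' - L) ≤ Real.sqrt (κ / (1 + L)) * (L' - L) := by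
        gcongr
    _ ≤ Real.sqrt (κ / (1 + L)) * ((Real.sqrt L' - Real.sqrt L) * (2 * Real.sqrt L')) := by
        rw [h3]
        gcongr
        · linarith
    _ = 2 * (Real.sqrt (κ / (1 + L)) * Real.sqrt L') * (Real.sqrt L' - Real.sqrt L) := by ring
    _ ≤ _ := by
        gcongr

/-! ### Optimistic-Adapt-ML-Prod with sleeping experts -/

/-- A run of Optimistic-Adapt-ML-Prod in which every expert `i` is awake exactly in the rounds
`birth i, …, death i`, all outputs of awake experts lie in `Ω`, and the losses satisfy the
boundedness assumptions. -/
structure IsSleepingRun {d : ℕ} {ι : Type} (Ω : Set (Space d)) (G D : ℝ) (r : Space d → ℝ)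
    (g : ℕ → Space d → Space d) (active : ℕ → Finset ι) (birth death : ι → ℕ) (κ x₀ : ι → ℝ)
    (first last : ℕ) (y : ℕ → ι → Space d)
    (w : ℕ → Space d) (x L p m ℓ : ℕ → ι → ℝ) (ℓbar : ℕ → ℝ) : Prop where
  isMeta : IsOptAdaptMLProd G D r g active birth κ x₀ first last y w x L p m ℓ ℓbar
  G_pos : 0 < G
  D_pos : 0 < D
  convex : Convex ℝ Ω
  diam : ∀ x ∈ Ω, ∀ y ∈ Ω, ‖x - y‖ ≤ D
  grad_le : ∀ t ∈ Finset.Icc first last, ∀ x ∈ Ω, ‖g t x‖ ≤ G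
  reg_convex : ConvexOn ℝ Ω r
  mem_active : ∀ t ∈ Finset.Icc first last, ∀ i, i ∈ active t ↔ birth i ≤ t ∧ t ≤ death i
  active_nonempty : ∀ t ∈ Finset.Icc first last, (active t).Nonempty
  y_mem : ∀ t ∈ Finset.Icc first last, ∀ i ∈ active t, y t i ∈ Ω
  first_le : ∀ i, first ≤ birth i
  κ_pos : ∀ i, 0 < κ i
  x₀_pos : ∀ i, 0 < x₀ i

/-- The difference of two points, tested against a gradient, is at most `G D`. -/
theorem abs_inner_sub_le {d : ℕ} {Ω : Set (Space d)} {G D : ℝ}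
    (hdiam : ∀ x ∈ Ω, ∀ y ∈ Ω, ‖x - y‖ ≤ D) {v a b : Space d} (hv : ‖v‖ ≤ G)
    (ha : a ∈ Ω) (hb : b ∈ Ω) : |inner ℝ v (a - b)| ≤ G * D :=
  (abs_real_inner_le_norm _ _).trans
    (mul_le_mul hv (hdiam a ha b hb) (norm_nonneg _) ((norm_nonneg _).trans hv))

namespace IsSleepingRun

variable {d : ℕ} {ι : Type} {Ω : Set (Space d)} {G D : ℝ} {r : Space d → ℝ}
  {g : ℕ → Space d → Space d} {active : ℕ → Finset ι} {birth death : ι → ℕ} {κ x₀ : ι → ℝ}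
  {first last : ℕ} {y : ℕ → ι → Space d}
  {w : ℕ → Space d} {x L p m ℓ : ℕ → ι → ℝ} {ℓbar : ℕ → ℝ}

theorem pos_and_nonneg
    (h : IsSleepingRun Ω G D r g active birth death κ x₀ first last y w x L p m ℓ ℓbar)
    {i : ι} {t : ℕ} (h1 : birth i ≤ t) (h2 : t ≤ death i + 1) (h3 : t ≤ last + 1) :
    0 < x t i ∧ 0 ≤ L t i := by
  induction t, h1 using Nat.le_induction with
  | base => rw [h.isMeta.x_init, h.isMeta.L_init]; exact ⟨h.x₀_pos i, le_rfl⟩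
  | succ t ht ih =>
    obtain ⟨ih1, ih2⟩ := ih (by omega) (by omega)
    have hf := h.first_le i
    have ht' : t ∈ Finset.Icc first last := Finset.mem_Icc.2 ⟨by omega, by omega⟩
    have hi : i ∈ active t := (h.mem_active t ht' i).2 ⟨ht, by omega⟩
    rw [h.isMeta.x_next t ht' i hi, h.isMeta.L_next t ht' i hi]
    exact ⟨Real.rpow_pos_of_pos (mul_pos ih1 (Real.exp_pos _)) _, by positivity⟩

theorem pos_and_nonneg_of_active
    (h : IsSleepingRun Ω G D r g active birth death κ x₀ first last y w x L p m ℓ ℓbar)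
    {i : ι} {t : ℕ} (ht : t ∈ Finset.Icc first last) (hi : i ∈ active t) :
    0 < x t i ∧ 0 ≤ L t i := by
  obtain ⟨h1, h2⟩ := (h.mem_active t ht i).1 hi
  exact h.pos_and_nonneg h1 (by omega) (by have := (Finset.mem_Icc.1 ht).2; omega)

theorem numerator_pos
    (h : IsSleepingRun Ω G D r g active birth death κ x₀ first last y w x L p m ℓ ℓbar)
    {i : ι} {t : ℕ} (ht : t ∈ Finset.Icc first last) (hi : i ∈ active t) :
    0 < learningRate (κ i) (L t i) *
      (x t i * Real.exp (learningRate (κ i) (L t i) * m t i)) := by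
  obtain ⟨h1, h2⟩ := h.pos_and_nonneg_of_active ht hi
  have := learningRate_pos (h.κ_pos i) h2
  positivity

theorem denominator_pos
    (h : IsSleepingRun Ω G D r g active birth death κ x₀ first last y w x L p m ℓ ℓbar)
    {t : ℕ} (ht : t ∈ Finset.Icc first last) :
    0 < ∑ j ∈ active t, learningRate (κ j) (L t j) *
      (x t j * Real.exp (learningRate (κ j) (L t j) * m t j)) :=
  Finset.sum_pos (fun _ hj => h.numerator_pos ht hj) (h.active_nonempty t ht)

theorem weight_pos
    (h : IsSleepingRun Ω G D r g active birth death κ x₀ first last y w x L p m ℓ ℓbar)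
    {i : ι} {t : ℕ} (ht : t ∈ Finset.Icc first last) (hi : i ∈ active t) : 0 < p t i := by
  rw [h.isMeta.weight t ht i hi]
  exact div_pos (h.numerator_pos ht hi) (h.denominator_pos ht)

theorem sum_weight
    (h : IsSleepingRun Ω G D r g active birth death κ x₀ first last y w x L p m ℓ ℓbar)
    {t : ℕ} (ht : t ∈ Finset.Icc first last) : ∑ i ∈ active t, p t i = 1 := by
  rw [Finset.sum_congr rfl (h.isMeta.weight t ht), ← Finset.sum_div]
  exact div_self (h.denominator_pos ht).ne'

theorem decision_mem
    (h : IsSleepingRun Ω G D r g active birth death κ x₀ first last y w x L p m ℓ ℓbar)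
    {t : ℕ} (ht : t ∈ Finset.Icc first last) : w t ∈ Ω := by
  rw [h.isMeta.decision t ht]
  exact h.convex.sum_mem (fun i hi => (h.weight_pos ht hi).le) (h.sum_weight ht) (h.y_mem t ht)

/-- The linear parts of the expert losses average to zero, as the decision is the weighted mean of
the outputs. -/
theorem metaLoss_eq
    (h : IsSleepingRun Ω G D r g active birth death κ x₀ first last y w x L p m ℓ ℓbar)
    {t : ℕ} (ht : t ∈ Finset.Icc first last) :
    ℓbar t = 1 / (G * D) * ∑ i ∈ active t, p t i * r (y t i) := by
  have h1 : ∑ i ∈ active t, p t i * inner ℝ (g t (w t)) (y t i - w t) = 0 := by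
    have h2 : ∀ i, p t i * inner ℝ (g t (w t)) (y t i - w t) =
        inner ℝ (g t (w t)) (p t i • y t i) - p t i * inner ℝ (g t (w t)) (w t) := by
      intro i; rw [inner_sub_right, inner_smul_right]; ring
    simp only [h2]
    rw [Finset.sum_sub_distrib, ← inner_sum, ← h.isMeta.decision t ht, ← Finset.sum_mul,
      h.sum_weight ht, one_mul, sub_self]
  rw [h.isMeta.metaLoss t ht]
  have h3 : ∀ i ∈ active t, p t i * ℓ t i = 1 / (G * D) *
      (p t i * inner ℝ (g t (w t)) (y t i - w t) + p t i * r (y t i)) := by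
    intro i hi; rw [h.isMeta.loss t ht i hi]; ring
  rw [Finset.sum_congr rfl h3, ← Finset.mul_sum, Finset.sum_add_distrib, h1, zero_add]

/-- The optimism cancels the regularizer: what remains is the linearized loss. -/
theorem deviation_eq
    (h : IsSleepingRun Ω G D r g active birth death κ x₀ first last y w x L p m ℓ ℓbar)
    {i : ι} {t : ℕ} (ht : t ∈ Finset.Icc first last) (hi : i ∈ active t) :
    ℓbar t - ℓ t i - m t i = 1 / (G * D) * inner ℝ (g t (w t)) (w t - y t i) := by
  rw [h.metaLoss_eq ht, h.isMeta.loss t ht i hi, h.isMeta.optimism t ht i hi,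
    ← neg_sub (y t i), inner_neg_right]
  ring

theorem abs_deviation_le
    (h : IsSleepingRun Ω G D r g active birth death κ x₀ first last y w x L p m ℓ ℓbar)
    {i : ι} {t : ℕ} (ht : t ∈ Finset.Icc first last) (hi : i ∈ active t) :
    |ℓbar t - ℓ t i - m t i| ≤ 1 := by
  have hGD := mul_pos h.G_pos h.D_pos
  rw [h.deviation_eq ht hi, abs_mul, abs_of_pos (by positivity), one_div, inv_mul_le_iff₀ hGD,
    mul_one]
  exact abs_inner_sub_le h.diam (h.grad_le t ht _ (h.decision_mem ht)) (h.decision_mem ht)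
    (h.y_mem t ht i hi)

/-- The instantaneous regret of the meta-algorithm dominates the linearized composite regret. -/
theorem linearized_le
    (h : IsSleepingRun Ω G D r g active birth death κ x₀ first last y w x L p m ℓ ℓbar)
    {i : ι} {t : ℕ} (ht : t ∈ Finset.Icc first last) (hi : i ∈ active t) :
    inner ℝ (g t (w t)) (w t - y t i) + (r (w t) - r (y t i)) ≤
      G * D * (ℓbar t - ℓ t i) := by
  have hGD := mul_pos h.G_pos h.D_pos
  have h1 : r (w t) ≤ ∑ i ∈ active t, p t i * r (y t i) := by
    rw [h.isMeta.decision t ht]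
    have := h.reg_convex.map_sum_le (fun i hi => (h.weight_pos ht hi).le) (h.sum_weight ht)
      (h.y_mem t ht)
    simpa only [smul_eq_mul] using this
  rw [h.metaLoss_eq ht, h.isMeta.loss t ht i hi, ← neg_sub (y t i), inner_neg_right, ← mul_sub,
    ← mul_assoc, mul_one_div_cancel hGD.ne', one_mul]
  linarith

theorem L_step
    (h : IsSleepingRun Ω G D r g active birth death κ x₀ first last y w x L p m ℓ ℓbar)
    {i : ι} {t : ℕ} (ht : t ∈ Finset.Icc first last) (hi : i ∈ active t) :
    L t i ≤ L (t + 1) i ∧ L (t + 1) i ≤ L t i + 1 := by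
  rw [h.isMeta.L_next t ht i hi]
  have h1 := (sq_le_one_iff_abs_le_one _).2 (h.abs_deviation_le ht hi)
  exact ⟨by nlinarith [sq_nonneg (ℓbar t - ℓ t i - m t i)], by linarith⟩

/-- One round increases the total potential at most by the decay of the learning rates. -/
theorem sum_potential_step
    (h : IsSleepingRun Ω G D r g active birth death κ x₀ first last y w x L p m ℓ ℓbar)
    {t : ℕ} (ht : t ∈ Finset.Icc first last) :
    ∑ i ∈ active t, x (t + 1) i ≤ ∑ i ∈ active t, (x t i + 1 / Real.exp 1 *
      ((L (t + 1) i - L t i) / (2 * (1 + L t i)))) := by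
  set W := ∑ j ∈ active t, learningRate (κ j) (L t j) *
      (x t j * Real.exp (learningRate (κ j) (L t j) * m t j)) with hW
  have hW0 : 0 < W := h.denominator_pos ht
  -- the first-order terms cancel, because the weights are proportional to `η x exp (η m)`
  have hzero : ∑ i ∈ active t, W * (p t i * (ℓbar t - ℓ t i)) = 0 := by
    have h1 : ∀ i ∈ active t, W * (p t i * (ℓbar t - ℓ t i)) =
        W * (p t i * ℓbar t) - W * (p t i * ℓ t i) := fun i _ => by ring
    rw [Finset.sum_congr rfl h1, Finset.sum_sub_distrib, ← Finset.mul_sum, ← Finset.mul_sum,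
      ← h.isMeta.metaLoss t ht, ← Finset.sum_mul, h.sum_weight ht]
    ring
  have key : ∀ i ∈ active t, x (t + 1) i ≤ (x t i + 1 / Real.exp 1 *
      ((L (t + 1) i - L t i) / (2 * (1 + L t i)))) + W * (p t i * (ℓbar t - ℓ t i)) := by
    intro i hi
    obtain ⟨hx, hL⟩ := h.pos_and_nonneg_of_active ht hi
    obtain ⟨hL1, -⟩ := h.L_step ht hi
    have hη := learningRate_pos (h.κ_pos i) hL
    have hη' := learningRate_pos (h.κ_pos i) (hL.trans hL1)
    have hdiv := learningRate_div_le (h.κ_pos i) hL hL1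
    have hanti := learningRate_anti (h.κ_pos i) hL hL1
    have hdev : |learningRate (κ i) (L t i) * (ℓbar t - ℓ t i - m t i)| ≤ 1 / 4 := by
      rw [abs_mul, abs_of_pos hη]
      calc _ ≤ 1 / 4 * 1 := mul_le_mul learningRate_le (h.abs_deviation_le ht hi)
            (abs_nonneg _) (by norm_num)
        _ = 1 / 4 := by norm_num
    have hexp := exp_optimistic_le hdev
    have hxn := h.isMeta.x_next t ht i hi
    set η := learningRate (κ i) (L t i)
    set η' := learningRate (κ i) (L (t + 1) i)
    have hbase : 0 < x t i * Real.exp (η * (ℓbar t - ℓ t i) -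
        (η * (ℓbar t - ℓ t i - m t i)) ^ 2) := mul_pos hx (Real.exp_pos _)
    have hpow : x (t + 1) i ^ (η / η') = x t i * Real.exp (η * (ℓbar t - ℓ t i) -
        (η * (ℓbar t - ℓ t i - m t i)) ^ 2) := by
      rw [hxn, ← Real.rpow_mul hbase.le, div_mul_div_cancel₀ hη.ne', div_self hη'.ne',
        Real.rpow_one]
    have hxpos : 0 < x (t + 1) i := by rw [hxn]; exact Real.rpow_pos_of_pos hbase _
    have h1 := le_rpow_add (a := η / η') hxpos (by rwa [one_le_div hη'])
    rw [hpow] at h1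
    have h2 : W * (p t i * (ℓbar t - ℓ t i)) =
        x t i * (η * Real.exp (η * m t i) * (ℓbar t - ℓ t i)) := by
      rw [h.isMeta.weight t ht i hi, ← mul_assoc, mul_div_cancel₀ _ hW0.ne']
      ring
    have h3 := mul_le_mul_of_nonneg_left hexp hx.le
    have h4 : (η / η' - 1) / Real.exp 1 ≤ 1 / Real.exp 1 *
        ((L (t + 1) i - L t i) / (2 * (1 + L t i))) := by
      rw [div_eq_mul_one_div, mul_comm]
      gcongr
    rw [h2]
    linarith
  calc ∑ i ∈ active t, x (t + 1) i ≤ ∑ i ∈ active t, ((x t i + 1 / Real.exp 1 *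
      ((L (t + 1) i - L t i) / (2 * (1 + L t i)))) + W * (p t i * (ℓbar t - ℓ t i))) :=
        Finset.sum_le_sum key
    _ = _ := by rw [Finset.sum_add_distrib, hzero, add_zero]

/-- Extending every potential by a constant before the birth and after the death of the expert,
the total potential of a finite set `S` of experts grows at most by the accumulated decay of the
learning rates. -/
theorem sum_frozen_potential_le
    (h : IsSleepingRun Ω G D r g active birth death κ x₀ first last y w x L p m ℓ ℓbar)
    (S : Finset ι) {t : ℕ} (h1 : first ≤ t) (h2 : t ≤ last + 1)
    (hbd : ∀ i ∈ S, birth i ≤ death i)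
    (hS : ∀ s ∈ Finset.Ico first t, active s ⊆ S) :
    ∑ i ∈ S, x (max (birth i) (min t (death i + 1))) i ≤ ∑ i ∈ S, x₀ i +
      1 / Real.exp 1 * ∑ s ∈ Finset.Ico first t, ∑ i ∈ active s,
        (L (s + 1) i - L s i) / (2 * (1 + L s i)) := by
  classical
  induction t, h1 using Nat.le_induction with
  | base =>
    rw [Finset.Ico_self, Finset.sum_empty, mul_zero, add_zero]
    refine le_of_eq (Finset.sum_congr rfl fun i _ => ?_)
    have := h.first_le i
    rw [max_eq_left (by omega), h.isMeta.x_init]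
  | succ t ht ih =>
    have ih' := ih (by omega) (fun s hs => hS s (by
      rw [Finset.mem_Ico] at hs ⊢; omega))
    have ht' : t ∈ Finset.Icc first last := Finset.mem_Icc.2 ⟨ht, by omega⟩
    have hsub : active t ⊆ S := hS t (by rw [Finset.mem_Ico]; omega)
    have hstep := h.sum_potential_step ht'
    rw [Finset.sum_add_distrib, ← Finset.mul_sum] at hstep
    rw [Finset.sum_Ico_succ_top ht, mul_add]
    have e1 : ∀ i ∈ active t, x (max (birth i) (min (t + 1) (death i + 1))) i = x (t + 1) i ∧
        x (max (birth i) (min t (death i + 1))) i = x t i := by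
      intro i hi
      obtain ⟨h3, h4⟩ := (h.mem_active t ht' i).1 hi
      constructor <;> congr 1 <;> omega
    have e2 : ∀ i ∈ S \ active t, x (max (birth i) (min (t + 1) (death i + 1))) i =
        x (max (birth i) (min t (death i + 1))) i := by
      intro i hi
      rw [Finset.mem_sdiff, h.mem_active t ht' i] at hi
      have := hbd i hi.1
      congr 1
      omega
    rw [← Finset.sum_sdiff hsub, Finset.sum_congr rfl e2,
      Finset.sum_congr rfl (fun i hi => (e1 i hi).1)]
    rw [← Finset.sum_sdiff hsub (f := fun i => x (max (birth i) (min t (death i + 1))) i),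
      Finset.sum_congr rfl (fun i hi => (e1 i hi).2)] at ih'
    linarith

/-- The potential of a single expert is at most the total potential. -/
theorem potential_le
    (h : IsSleepingRun Ω G D r g active birth death κ x₀ first last y w x L p m ℓ ℓbar)
    (S : Finset ι) {t : ℕ} (h1 : first ≤ t) (h2 : t ≤ last + 1)
    (hbd : ∀ i ∈ S, birth i ≤ death i)
    (hS : ∀ s ∈ Finset.Ico first t, active s ⊆ S) {i : ι} (hi : i ∈ S)
    (hit : birth i ≤ t) (hti : t ≤ death i + 1) :
    x t i ≤ ∑ i ∈ S, x₀ i +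
      1 / Real.exp 1 * ∑ s ∈ Finset.Ico first t, ∑ i ∈ active s,
        (L (s + 1) i - L s i) / (2 * (1 + L s i)) := by
  refine le_trans ?_ (h.sum_frozen_potential_le S h1 h2 hbd hS)
  have h3 : x t i = x (max (birth i) (min t (death i + 1))) i := by congr 1; omega
  rw [h3]
  refine Finset.single_le_sum (f := fun i => x (max (birth i) (min t (death i + 1))) i)
    (fun j hj => ?_) hi
  have := hbd j hj
  by_cases hb : birth j ≤ t
  · exact (h.pos_and_nonneg (by omega) (by omega) (by omega)).1.le
  · rw [show max (birth j) (min t (death j + 1)) = birth j by omega, h.isMeta.x_init]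
    exact (h.x₀_pos j).le

/-- The regret of the meta-algorithm against an expert is the logarithm of the potential of that
expert, up to second-order terms. -/
theorem sum_regret_eq
    (h : IsSleepingRun Ω G D r g active birth death κ x₀ first last y w x L p m ℓ ℓbar)
    {i : ι} {t : ℕ} (h1 : birth i ≤ t) (h2 : t ≤ death i + 1) (h3 : t ≤ last + 1) :
    ∑ s ∈ Finset.Ico (birth i) t, (ℓbar s - ℓ s i) =
      Real.log (x t i) / learningRate (κ i) (L t i) -
        Real.log (x₀ i) / learningRate (κ i) 0 +
        ∑ s ∈ Finset.Ico (birth i) t, learningRate (κ i) (L s i) * (L (s + 1) i - L s i) := by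
  induction t, h1 using Nat.le_induction with
  | base => simp [h.isMeta.x_init, h.isMeta.L_init]
  | succ t ht ih =>
    have hf := h.first_le i
    have ht' : t ∈ Finset.Icc first last := Finset.mem_Icc.2 ⟨by omega, by omega⟩
    have hi : i ∈ active t := (h.mem_active t ht' i).2 ⟨ht, by omega⟩
    obtain ⟨hx, hL⟩ := h.pos_and_nonneg_of_active ht' hi
    have hη := learningRate_pos (h.κ_pos i) hL
    have hη' := learningRate_pos (h.κ_pos i) (hL.trans (h.L_step ht' hi).1)
    rw [Finset.sum_Ico_succ_top ht, Finset.sum_Ico_succ_top ht, ih (by omega) (by omega)]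
    have hlog : Real.log (x (t + 1) i) / learningRate (κ i) (L (t + 1) i) =
        (Real.log (x t i) + (learningRate (κ i) (L t i) * (ℓbar t - ℓ t i) -
        (learningRate (κ i) (L t i) * (ℓbar t - ℓ t i - m t i)) ^ 2)) /
          learningRate (κ i) (L t i) := by
      rw [h.isMeta.x_next t ht' i hi, Real.log_rpow (mul_pos hx (Real.exp_pos _)),
        Real.log_mul hx.ne' (Real.exp_pos _).ne', Real.log_exp]
      field_simp
    rw [hlog, h.isMeta.L_next t ht' i hi]
    field_simp
    ring

/-- Up to normalization, `L` accumulates the squared linearized losses relative to the expert. -/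
theorem L_eq
    (h : IsSleepingRun Ω G D r g active birth death κ x₀ first last y w x L p m ℓ ℓbar)
    {i : ι} {t : ℕ} (h1 : birth i ≤ t) (h2 : t ≤ death i + 1) (h3 : t ≤ last + 1) :
    (G * D) ^ 2 * L t i =
      ∑ s ∈ Finset.Ico (birth i) t, inner ℝ (g s (w s)) (w s - y s i) ^ 2 := by
  have hGD := mul_pos h.G_pos h.D_pos
  induction t, h1 using Nat.le_induction with
  | base => simp [h.isMeta.L_init]
  | succ t ht ih =>
    have hf := h.first_le i
    have ht' : t ∈ Finset.Icc first last := Finset.mem_Icc.2 ⟨by omega, by omega⟩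
    have hi : i ∈ active t := (h.mem_active t ht' i).2 ⟨ht, by omega⟩
    rw [Finset.sum_Ico_succ_top ht, ← ih (by omega) (by omega), h.isMeta.L_next t ht' i hi,
      h.deviation_eq ht' hi, mul_add, ← mul_pow, ← mul_assoc, mul_one_div_cancel hGD.ne', one_mul]

theorem L_le
    (h : IsSleepingRun Ω G D r g active birth death κ x₀ first last y w x L p m ℓ ℓbar)
    {i : ι} {t : ℕ} (h1 : birth i ≤ t) (h2 : t ≤ death i + 1) (h3 : t ≤ last + 1) :
    L t i ≤ (t : ℝ) - birth i := by
  induction t, h1 using Nat.le_induction with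
  | base => simp [h.isMeta.L_init]
  | succ t ht ih =>
    have hf := h.first_le i
    have ht' : t ∈ Finset.Icc first last := Finset.mem_Icc.2 ⟨by omega, by omega⟩
    have hi : i ∈ active t := (h.mem_active t ht' i).2 ⟨ht, by omega⟩
    have := (h.L_step ht' hi).2
    have := ih (by omega) (by omega)
    push_cast
    linarith

theorem sum_learningRate_mul_le
    (h : IsSleepingRun Ω G D r g active birth death κ x₀ first last y w x L p m ℓ ℓbar)
    {i : ι} {t : ℕ} (h1 : birth i ≤ t) (h2 : t ≤ death i + 1) (h3 : t ≤ last + 1) :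
    ∑ s ∈ Finset.Ico (birth i) t, learningRate (κ i) (L s i) * (L (s + 1) i - L s i) ≤
      2 * Real.sqrt (κ i) * Real.sqrt (L t i) := by
  induction t, h1 using Nat.le_induction with
  | base => simp [h.isMeta.L_init]
  | succ t ht ih =>
    have hf := h.first_le i
    have ht' : t ∈ Finset.Icc first last := Finset.mem_Icc.2 ⟨by omega, by omega⟩
    have hi : i ∈ active t := (h.mem_active t ht' i).2 ⟨ht, by omega⟩
    obtain ⟨hL1, hL2⟩ := h.L_step ht' hi
    have h4 := learningRate_mul_le (h.κ_pos i) (h.pos_and_nonneg_of_active ht' hi).2 hL1 hL2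
    rw [Finset.sum_Ico_succ_top ht]
    have := ih (by omega) (by omega)
    linarith

theorem sum_decay_le
    (h : IsSleepingRun Ω G D r g active birth death κ x₀ first last y w x L p m ℓ ℓbar)
    {i : ι} {t : ℕ} (h1 : birth i ≤ t) (h2 : t ≤ death i + 1) (h3 : t ≤ last + 1) :
    ∑ s ∈ Finset.Ico (birth i) t, (L (s + 1) i - L s i) / (2 * (1 + L s i)) ≤
      3 / 4 * Real.log (1 + L t i) := by
  induction t, h1 using Nat.le_induction with
  | base => simp [h.isMeta.L_init]
  | succ t ht ih =>
    have hf := h.first_le i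
    have ht' : t ∈ Finset.Icc first last := Finset.mem_Icc.2 ⟨by omega, by omega⟩
    have hi : i ∈ active t := (h.mem_active t ht' i).2 ⟨ht, by omega⟩
    obtain ⟨hL1, hL2⟩ := h.L_step ht' hi
    have h4 := div_le_log_sub_log (h.pos_and_nonneg_of_active ht' hi).2 hL1 hL2
    rw [Finset.sum_Ico_succ_top ht]
    have := ih (by omega) (by omega)
    linarith

end IsSleepingRun

/-! ### First-order inequalities -/

/-- A function on `[0, 1]` that lies below its chord has slope at most that of the chord at `0`. -/
theorem slope_le_of_below_chord {φ : ℝ → ℝ} {c : ℝ} (hφ : HasDerivWithinAt φ c (Set.Icc 0 1) 0)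
    (h : ∀ τ ∈ Set.Icc (0 : ℝ) 1, φ τ ≤ (1 - τ) * φ 0 + τ * φ 1) : c ≤ φ 1 - φ 0 := by
  have h1 : HasDerivWithinAt φ c (Set.Ioo 0 1) 0 := hφ.mono Set.Ioo_subset_Icc_self
  rw [hasDerivWithinAt_iff_tendsto_slope' (by simp)] at h1
  have : (nhdsWithin (0 : ℝ) (Set.Ioo 0 1)).NeBot := by
    rw [nhdsWithin_Ioo_eq_nhdsGT one_pos]; infer_instance
  refine le_of_tendsto h1 ?_
  filter_upwards [self_mem_nhdsWithin] with τ hτ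
  rw [slope_def_field, sub_zero, div_le_iff₀ hτ.1]
  have := h τ ⟨hτ.1.le, hτ.2.le⟩
  linarith

theorem hasDerivWithinAt_segment {d : ℕ} {Ω : Set (Space d)} (hΩ : Convex ℝ Ω)
    {f : Space d → ℝ} {v x y : Space d} (hf : HasGradientWithinAt f v Ω x) (hx : x ∈ Ω)
    (hy : y ∈ Ω) :
    HasDerivWithinAt (fun τ : ℝ => f (x + τ • (y - x))) (inner ℝ v (y - x)) (Set.Icc 0 1) 0 := by
  have h1 : HasDerivWithinAt (fun τ : ℝ => x + τ • (y - x)) (y - x) (Set.Icc 0 1) 0 := by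
    simpa using (((hasDerivAt_id (0 : ℝ)).smul_const (y - x)).const_add x).hasDerivWithinAt
  have h2 : Set.MapsTo (fun τ : ℝ => x + τ • (y - x)) (Set.Icc 0 1) Ω :=
    fun τ hτ => hΩ.add_smul_sub_mem hx hy hτ
  have h3 : HasFDerivWithinAt f (InnerProductSpace.toDual ℝ (Space d) v) Ω
      (x + (0 : ℝ) • (y - x)) := by
    simpa using hf.hasFDerivWithinAt
  exact h3.comp_hasDerivWithinAt (0 : ℝ) h1 h2

/-- The gradient is only a gradient within `Ω`, so the difference quotients run along segments. -/
theorem first_order_of_convexOn {d : ℕ} {Ω : Set (Space d)} {f : Space d → ℝ}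
    (hc : ConvexOn ℝ Ω f) {v x y : Space d} (hf : HasGradientWithinAt f v Ω x) (hx : x ∈ Ω)
    (hy : y ∈ Ω) : f x - f y ≤ inner ℝ v (x - y) := by
  have h := slope_le_of_below_chord (hasDerivWithinAt_segment hc.1 hf hx hy) (by
    intro τ hτ
    have := hc.2 hx hy (sub_nonneg.2 hτ.2) hτ.1 (by ring)
    simp only [smul_eq_mul] at this
    rw [show x + τ • (y - x) = (1 - τ) • x + τ • y by module]
    simpa using this)
  simp only [one_smul, zero_smul, add_zero, add_sub_cancel] at h
  rw [← neg_sub y x, inner_neg_right]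
  linarith

/-- Exp-concave functions with bounded gradients lie above a quadratic in the direction of the
gradient. -/
theorem first_order_of_expConcaveOn {d : ℕ} {Ω : Set (Space d)} {f : Space d → ℝ} {α G D : ℝ}
    (hα : 0 < α) (hG : 0 < G) (hD : 0 < D) (hc : ExpConcaveOn α Ω f)
    (hdiam : ∀ x ∈ Ω, ∀ y ∈ Ω, ‖x - y‖ ≤ D) {v x y : Space d}
    (hf : HasGradientWithinAt f v Ω x) (hv : ‖v‖ ≤ G) (hx : x ∈ Ω) (hy : y ∈ Ω) :
    f x - f y ≤ inner ℝ v (x - y) - onsBeta G D α / 2 * inner ℝ v (x - y) ^ 2 := by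
  have hder := hasDerivWithinAt_segment hc.1 hf hx hy
  have hder' := ((hder.const_mul (-α)).exp).neg
  have h := slope_le_of_below_chord hder' (by
    intro τ hτ
    have := hc.2 hx hy (sub_nonneg.2 hτ.2) hτ.1 (by ring)
    simp only [smul_eq_mul] at this
    simp only [Pi.neg_apply, zero_smul, add_zero, one_smul, add_sub_cancel]
    rw [show x + τ • (y - x) = (1 - τ) • x + τ • y by module]
    linarith)
  simp only [Pi.neg_apply, one_smul, zero_smul, add_zero, add_sub_cancel] at h
  have hz' := abs_inner_sub_le hdiam hv hx hy
  set z := inner ℝ v (x - y) with hz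
  have hzn : inner ℝ v (y - x) = -z := by rw [hz, ← neg_sub x y, inner_neg_right]
  rw [hzn] at h
  have h1 : Real.exp (α * (f x - f y)) ≤ 1 + α * z := by
    have h2 : Real.exp (-α * f y) = Real.exp (-α * f x) * Real.exp (α * (f x - f y)) := by
      rw [← Real.exp_add]; ring_nf
    rw [h2] at h
    have h3 := Real.exp_pos (-α * f x)
    by_contra! h4
    nlinarith [mul_lt_mul_of_pos_left h4 h3]
  have hGD : 0 < G * D := mul_pos hG hD
  set γ := min (1 / (4 * G * D)) α with hγ
  have hγ0 : 0 < γ := lt_min (by positivity) hα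
  have hγα : γ ≤ α := min_le_right _ _
  have hγG : γ ≤ 1 / (4 * G * D) := min_le_left _ _
  -- exp-concavity with a smaller parameter, by Bernoulli's inequality
  have h5 : Real.exp (γ * (f x - f y)) ≤ 1 + γ * z := by
    have h6 : Real.exp (γ * (f x - f y)) = Real.exp (α * (f x - f y)) ^ (γ / α) := by
      rw [← Real.exp_mul]; congr 1; field_simp
    rw [h6]
    calc Real.exp (α * (f x - f y)) ^ (γ / α) ≤ (1 + α * z) ^ (γ / α) := by
          gcongr
      _ ≤ 1 + γ / α * (α * z) := by
          apply rpow_one_add_le_one_add_mul_self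
          · have := Real.exp_pos (α * (f x - f y)); linarith
          · positivity
          · rwa [div_le_one hα]
      _ = 1 + γ * z := by field_simp
  have h6 : |(-(γ * z))| ≤ 1 / 4 := by
    rw [abs_neg, abs_mul, abs_of_pos hγ0]
    calc γ * |z| ≤ 1 / (4 * G * D) * (G * D) := by gcongr
      _ = 1 / 4 := by field_simp
  have h7 := add_sq_div_four_le_neg_log h6
  have h8 : γ * (f x - f y) ≤ Real.log (1 + γ * z) := by
    rwa [Real.le_log_iff_exp_le (lt_of_lt_of_le (Real.exp_pos _) h5)]
  rw [sub_neg_eq_add] at h7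
  have h9 : γ * (f x - f y) ≤ γ * (z - γ / 4 * z ^ 2) := by nlinarith
  have h10 := le_of_mul_le_mul_left h9 hγ0
  unfold onsBeta
  rw [← hγ]
  linarith

/-! ### Proximal steps -/

theorem quadForm_combo {d : ℕ} (A : Matrix (Fin d) (Fin d) ℝ) (a b : Space d) (τ : ℝ) :
    quadForm A ((1 - τ) • a + τ • b) =
      (1 - τ) * quadForm A a + τ * quadForm A b - τ * (1 - τ) * quadForm A (b - a) := by
  unfold quadForm
  simp only [WithLp.ofLp_add, WithLp.ofLp_smul, WithLp.ofLp_sub, Matrix.mulVec_add,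
    Matrix.mulVec_sub, Matrix.mulVec_smul, add_dotProduct, dotProduct_add, sub_dotProduct,
    dotProduct_sub, smul_dotProduct, dotProduct_smul, smul_eq_mul]
  ring

theorem quadForm_sub_comm {d : ℕ} (A : Matrix (Fin d) (Fin d) ℝ) (a b : Space d) :
    quadForm A (a - b) = quadForm A (b - a) := by
  unfold quadForm
  rw [← neg_sub b a, WithLp.ofLp_neg, Matrix.mulVec_neg, neg_dotProduct_neg]

theorem quadForm_one {d : ℕ} (u : Space d) : quadForm 1 u = ‖u‖ ^ 2 := by
  unfold quadForm
  rw [Matrix.one_mulVec, EuclideanSpace.real_norm_sq_eq]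
  simp [dotProduct, sq]

theorem quadForm_smul_one {d : ℕ} (c : ℝ) (u : Space d) :
    quadForm (c • 1) u = c * ‖u‖ ^ 2 := by
  rw [← quadForm_one]
  unfold quadForm
  rw [Matrix.smul_mulVec, dotProduct_smul, smul_eq_mul]

theorem inner_eq_dotProduct {d : ℕ} (u v : Space d) :
    inner ℝ u v = WithLp.ofLp u ⬝ᵥ WithLp.ofLp v := by
  simp [PiLp.inner_apply, dotProduct, mul_comm]

theorem quadForm_add_outerSelf {d : ℕ} (A : Matrix (Fin d) (Fin d) ℝ) (v u : Space d) :
    quadForm (A + outerSelf v) u = quadForm A u + inner ℝ v u ^ 2 := by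
  unfold quadForm outerSelf
  rw [Matrix.add_mulVec, dotProduct_add, Matrix.vecMulVec_mulVec, inner_eq_dotProduct,
    dotProduct_smul, dotProduct_comm (WithLp.ofLp u) (WithLp.ofLp v)]
  simp [sq]

/-- The three-point inequality for a proximal step. -/
theorem IsProxONSStep.le {d : ℕ} {Ω : Set (Space d)} {R : Space d → ℝ} (hR : ConvexOn ℝ Ω R)
    {β : ℝ} {A : Matrix (Fin d) (Fin d) ℝ} {v z z' : Space d}
    (h : IsProxONSStep Ω R β A v z z') {u : Space d} (hu : u ∈ Ω) :
    inner ℝ v (z' - u) + (R z' - R u) ≤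
      β / 2 * (quadForm A (u - z) - quadForm A (u - z') - quadForm A (z' - z)) := by
  obtain ⟨hz', hmin⟩ := h
  have hmin' := isMinOn_iff.1 hmin
  -- compare with the points of the segment from `z'` to `u` and let them tend to `z'`
  set δ := (inner ℝ v u + R u + β / 2 * quadForm A (u - z)) -
    (inner ℝ v z' + R z' + β / 2 * quadForm A (z' - z)) with hδ
  have key : ∀ τ ∈ Set.Ioo (0 : ℝ) 1, (1 - τ) * (β / 2 * quadForm A (u - z')) ≤ δ := by
    intro τ hτ
    have h1 : (1 - τ) • z' + τ • u ∈ Ω :=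
      hR.1 hz' hu (sub_nonneg.2 hτ.2.le) hτ.1.le (by ring)
    have h2 := hmin' _ h1
    have h3 := hR.2 hz' hu (sub_nonneg.2 hτ.2.le) hτ.1.le (by ring)
    have h4 : (1 - τ) • z' + τ • u - z = (1 - τ) • (z' - z) + τ • (u - z) := by module
    have h5 := quadForm_combo A (z' - z) (u - z) τ
    rw [sub_sub_sub_cancel_right] at h5
    rw [h4, h5, inner_add_right, inner_smul_right, inner_smul_right] at h2
    simp only [smul_eq_mul] at h3
    have h6 : τ * ((1 - τ) * (β / 2 * quadForm A (u - z'))) ≤ τ * δ := by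
      rw [hδ]; linarith
    exact le_of_mul_le_mul_left h6 hτ.1
  have hlim : β / 2 * quadForm A (u - z') ≤ δ := by
    have ht : Filter.Tendsto (fun τ : ℝ => (1 - τ) * (β / 2 * quadForm A (u - z')))
        (nhdsWithin 0 (Set.Ioo 0 1)) (nhds ((1 - 0) * (β / 2 * quadForm A (u - z')))) :=
      (Continuous.tendsto (by fun_prop) 0).mono_left nhdsWithin_le_nhds
    have : (nhdsWithin (0 : ℝ) (Set.Ioo 0 1)).NeBot := by
      rw [nhdsWithin_Ioo_eq_nhdsGT one_pos]; infer_instance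
    rw [sub_zero, one_mul] at ht
    refine le_of_tendsto ht ?_
    filter_upwards [self_mem_nhdsWithin] with τ hτ using key τ hτ
  rw [inner_sub_right]
  linarith

theorem IsFobosStep.isProxONSStep {d : ℕ} {Ω : Set (Space d)} {R : Space d → ℝ} {s : ℝ}
    {v z z' : Space d} (h : IsFobosStep Ω R s v z z') :
    IsProxONSStep Ω (fun u => s * R u) 1 1 (s • v) z z' := by
  refine ⟨h.1, ?_⟩
  have hmin := isMinOn_iff.1 h.2
  refine isMinOn_iff.2 fun u hu => ?_
  have h1 := hmin u hu
  have h2 : ∀ u : Space d, ‖u - (z - s • v)‖ ^ 2 =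
      ‖u - z‖ ^ 2 + 2 * (inner ℝ (s • v) u - inner ℝ (s • v) z) + ‖s • v‖ ^ 2 := by
    intro u
    rw [show u - (z - s • v) = (u - z) + s • v by abel, norm_add_sq_real,
      real_inner_comm, inner_sub_right]
  simp only [quadForm_one]
  rw [h2, h2] at h1
  linarith

/-- The regret of one FOBOS step. -/
theorem IsFobosStep.le {d : ℕ} {Ω : Set (Space d)} {R : Space d → ℝ} (hR : ConvexOn ℝ Ω R)
    {s : ℝ} (hs : 0 < s) {v z z' : Space d} (h : IsFobosStep Ω R s v z z') {u : Space d}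
    (hu : u ∈ Ω) :
    inner ℝ v (z - u) + (R z' - R u) ≤
      1 / (2 * s) * (‖u - z‖ ^ 2 - ‖u - z'‖ ^ 2) + s / 2 * ‖v‖ ^ 2 := by
  have h1 := h.isProxONSStep.le (hR.smul hs.le) hu
  simp only [quadForm_one, inner_smul_left, conj_trivial, smul_eq_mul] at h1
  have h2 : 0 ≤ ‖s • v + (z' - z)‖ ^ 2 := sq_nonneg _
  rw [norm_add_sq_real, norm_smul, inner_smul_left, mul_pow, Real.norm_eq_abs, sq_abs,
    conj_trivial] at h2
  have h3 : inner ℝ v (z - u) = inner ℝ v (z' - u) - inner ℝ v (z' - z) := by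
    rw [← inner_sub_right]; congr 1; abel
  have h4 : s * (inner ℝ v (z - u) + (R z' - R u)) ≤
      s * (1 / (2 * s) * (‖u - z‖ ^ 2 - ‖u - z'‖ ^ 2) + s / 2 * ‖v‖ ^ 2) := by
    have : s * (1 / (2 * s) * (‖u - z‖ ^ 2 - ‖u - z'‖ ^ 2) + s / 2 * ‖v‖ ^ 2) =
      1 / 2 * (‖u - z‖ ^ 2 - ‖u - z'‖ ^ 2) + s ^ 2 * ‖v‖ ^ 2 / 2 := by field_simp
    rw [this, h3]
    linarith
  exact le_of_mul_le_mul_left h4 hs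

theorem posDef_add_outerSelf {d : ℕ} {A : Matrix (Fin d) (Fin d) ℝ} (hA : A.PosDef)
    (v : Space d) : (A + outerSelf v).PosDef :=
  hA.add_posSemidef (by
    simpa [outerSelf] using Matrix.posSemidef_vecMulVec_self_star (WithLp.ofLp v))

/-- The squared dual norm of the rank-one update is controlled by the growth of the
determinant. -/
theorem dotProduct_inv_le_log_det {d : ℕ} {A : Matrix (Fin d) (Fin d) ℝ} (hA : A.PosDef)
    (v : Space d) :
    WithLp.ofLp v ⬝ᵥ ((A + outerSelf v)⁻¹ *ᵥ WithLp.ofLp v) ≤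
      Real.log (A + outerSelf v).det - Real.log A.det := by
  have hB := posDef_add_outerSelf hA v
  set B := A + outerSelf v with hBdef
  have hAB : A = B + Matrix.replicateCol Unit (-WithLp.ofLp v) *
      Matrix.replicateRow Unit (WithLp.ofLp v) := by
    rw [← Matrix.vecMulVec_eq, hBdef, outerSelf, Matrix.neg_vecMulVec]; abel
  have hdet : A.det = B.det * (1 - WithLp.ofLp v ⬝ᵥ (B⁻¹ *ᵥ WithLp.ofLp v)) := by
    conv_lhs => rw [hAB]
    rw [Matrix.det_add_replicateCol_mul_replicateRow hB.det_pos.ne'.isUnit]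
    congr 1
    rw [Matrix.det_unique]
    simp only [Matrix.add_apply, Matrix.one_apply_eq, Matrix.mul_apply, Matrix.replicateRow_apply,
      Matrix.replicateCol_apply, Pi.neg_apply, mul_neg, Finset.sum_neg_distrib, sub_eq_add_neg]
    congr 2
    rw [Matrix.dotProduct_mulVec]
    rfl
  set e := WithLp.ofLp v ⬝ᵥ (B⁻¹ *ᵥ WithLp.ofLp v)
  have he : 0 < 1 - e := by
    have := hA.det_pos
    rw [hdet] at this
    exact (mul_pos_iff_of_pos_left hB.det_pos).1 this
  have h1 := Real.log_le_sub_one_of_pos he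
  rw [hdet, Real.log_mul hB.det_pos.ne' he.ne']
  linarith

/-- Fenchel–Young inequality for the norm given by `B` and its dual norm. -/
theorem inner_le_quadForm_add_inv {d : ℕ} {B : Matrix (Fin d) (Fin d) ℝ} (hB : B.PosDef)
    {β : ℝ} (hβ : 0 < β) (v a : Space d) :
    inner ℝ v a ≤ β / 2 * quadForm B a +
      1 / (2 * β) * (WithLp.ofLp v ⬝ᵥ (B⁻¹ *ᵥ WithLp.ofLp v)) := by
  set b := B⁻¹ *ᵥ WithLp.ofLp v with hb
  have hBb : B *ᵥ b = WithLp.ofLp v := by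
    rw [hb, Matrix.mulVec_mulVec, Matrix.mul_nonsing_inv _ hB.det_pos.ne'.isUnit,
      Matrix.one_mulVec]
  have hsymm : b ⬝ᵥ (B *ᵥ WithLp.ofLp a) = WithLp.ofLp v ⬝ᵥ WithLp.ofLp a := by
    rw [Matrix.dotProduct_mulVec, ← Matrix.mulVec_transpose]
    have : Bᵀ = B := by simpa using hB.isHermitian.eq
    rw [this, hBb]
  have h0 : 0 ≤ (β • WithLp.ofLp a - b) ⬝ᵥ (B *ᵥ (β • WithLp.ofLp a - b)) := by
    simpa using hB.posSemidef.dotProduct_mulVec_nonneg (β • WithLp.ofLp a - b)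
  rw [Matrix.mulVec_sub, Matrix.mulVec_smul, hBb] at h0
  simp only [sub_dotProduct, dotProduct_sub, smul_dotProduct, dotProduct_smul, smul_eq_mul,
    hsymm] at h0
  rw [dotProduct_comm (WithLp.ofLp a) (WithLp.ofLp v), dotProduct_comm b (WithLp.ofLp v)] at h0
  rw [inner_eq_dotProduct]
  have h1 : quadForm B a = WithLp.ofLp a ⬝ᵥ (B *ᵥ WithLp.ofLp a) := rfl
  rw [h1]
  have h2 : (2 * β) * (WithLp.ofLp v ⬝ᵥ WithLp.ofLp a) ≤
      (2 * β) * (β / 2 * (WithLp.ofLp a ⬝ᵥ (B *ᵥ WithLp.ofLp a)) +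
        1 / (2 * β) * (WithLp.ofLp v ⬝ᵥ b)) := by
    have : (2 * β) * (β / 2 * (WithLp.ofLp a ⬝ᵥ (B *ᵥ WithLp.ofLp a)) +
        1 / (2 * β) * (WithLp.ofLp v ⬝ᵥ b)) =
        β * (β * (WithLp.ofLp a ⬝ᵥ (B *ᵥ WithLp.ofLp a))) + WithLp.ofLp v ⬝ᵥ b := by
      field_simp
    rw [this]
    linarith
  exact le_of_mul_le_mul_left h2 (by positivity)

/-- The determinant is bounded through the eigenvalues. -/
theorem log_det_le {d : ℕ} {B : Matrix (Fin d) (Fin d) ℝ} (hB : B.PosDef) {c : ℝ}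
    (h : ∀ u : Space d, quadForm B u ≤ c * ‖u‖ ^ 2) : Real.log B.det ≤ d * Real.log c := by
  have hev : ∀ i, 0 < hB.isHermitian.eigenvalues i := hB.eigenvalues_pos
  rw [hB.isHermitian.det_eq_prod_eigenvalues]
  simp only [RCLike.ofReal_real_eq_id, id_eq]
  rw [Real.log_prod (fun i _ => (hev i).ne')]
  calc ∑ i, Real.log (hB.isHermitian.eigenvalues i) ≤ ∑ _i : Fin d, Real.log c := by
        refine Finset.sum_le_sum fun i _ => Real.log_le_log (hev i) ?_
        rw [hB.isHermitian.eigenvalues_eq]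
        have := h (hB.isHermitian.eigenvectorBasis i)
        rw [hB.isHermitian.eigenvectorBasis.orthonormal.1 i] at this
        simpa [quadForm] using this
    _ = d * Real.log c := by simp

/-! ### Regret of the base algorithms -/

/-- The regularizer is charged one round late by each step; shifting it back leaves only the
boundary term `R (z a) - R (z b)`. -/
theorem fobos_regret {d : ℕ} {Ω : Set (Space d)} {R : Space d → ℝ} (hR : ConvexOn ℝ Ω R)
    {s B : ℝ} (hs : 0 < s) {v z : ℕ → Space d} {a b : ℕ} (hab : a ≤ b)
    (hstep : ∀ t ∈ Finset.Ico a b, IsFobosStep Ω R s (v t) (z t) (z (t + 1)))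
    (hv : ∀ t ∈ Finset.Ico a b, ‖v t‖ ^ 2 ≤ B) {u : Space d} (hu : u ∈ Ω) :
    ∑ t ∈ Finset.Ico a b, (inner ℝ (v t) (z t - u) + (R (z t) - R u)) ≤
      1 / (2 * s) * (‖u - z a‖ ^ 2 - ‖u - z b‖ ^ 2) + s / 2 * B * ((b : ℝ) - a) +
        (R (z a) - R (z b)) := by
  induction b, hab using Nat.le_induction with
  | base => simp
  | succ b hab ih =>
    have hb : b ∈ Finset.Ico a (b + 1) := by simp [hab]
    have ih' := ih (fun t ht => hstep t (Finset.Ico_subset_Ico_right (by omega) ht))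
      (fun t ht => hv t (Finset.Ico_subset_Ico_right (by omega) ht))
    have h1 := (hstep b hb).le hR hs hu
    have h2 : s / 2 * ‖v b‖ ^ 2 ≤ s / 2 * B := by gcongr; exact hv b hb
    rw [Finset.sum_Ico_succ_top hab]
    push_cast
    linarith

/-- FOBOS with step sizes `1 / (μ k)` has logarithmic regret on `μ`-strongly convex losses. -/
theorem fobos_strong_regret {d : ℕ} {Ω : Set (Space d)} {R : Space d → ℝ} (hR : ConvexOn ℝ Ω R)
    {μ B : ℝ} (hμ : 0 < μ) {v z : ℕ → Space d} {a b : ℕ} (hab : a ≤ b)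
    (hstep : ∀ t ∈ Finset.Ico a b,
      IsFobosStep Ω R (1 / (μ * ((t : ℝ) - a + 1))) (v t) (z t) (z (t + 1)))
    (hv : ∀ t ∈ Finset.Ico a b, ‖v t‖ ^ 2 ≤ B) {u : Space d} (hu : u ∈ Ω) :
    ∑ t ∈ Finset.Ico a b,
      (inner ℝ (v t) (z t - u) - μ / 2 * ‖u - z t‖ ^ 2 + (R (z t) - R u)) ≤
      -(μ * ((b : ℝ) - a) / 2) * ‖u - z b‖ ^ 2 + B / (2 * μ) * (harmonic (b - a) : ℝ) +
        (R (z a) - R (z b)) := by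
  induction b, hab using Nat.le_induction with
  | base => simp
  | succ b hab ih =>
    have hb : b ∈ Finset.Ico a (b + 1) := by simp [hab]
    have ih' := ih (fun t ht => hstep t (Finset.Ico_subset_Ico_right (by omega) ht))
      (fun t ht => hv t (Finset.Ico_subset_Ico_right (by omega) ht))
    have hk : (0 : ℝ) < (b : ℝ) - a + 1 := by
      have : (a : ℝ) ≤ b := by exact_mod_cast hab
      linarith
    have hs : 0 < 1 / (μ * ((b : ℝ) - a + 1)) := by positivity
    have h1 := (hstep b hb).le hR hs hu
    have h2 : 1 / (μ * ((b : ℝ) - a + 1)) / 2 * ‖v b‖ ^ 2 ≤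
        1 / (μ * ((b : ℝ) - a + 1)) / 2 * B := by gcongr; exact hv b hb
    have h3 : 1 / (2 * (1 / (μ * ((b : ℝ) - a + 1)))) = μ * ((b : ℝ) - a + 1) / 2 := by
      field_simp
    rw [h3] at h1
    rw [Finset.sum_Ico_succ_top hab, Nat.sub_add_comm hab, harmonic_succ]
    push_cast [Nat.cast_sub hab]
    have h4 : 1 / (μ * ((b : ℝ) - a + 1)) / 2 * B = B / (2 * μ) * ((b : ℝ) - a + 1)⁻¹ := by
      field_simp
    rw [h4] at h2
    linarith

/-- The squared dual norms of the gradients sum up to the growth of `log det A`; the quadratic term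
on the left is the exp-concavity of the losses. -/
theorem proxONS_regret {d : ℕ} {Ω : Set (Space d)} {R : Space d → ℝ} (hR : ConvexOn ℝ Ω R)
    {β : ℝ} (hβ : 0 < β) {v z : ℕ → Space d} {A : ℕ → Matrix (Fin d) (Fin d) ℝ}
    {a b : ℕ} (hab : a ≤ b) (hA : (A a).PosDef)
    (hAn : ∀ t ∈ Finset.Ico a b, A (t + 1) = A t + outerSelf (v t))
    (hstep : ∀ t ∈ Finset.Ico a b, IsProxONSStep Ω R β (A (t + 1)) (v t) (z t) (z (t + 1)))
    {u : Space d} (hu : u ∈ Ω) :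
    (A b).PosDef ∧ ∑ t ∈ Finset.Ico a b,
      (inner ℝ (v t) (z t - u) - β / 2 * inner ℝ (v t) (z t - u) ^ 2 + (R (z t) - R u)) ≤
      β / 2 * (quadForm (A a) (u - z a) - quadForm (A b) (u - z b)) +
        1 / (2 * β) * (Real.log (A b).det - Real.log (A a).det) + (R (z a) - R (z b)) := by
  induction b, hab using Nat.le_induction with
  | base => simp [hA]
  | succ b hab ih =>
    have hb : b ∈ Finset.Ico a (b + 1) := by simp [hab]
    obtain ⟨hAb, ih'⟩ := ih (fun t ht => hAn t (Finset.Ico_subset_Ico_right (by omega) ht))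
      (fun t ht => hstep t (Finset.Ico_subset_Ico_right (by omega) ht))
    have hB : (A (b + 1)).PosDef := by rw [hAn b hb]; exact posDef_add_outerSelf hAb _
    refine ⟨hB, ?_⟩
    have h1 := (hstep b hb).le hR hu
    have h2 := inner_le_quadForm_add_inv hB hβ (v b) (z b - z (b + 1))
    have h3 := dotProduct_inv_le_log_det hAb (v b)
    rw [← hAn b hb] at h3
    have h4 : 1 / (2 * β) * (WithLp.ofLp (v b) ⬝ᵥ ((A (b + 1))⁻¹ *ᵥ WithLp.ofLp (v b))) ≤
        1 / (2 * β) * (Real.log (A (b + 1)).det - Real.log (A b).det) := by gcongr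
    have h5 : quadForm (A (b + 1)) (u - z b) =
        quadForm (A b) (u - z b) + inner ℝ (v b) (z b - u) ^ 2 := by
      rw [hAn b hb, quadForm_add_outerSelf, ← neg_sub (z b) u, inner_neg_right, neg_sq]
    have h6 : inner ℝ (v b) (z b - z (b + 1)) =
        inner ℝ (v b) (z b - u) - inner ℝ (v b) (z (b + 1) - u) := by
      rw [← inner_sub_right]; congr 1; abel
    rw [quadForm_sub_comm] at h2
    rw [Finset.sum_Ico_succ_top hab]
    rw [h6] at h2
    rw [h5] at h1
    linarith

/-- The matrix of ProxONS grows linearly. -/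
theorem quadForm_proxONS_le {d : ℕ} {v : ℕ → Space d} {A : ℕ → Matrix (Fin d) (Fin d) ℝ}
    {a b : ℕ} (hab : a ≤ b) {c B : ℝ} (hA : A a = c • 1)
    (hAn : ∀ t ∈ Finset.Ico a b, A (t + 1) = A t + outerSelf (v t))
    (hv : ∀ t ∈ Finset.Ico a b, ‖v t‖ ^ 2 ≤ B) (u : Space d) :
    quadForm (A b) u ≤ (c + ((b : ℝ) - a) * B) * ‖u‖ ^ 2 := by
  induction b, hab using Nat.le_induction with
  | base => simp [hA, quadForm_smul_one]
  | succ b hab ih =>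
    have hb : b ∈ Finset.Ico a (b + 1) := by simp [hab]
    have ih' := ih (fun t ht => hAn t (Finset.Ico_subset_Ico_right (by omega) ht))
      (fun t ht => hv t (Finset.Ico_subset_Ico_right (by omega) ht))
    rw [hAn b hb, quadForm_add_outerSelf]
    have h1 : inner ℝ (v b) u ^ 2 ≤ B * ‖u‖ ^ 2 := by
      have h2 := abs_real_inner_le_norm (v b) u
      calc inner ℝ (v b) u ^ 2 = |inner ℝ (v b) u| ^ 2 := (sq_abs _).symm
        _ ≤ (‖v b‖ * ‖u‖) ^ 2 := by gcongr
        _ = ‖v b‖ ^ 2 * ‖u‖ ^ 2 := by ring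
        _ ≤ B * ‖u‖ ^ 2 := by gcongr; exact hv b hb
    push_cast
    linarith

/-! ### Surrogate losses -/

theorem hasFDerivAt_inner_sub {d : ℕ} (v c u : Space d) :
    HasFDerivAt (fun u => inner ℝ v (c - u)) (-(innerSL ℝ v)) u := by
  have := (innerSL ℝ v).hasFDerivAt.comp u ((hasFDerivAt_id u).const_sub c)
  refine HasFDerivAt.congr_fderiv this ?_
  ext w
  simp

theorem gradient_expSurrogate {d : ℕ} (η : ℝ) (v c u : Space d) :
    gradient (expSurrogate η v c) u = (η * (1 - 2 * (η * inner ℝ v (c - u)))) • v := by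
  apply HasGradientAt.gradient
  rw [hasGradientAt_iff_hasFDerivAt]
  have h := hasFDerivAt_inner_sub v c u
  have h1 := (h.const_mul (-η)).add ((h.pow 2).const_mul (η ^ 2))
  have h2 : HasFDerivAt (expSurrogate η v c) _ u := h1
  refine h2.congr_fderiv ?_
  ext w
  simp
  ring

theorem gradient_strSurrogate {d : ℕ} (G η : ℝ) (v c u : Space d) :
    gradient (strSurrogate G η v c) u = η • v - (2 * η ^ 2 * G ^ 2) • (c - u) := by
  apply HasGradientAt.gradient
  rw [hasGradientAt_iff_hasFDerivAt]
  have h := hasFDerivAt_inner_sub v c u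
  have h3 := ((hasFDerivAt_id u).const_sub c).norm_sq
  have h1 := (h.const_mul (-η)).add (h3.const_mul (η ^ 2 * G ^ 2))
  have h2 : HasFDerivAt (strSurrogate G η v c) _ u := h1
  refine h2.congr_fderiv ?_
  ext w
  simp
  ring

section Surrogate

variable {d : ℕ} {Ω : Set (Space d)} {G D η : ℝ} (hη : 0 < η) (hη' : η * (G * D) ≤ 1 / 5)
  (hdiam : ∀ x ∈ Ω, ∀ y ∈ Ω, ‖x - y‖ ≤ D) {v c z u : Space d} (hv : ‖v‖ ≤ G)
  (hc : c ∈ Ω) (hz : z ∈ Ω)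

include hη hη' hdiam hv hc hz

theorem abs_surrogate_inner_le : |η * inner ℝ v (c - z)| ≤ 1 / 5 := by
  rw [abs_mul, abs_of_pos hη]
  exact (mul_le_mul_of_nonneg_left (abs_inner_sub_le hdiam hv hc hz) hη.le).trans hη'

theorem norm_sq_gradient_expSurrogate_le (hD : 0 < D) :
    ‖gradient (expSurrogate η v c) z‖ ^ 2 ≤ 4 / (25 * D ^ 2) := by
  have h1 := abs_le.1 (abs_surrogate_inner_le hη hη' hdiam hv hc hz)
  rw [gradient_expSurrogate, norm_smul, Real.norm_eq_abs, abs_mul, abs_of_pos hη,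
    abs_of_pos (by linarith)]
  have h2 : η * G ≤ 1 / (5 * D) := by rw [le_div_iff₀ (by positivity)]; linarith
  have h3 : η * (1 - 2 * (η * inner ℝ v (c - z))) * ‖v‖ ≤ 2 / (5 * D) := by
    calc η * (1 - 2 * (η * inner ℝ v (c - z))) * ‖v‖
        = (1 - 2 * (η * inner ℝ v (c - z))) * (η * ‖v‖) := by ring
      _ ≤ 2 * (1 / (5 * D)) := by
          gcongr
          · linarith
          · exact (mul_le_mul_of_nonneg_left hv hη.le).trans h2
      _ = 2 / (5 * D) := by ring
  have h4 : 0 ≤ η * (1 - 2 * (η * inner ℝ v (c - z))) * ‖v‖ :=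
    mul_nonneg (mul_nonneg hη.le (by linarith)) (norm_nonneg _)
  calc _ ≤ (2 / (5 * D)) ^ 2 := by gcongr
    _ = 4 / (25 * D ^ 2) := by field_simp; norm_num

theorem norm_sq_gradient_strSurrogate_le (hG : 0 < G) :
    ‖gradient (strSurrogate G η v c) z‖ ^ 2 ≤ 49 / 25 * (η * G) ^ 2 := by
  rw [gradient_strSurrogate]
  have h1 : ‖η • v - (2 * η ^ 2 * G ^ 2) • (c - z)‖ ≤ 7 / 5 * (η * G) := by
    refine (norm_sub_le _ _).trans ?_
    rw [norm_smul, norm_smul, Real.norm_eq_abs, Real.norm_eq_abs, abs_of_pos hη,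
      abs_of_pos (by positivity)]
    have h2 : η * ‖v‖ ≤ η * G := by gcongr
    have h3 : 2 * η ^ 2 * G ^ 2 * ‖c - z‖ ≤ 2 * η ^ 2 * G ^ 2 * D := by
      gcongr; exact hdiam c hc z hz
    have h4 : 2 * η ^ 2 * G ^ 2 * D = 2 * (η * G) * (η * (G * D)) := by ring
    have h5 : 2 * (η * G) * (η * (G * D)) ≤ 2 * (η * G) * (1 / 5) := by gcongr
    linarith
  calc _ ≤ (7 / 5 * (η * G)) ^ 2 := by gcongr
    _ = _ := by ring

/-- The surrogate is exp-concave with parameter `5 / 16`, the value of `surrogateBeta`. -/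
theorem expSurrogate_sub_le :
    expSurrogate η v c z - expSurrogate η v c u ≤
      inner ℝ (gradient (expSurrogate η v c) z) (z - u) -
        5 / 16 / 2 * inner ℝ (gradient (expSurrogate η v c) z) (z - u) ^ 2 := by
  have h1 := abs_le.1 (abs_surrogate_inner_le hη hη' hdiam hv hc hz)
  rw [gradient_expSurrogate, inner_smul_left, conj_trivial]
  have h2 : inner ℝ v (z - u) = inner ℝ v (c - u) - inner ℝ v (c - z) := by
    rw [← inner_sub_right]; congr 1; abel
  unfold expSurrogate
  rw [h2]
  set X := inner ℝ v (c - z)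
  set Y := inner ℝ v (c - u)
  have h3 : 5 / 16 / 2 * (η * (1 - 2 * (η * X)) * (Y - X)) ^ 2 ≤ (η * (Y - X)) ^ 2 := by
    have h4 : (1 - 2 * (η * X)) ^ 2 ≤ 2 := by nlinarith
    have h5 : 5 / 16 / 2 * (η * (1 - 2 * (η * X)) * (Y - X)) ^ 2 =
      5 / 32 * ((1 - 2 * (η * X)) ^ 2 * (η * (Y - X)) ^ 2) := by ring
    rw [h5]
    nlinarith [mul_le_mul_of_nonneg_right h4 (sq_nonneg (η * (Y - X))),
      sq_nonneg (η * (Y - X))]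
  nlinarith

omit hη hη' hdiam hv hc hz in
/-- The surrogate is a quadratic function with modulus of strong convexity `2 η² G²`. -/
theorem strSurrogate_sub_eq :
    strSurrogate G η v c z - strSurrogate G η v c u =
      inner ℝ (gradient (strSurrogate G η v c) z) (z - u) -
        2 * η ^ 2 * G ^ 2 / 2 * ‖u - z‖ ^ 2 := by
  rw [gradient_strSurrogate, inner_sub_left, inner_smul_left, inner_smul_left, conj_trivial,
    conj_trivial]
  have h2 : inner ℝ v (z - u) = inner ℝ v (c - u) - inner ℝ v (c - z) := by
    rw [← inner_sub_right]; congr 1; abel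
  have h3 : ‖c - u‖ ^ 2 = ‖c - z‖ ^ 2 + 2 * inner ℝ (c - z) (z - u) + ‖u - z‖ ^ 2 := by
    rw [← norm_neg (u - z), neg_sub, ← norm_add_sq_real]; congr 2; abel
  unfold strSurrogate
  rw [h2, h3]
  ring

end Surrogate

/-! ### Numerical estimates for the numbers of experts -/

theorem expertCount_two_pow (k : ℕ) : expertCount (2 ^ k) = 3 + k := by
  unfold expertCount
  rw [Real.logb_pow, Real.logb_self_eq_one (by norm_num)]
  simp

/-- The rounding `⌈k / 2⌉` makes the number of experts exceed `3 + k` by at most one. -/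
theorem gridSize_two_pow (k : ℕ) : k ≤ 2 * gridSize (2 ^ k) ∧ 2 * gridSize (2 ^ k) ≤ k + 1 := by
  have h : gridSize (2 ^ k) = ⌈(k : ℝ) / 2⌉₊ := by
    unfold gridSize
    push_cast
    rw [Real.logb_pow, Real.logb_self_eq_one (by norm_num)]
    congr 1; ring
  rw [h]
  constructor
  · have := Nat.le_ceil ((k : ℝ) / 2)
    have h2 : (k : ℝ) ≤ 2 * ⌈(k : ℝ) / 2⌉₊ := by linarith
    exact_mod_cast h2
  · have := Nat.ceil_lt_add_one (a := (k : ℝ) / 2) (by positivity)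
    have h2 : (2 * ⌈(k : ℝ) / 2⌉₊ : ℝ) < k + 2 := by linarith
    have h3 : 2 * ⌈(k : ℝ) / 2⌉₊ < k + 2 := by exact_mod_cast h2
    omega

theorem card_umsExpert (n : ℕ) : Fintype.card (UMSExpert n) = 3 + 2 * gridSize n := by
  simp only [Fintype.card_sum, Fintype.card_unit, Fintype.card_fin]; omega

theorem card_umsExpert_two_pow (k : ℕ) :
    (3 + k : ℝ) ≤ Fintype.card (UMSExpert (2 ^ k)) ∧
      (Fintype.card (UMSExpert (2 ^ k)) : ℝ) ≤ 4 + k := by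
  have h := gridSize_two_pow k
  rw [card_umsExpert]
  constructor
  · exact_mod_cast (by omega : 3 + k ≤ 3 + 2 * gridSize (2 ^ k))
  · exact_mod_cast (by omega : 3 + 2 * gridSize (2 ^ k) ≤ 4 + k)

theorem log_nine_ge : 2.19 ≤ Real.log 9 := by
  have h1 : Real.log 9 = 3 * Real.log 2 + Real.log (1 + 1 / 8) := by
    rw [show (9 : ℝ) = 2 ^ 3 * (1 + 1 / 8) by norm_num, Real.log_mul (by norm_num) (by norm_num),
      Real.log_pow]
    norm_num
  have h2 := Real.le_log_one_add_of_nonneg (x := 1 / 8) (by norm_num)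
  have h3 := Real.log_two_gt_d9
  rw [h1]
  norm_num at h2 ⊢
  linarith

theorem one_le_log_three : 1 ≤ Real.log 3 := by
  rw [Real.le_log_iff_exp_le (by norm_num)]
  exact (Real.exp_one_lt_d9.trans (by norm_num)).le

theorem three_le_expertCount {n : ℝ} (hn : 1 ≤ n) : 3 ≤ expertCount n := by
  unfold expertCount
  have h : 0 ≤ Real.logb 2 n := Real.logb_nonneg (by norm_num) hn
  have : (0 : ℤ) ≤ ⌈Real.logb 2 n⌉ := Int.ceil_nonneg h
  have : (0 : ℝ) ≤ (⌈Real.logb 2 n⌉ : ℝ) := by exact_mod_cast this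
  linarith

theorem expertCount_mono {n n' : ℝ} (hn : 1 ≤ n) (h : n ≤ n') :
    expertCount n ≤ expertCount n' := by
  unfold expertCount
  have h1 : Real.logb 2 n ≤ Real.logb 2 n' :=
    Real.logb_le_logb_of_le (by norm_num) (by linarith) h
  have : (⌈Real.logb 2 n⌉ : ℝ) ≤ ⌈Real.logb 2 n'⌉ := by exact_mod_cast Int.ceil_mono h1
  linarith

theorem one_le_log_expertCount {n : ℝ} (hn : 1 ≤ n) : 1 ≤ Real.log (expertCount n) :=
  one_le_log_three.trans (Real.log_le_log (by norm_num) (three_le_expertCount hn))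

theorem log_expertCount_mono {n n' : ℝ} (hn : 1 ≤ n) (h : n ≤ n') :
    Real.log (expertCount n) ≤ Real.log (expertCount n') :=
  Real.log_le_log (by linarith [three_le_expertCount hn]) (expertCount_mono hn h)

theorem logFactor_mono {n n' : ℝ} (hn : 1 ≤ n) (h : n ≤ n') : logFactor n ≤ logFactor n' := by
  have h1 := three_le_expertCount hn
  have h2 : 0 ≤ Real.log (n + 1) := Real.log_nonneg (by linarith)
  have h3 : Real.log (n + 1) ≤ Real.log (n' + 1) := Real.log_le_log (by linarith) (by linarith)
  unfold logFactor
  apply Real.log_le_log (by positivity)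
  have := expertCount_mono hn h
  have h0 : 0 ≤ expertCount n' / Real.exp 1 := div_nonneg (by linarith) (Real.exp_pos 1).le
  gcongr

theorem half_le_logFactor {n : ℝ} (hn : 1 ≤ n) : 1 / 2 ≤ logFactor n := by
  have h1 := three_le_expertCount hn
  have h2 : 0 ≤ Real.log (n + 1) := Real.log_nonneg (by linarith)
  unfold logFactor
  have h3 : (2 : ℝ) ≤ 1 + expertCount n / Real.exp 1 * (1 + Real.log (n + 1)) := by
    have : 1 ≤ expertCount n / Real.exp 1 := by
      rw [one_le_div (Real.exp_pos 1)]
      linarith [Real.exp_one_lt_d9]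
    nlinarith
  have h4 := Real.log_le_log (by norm_num) h3
  linarith [Real.log_two_gt_d9]

theorem log_add_one_le_expertCount {n : ℝ} (hn : 1 ≤ n) :
    1 + Real.log (n + 1) ≤ expertCount n := by
  have h1 : Real.log (n + 1) ≤ Real.log 2 + Real.log n := by
    rw [← Real.log_mul (by norm_num) (by linarith)]
    exact Real.log_le_log (by linarith) (by linarith)
  have h2 := Int.le_ceil (Real.logb 2 n)
  have h3 : Real.log n ≤ Real.logb 2 n := by
    unfold Real.logb
    rw [le_div_iff₀ (by linarith [Real.log_two_gt_d9])]
    nlinarith [Real.log_two_lt_d9, Real.log_nonneg hn]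
  unfold expertCount
  linarith [Real.log_two_lt_d9]

theorem logFactor_le {n : ℝ} (hn : 1 ≤ n) : logFactor n ≤ 2 * Real.log (expertCount n) := by
  have h1 := three_le_expertCount hn
  have h2 := log_add_one_le_expertCount hn
  have h4 : 0 ≤ Real.log (n + 1) := Real.log_nonneg (by linarith)
  unfold logFactor
  have h3 : 2 * Real.log (expertCount n) = Real.log (expertCount n ^ 2) := by
    rw [Real.log_pow]; norm_num
  rw [h3]
  apply Real.log_le_log (by positivity)
  have h5 : expertCount n / Real.exp 1 ≤ expertCount n / 2 := by
    gcongr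
    linarith [Real.exp_one_gt_d9]
  have h6 : expertCount n / Real.exp 1 * (1 + Real.log (n + 1)) ≤
      expertCount n / 2 * expertCount n := by gcongr
  nlinarith

/-- The accumulated decay of the learning rates is dominated by the argument of the logarithm in
`logFactor`. The factor `3 / 4` compensates for the rounding in the number of experts. -/
theorem log_potential_le_logFactor (k : ℕ) {X : ℝ} (hX : 0 < X)
    (h : X ≤ 1 + 1 / Real.exp 1 * ((Fintype.card (UMSExpert (2 ^ k)) : ℝ) *
      (3 / 4 * Real.log (1 + 2 ^ k)))) : Real.log X ≤ logFactor (2 ^ k) := by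
  unfold logFactor
  apply Real.log_le_log hX
  rw [expertCount_two_pow]
  refine h.trans ?_
  have h1 := (card_umsExpert_two_pow k).2
  have h2 : 0 ≤ Real.log (1 + 2 ^ k) := Real.log_nonneg (by
    have : (0 : ℝ) < 2 ^ k := by positivity
    linarith)
  rw [add_comm (2 ^ k : ℝ) 1]
  have h3 : (Fintype.card (UMSExpert (2 ^ k)) : ℝ) * (3 / 4 * Real.log (1 + 2 ^ k)) ≤
      (3 + k) * (1 + Real.log (1 + 2 ^ k)) := by
    have hk : (0 : ℝ) ≤ k := Nat.cast_nonneg k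
    nlinarith [mul_le_mul_of_nonneg_right h1 h2, mul_nonneg hk h2]
  calc 1 + 1 / Real.exp 1 * ((Fintype.card (UMSExpert (2 ^ k)) : ℝ) *
      (3 / 4 * Real.log (1 + 2 ^ k)))
      ≤ 1 + 1 / Real.exp 1 * ((3 + k) * (1 + Real.log (1 + 2 ^ k))) := by gcongr
    _ = _ := by ring

theorem log_card_umsExpert (k : ℕ) :
    1 ≤ Real.log (Fintype.card (UMSExpert (2 ^ k))) ∧
    Real.log (expertCount (2 ^ k)) ≤ Real.log (Fintype.card (UMSExpert (2 ^ k))) ∧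
    Real.log (Fintype.card (UMSExpert (2 ^ k))) ≤
      Real.log (expertCount (2 ^ k)) + 1 / (3 + k) := by
  obtain ⟨h1, h2⟩ := card_umsExpert_two_pow k
  have hk : (0 : ℝ) ≤ k := Nat.cast_nonneg k
  rw [expertCount_two_pow]
  refine ⟨one_le_log_three.trans (Real.log_le_log (by norm_num) (by linarith)),
    Real.log_le_log (by positivity) h1, ?_⟩
  have h3 : Real.log (4 + k) = Real.log (3 + k) + Real.log (1 + 1 / (3 + k)) := by
    rw [← Real.log_mul (by positivity) (by positivity)]
    congr 1; field_simp; ring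
  have h4 := Real.log_le_sub_one_of_pos (x := 1 + 1 / (3 + (k : ℝ))) (by positivity)
  have h5 := Real.log_le_log (by linarith) h2
  linarith

/-- The leading coefficient of the regret of the meta-algorithm with `E` experts, where `a = ln E`
and `M` bounds the logarithm of the final potential. -/
def metaCoeff (a M : ℝ) : ℝ := M / Real.sqrt a + 2 * Real.sqrt a

theorem metaCoeff_sq {a M : ℝ} (ha : 0 < a) :
    metaCoeff a M ^ 2 = M ^ 2 / a + 4 * M + 4 * a := by
  unfold metaCoeff
  have h := Real.sq_sqrt ha.le
  have h' := Real.sqrt_pos.2 ha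
  rw [add_sq, div_pow, mul_pow, h]
  field_simp
  ring

/-- For long games the coefficient is dominated by the one in `phi3`, and its square by `phi1` up
to an additive constant. -/
theorem metaCoeff_le {k : ℕ} (hk : 6 ≤ k) :
    metaCoeff (Real.log (Fintype.card (UMSExpert (2 ^ k)))) (logFactor (2 ^ k)) ≤
      Real.log (expertCount (2 ^ k)) + logFactor (2 ^ k) ∧
    metaCoeff (Real.log (Fintype.card (UMSExpert (2 ^ k)))) (logFactor (2 ^ k)) ^ 2 / 2 ≤
      phi1 (2 ^ k) + 12.2 := by
  have hk' : (6 : ℝ) ≤ k := by exact_mod_cast hk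
  have hn : (1 : ℝ) ≤ 2 ^ k := one_le_pow₀ (by norm_num)
  obtain ⟨h1, h2, h3⟩ := log_card_umsExpert k
  have hM2 := logFactor_le hn
  have hb : 2.19 ≤ Real.log (expertCount (2 ^ k)) := by
    refine log_nine_ge.trans (Real.log_le_log (by norm_num) ?_)
    rw [expertCount_two_pow]; linarith
  have hM : 2.88 ≤ logFactor (2 ^ k) := by
    have h18 : 2.88 ≤ Real.log 18 := by
      rw [show (18 : ℝ) = 2 * 9 by norm_num, Real.log_mul (by norm_num) (by norm_num)]
      linarith [log_nine_ge, Real.log_two_gt_d9]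
    refine h18.trans ?_
    unfold logFactor
    apply Real.log_le_log (by norm_num)
    rw [expertCount_two_pow]
    have h4 : 6 * Real.log 2 ≤ Real.log (2 ^ k + 1) := by
      calc 6 * Real.log 2 ≤ k * Real.log 2 := by
            gcongr
        _ = Real.log (2 ^ k) := by rw [Real.log_pow]
        _ ≤ _ := Real.log_le_log (by positivity) (by linarith)
    have h5 : 17 ≤ 9 / Real.exp 1 * 5.158 := by
      rw [div_mul_eq_mul_div, le_div_iff₀ (Real.exp_pos 1)]
      linarith [Real.exp_one_lt_d9]
    have h6 : 9 / Real.exp 1 * 5.158 ≤ (3 + k) / Real.exp 1 * (1 + Real.log (2 ^ k + 1)) := by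
      gcongr
      · linarith
      · linarith [Real.log_two_gt_d9]
    linarith
  have h4 : 1 / (3 + (k : ℝ)) ≤ 1 / 9 := by gcongr; linarith
  set a := Real.log (Fintype.card (UMSExpert (2 ^ k)))
  unfold phi1
  set M := logFactor (2 ^ k)
  set b := Real.log (expertCount (2 ^ k))
  have ha : 2.19 ≤ a := hb.trans h2
  have hba : a - 1 / 9 ≤ b := by linarith
  constructor
  · unfold metaCoeff
    have hx2 := Real.sq_sqrt (by linarith : 0 ≤ a)
    have hx : 1.479 ≤ Real.sqrt a := Real.le_sqrt_of_sq_le (by norm_num; linarith)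
    set x := Real.sqrt a
    have hx0 : 0 < x := by linarith
    have h5 : M / x + 2 * x ≤ x ^ 2 - 1 / 9 + M := by
      have h6 : 2.88 * (1 - 1 / x) ≤ M * (1 - 1 / x) := by
        gcongr
        rw [sub_nonneg, div_le_one hx0]; linarith
      have h7 : 2 * x - x ^ 2 + 1 / 9 ≤ 2.88 * (1 - 1 / x) := by
        have h8 : 2.88 * (1 - 1 / x) = 2.88 * (x - 1) / x := by field_simp
        rw [h8, le_div_iff₀ hx0]
        nlinarith [mul_nonneg (sub_nonneg.2 hx) (sq_nonneg x),
          mul_nonneg (sub_nonneg.2 hx) (sub_nonneg.2 hx)]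
      have h9 : M / x = M * (1 / x) := by ring
      rw [h9]; linarith
    linarith
  · rw [metaCoeff_sq (by linarith)]
    have hMa : M ^ 2 / a ≤ M ^ 2 / 2.19 := by gcongr
    have hsq : (a - 1 / 9 + M) ^ 2 ≤ (b + M) ^ 2 := by
      gcongr
      linarith
    have hM2a : M ≤ 2 * a := by linarith
    have e : M ^ 2 / 2.19 = M ^ 2 * (100 / 219) := by norm_num [div_eq_mul_inv]
    rw [e] at hMa
    nlinarith [mul_nonneg (sub_nonneg.2 hM2a) (sub_nonneg.2 hM), sq_nonneg (M - 4.5),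
      mul_nonneg (sub_nonneg.2 hM2a) (sub_nonneg.2 ha), sq_nonneg (a - 2.25)]

/-- The slack in the regret of ProxONS pays for the square of the coefficient of the
meta-algorithm. -/
theorem ons_slack {d : ℕ} (hd : 1 ≤ d) {k : ℕ} {c : ℝ}
    (hc : c = 0 ∨ (6 ≤ k ∧ c ^ 2 / 2 ≤ phi1 (2 ^ k) + 12.2)) :
    2 * (c ^ 2 / 4 + 8 / 5 * (1 + d * Real.log (1 + 2 ^ k / 64))) ≤
      4 * d * Real.log (2 ^ k + 1) + phi1 (2 ^ k) + 4 := by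
  have hn : (0 : ℝ) < 2 ^ k := by positivity
  have hd' : (1 : ℝ) ≤ d := by exact_mod_cast hd
  have h0 : Real.log (1 + 2 ^ k / 64) ≤ Real.log (2 ^ k + 1) :=
    Real.log_le_log (by positivity) (by linarith)
  have h1 : 0 ≤ Real.log (1 + (2 : ℝ) ^ k / 64) := Real.log_nonneg (by linarith)
  have hphi : 0 ≤ phi1 (2 ^ k) := by unfold phi1; positivity
  rcases hc with rfl | ⟨hk, hc⟩
  · nlinarith
  · have hk64 : (64 : ℝ) ≤ 2 ^ k := by
      calc (64 : ℝ) = 2 ^ 6 := by norm_num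
        _ ≤ 2 ^ k := pow_le_pow_right₀ (by norm_num) hk
    have h2 : Real.log (1 + 2 ^ k / 64) + 3 ≤ Real.log (2 ^ k + 1) := by
      have h3 : Real.log ((1 + 2 ^ k / 64) * 32) = Real.log (1 + 2 ^ k / 64) + 5 * Real.log 2 := by
        rw [Real.log_mul (by positivity) (by norm_num), show (32 : ℝ) = 2 ^ 5 by norm_num,
          Real.log_pow]
        norm_num
      have h4 : Real.log ((1 + 2 ^ k / 64) * 32) ≤ Real.log (2 ^ k + 1) :=
        Real.log_le_log (by positivity) (by linarith)
      linarith [Real.log_two_gt_d9]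
    have h5 : 4.1 ≤ Real.log (2 ^ k + 1) := by
      have h3 : Real.log 64 = 6 * Real.log 2 := by
        rw [show (64 : ℝ) = 2 ^ 6 by norm_num, Real.log_pow]; norm_num
      have h4 : Real.log 64 ≤ Real.log (2 ^ k + 1) := Real.log_le_log (by norm_num) (by linarith)
      linarith [Real.log_two_gt_d9]
    have h6 : 12.4 ≤ 4 * Real.log (2 ^ k + 1) - 16 / 5 * Real.log (1 + 2 ^ k / 64) := by linarith
    nlinarith

/-! ### Tuning the learning rate of the surrogates -/

/-- The grid of learning rates contains a nearly optimal one: some `η` in the grid differs from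
`√(A / S)` by a factor of at most `√2`, unless `√(A / S)` exceeds the largest element of the
grid. -/
theorem exists_grid_bound {G D A S γ : ℝ} (hG : 0 < G) (hD : 0 < D) (hA : 1 / 50 ≤ A)
    (hγ : 0 < γ) (hS0 : 0 ≤ S) (k : ℕ) (hS : S ≤ 2 ^ k * (G * D) ^ 2) :
    ∃ i : Fin (gridSize (2 ^ k) + 1),
      A / gridEta G D i + gridEta G D i * S - γ / 2 * S ≤ 9 / (4 * γ) * A + 10 * (G * D) * A := by
  have hGD : 0 < G * D := mul_pos hG hD
  have hA0 : 0 < A := by linarith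
  have hη : ∀ i, 0 < gridEta G D i := fun i => by unfold gridEta; positivity
  have hη0 : gridEta G D 0 = 1 / (5 * (G * D)) := by unfold gridEta; rw [pow_zero]; ring
  have hbal : ∀ i, A ≤ 2 * (gridEta G D i ^ 2 * S) → gridEta G D i ^ 2 * S ≤ 2 * A →
      A / gridEta G D i + gridEta G D i * S - γ / 2 * S ≤
        9 / (4 * γ) * A + 10 * (G * D) * A := by
    intro i h1 h2
    have hi := hη i
    set η := gridEta G D i
    set P := A / η with hP
    have hPA : A = P * η := by rw [hP]; field_simp
    have hP0 : 0 < P := by positivity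
    have h3 : P ≤ 2 * (η * S) := by
      have : P * η ≤ 2 * (η * S) * η := by rw [← hPA]; linarith
      exact le_of_mul_le_mul_right this hi
    have h4 : η * S ≤ 2 * P := by
      have : (η * S) * η ≤ (2 * P) * η := by nlinarith
      exact le_of_mul_le_mul_right this hi
    have h5 : (P + η * S) ^ 2 ≤ (γ / 2 * S + 9 / (4 * γ) * A) ^ 2 := by
      have h6 : (P + η * S) ^ 2 ≤ 9 / 2 * (P * (η * S)) := by nlinarith
      have h7 : P * (η * S) = A * S := by rw [hPA]; ring
      have h8 : 9 / 2 * (A * S) = 4 * (γ / 2 * S) * (9 / (4 * γ) * A) := by field_simp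
      rw [h7, h8] at h6
      nlinarith [sq_nonneg (γ / 2 * S - 9 / (4 * γ) * A)]
    have h9 : P + η * S ≤ γ / 2 * S + 9 / (4 * γ) * A := by
      apply le_of_sq_le_sq h5
      positivity
    have : 0 ≤ 10 * (G * D) * A := by positivity
    linarith
  by_cases hcase : gridEta G D 0 ^ 2 * S ≤ A
  · refine ⟨0, ?_⟩
    have h1 : gridEta G D 0 * S ≤ A / gridEta G D 0 := by
      rw [le_div_iff₀ (hη 0)]; linarith
    have h2 : A / gridEta G D 0 = 5 * (G * D) * A := by rw [hη0]; field_simp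
    have h3 : 0 ≤ γ / 2 * S := by positivity
    have h4 : 0 ≤ 9 / (4 * γ) * A := by positivity
    simp only [Fin.val_zero]
    linarith
  push Not at hcase
  have hex : ∃ j, gridEta G D j ^ 2 * S ≤ 2 * A ∧ j ≤ gridSize (2 ^ k) := by
    refine ⟨gridSize (2 ^ k), ?_, le_rfl⟩
    have h1 : (2 : ℝ) ^ k ≤ (2 ^ gridSize (2 ^ k)) ^ 2 := by
      rw [← pow_mul, mul_comm]
      exact pow_le_pow_right₀ (by norm_num) (gridSize_two_pow k).1
    have h2 : gridEta G D (gridSize (2 ^ k)) ^ 2 =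
        1 / ((2 ^ gridSize (2 ^ k)) ^ 2 * (25 * (G * D) ^ 2)) := by
      unfold gridEta
      rw [inv_pow]
      field_simp
      norm_num
    rw [h2, one_div, inv_mul_le_iff₀ (by positivity)]
    calc S ≤ 2 ^ k * (G * D) ^ 2 := hS
      _ ≤ (2 ^ gridSize (2 ^ k)) ^ 2 * (G * D) ^ 2 * 1 := by rw [mul_one]; gcongr
      _ ≤ (2 ^ gridSize (2 ^ k)) ^ 2 * (G * D) ^ 2 * (50 * A) := by gcongr; linarith
      _ = _ := by ring
  -- the first grid point with `η² S ≤ 2 A`; its predecessor fails, hence also `A ≤ 2 η² S`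
  classical
  obtain ⟨hj1, hj2⟩ := Nat.find_spec hex
  set j := Nat.find hex with hj
  refine ⟨⟨j, by omega⟩, hbal j ?_ hj1⟩
  rcases Nat.eq_zero_or_pos j with h0 | hpos
  · rw [h0]; linarith
  · have hmin := Nat.find_min hex (m := j - 1) (by omega)
    have h1 : 2 * A < gridEta G D (j - 1) ^ 2 * S := by
      by_contra! h; exact hmin ⟨h, by omega⟩
    have h2 : gridEta G D (j - 1) = 2 * gridEta G D j := by
      obtain ⟨i, hi⟩ : ∃ i, j = i + 1 := ⟨j - 1, by omega⟩
      rw [hi, Nat.add_sub_cancel]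
      unfold gridEta
      rw [pow_succ]; ring
    rw [h2] at h1
    linarith

/-! ### Regret of UMS-Comp -/

/-- The standing assumptions on the domain, the regularizer, the starting point and the gradients
in the given rounds. -/
structure CompositeSetting {d : ℕ} (Ω : Set (Space d)) (G D : ℝ) (r : Space d → ℝ)
    (g : ℕ → Space d → Space d) (o : Space d) (rounds : Finset ℕ) : Prop where
  G_pos : 0 < G
  D_pos : 0 < D
  convex : Convex ℝ Ω
  start_mem : o ∈ Ω
  diam : ∀ x ∈ Ω, ∀ y ∈ Ω, ‖x - y‖ ≤ D
  grad_le : ∀ t ∈ rounds, ∀ x ∈ Ω, ‖g t x‖ ≤ G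
  reg_convex : ConvexOn ℝ Ω r
  reg_nonneg : ∀ x ∈ Ω, 0 ≤ r x

theorem CompositeSetting.mono {d : ℕ} {Ω : Set (Space d)} {G D : ℝ} {r : Space d → ℝ}
    {g : ℕ → Space d → Space d} {o : Space d} {s s' : Finset ℕ}
    (h : CompositeSetting Ω G D r g o s) (hs : s' ⊆ s) : CompositeSetting Ω G D r g o s' :=
  { h with grad_le := fun t ht => h.grad_le t (hs ht) }

theorem CompositeSetting.sub_le_initGap {d : ℕ} {Ω : Set (Space d)} {G D : ℝ} {r : Space d → ℝ}
    {g : ℕ → Space d → Space d} {o : Space d} {s : Finset ℕ}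
    (h : CompositeSetting Ω G D r g o s) {x : Space d} (hx : x ∈ Ω) :
    r o - r x ≤ initGap Ω r o := by
  unfold initGap
  have : sInf (r '' Ω) ≤ r x := csInf_le
    ⟨0, by rintro _ ⟨y, hy, rfl⟩; exact h.reg_nonneg y hy⟩ ⟨x, hx, rfl⟩
  linarith

namespace UMSCompRun

variable {d : ℕ} {Ω : Set (Space d)} {G D : ℝ} {r : Space d → ℝ}
  {g : ℕ → Space d → Space d} {o : Space d} {a e n : ℕ}

theorem u_mem (U : UMSCompRun Ω G D r g o a e n) (ho : o ∈ Ω) {t : ℕ} (h1 : a ≤ t)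
    (h2 : t ≤ e + 1) (i : UMSExpert n) : U.u t i ∈ Ω := by
  rcases h1.eq_or_lt with rfl | h1
  · rw [U.u_init]; exact ho
  · obtain ⟨s, rfl⟩ : ∃ s, t = s + 1 := ⟨t - 1, by omega⟩
    have hs : s ∈ Finset.Icc a e := Finset.mem_Icc.2 ⟨by omega, by omega⟩
    rcases i with _ | i | i
    · exact (U.cvx_step s hs).1
    · exact (U.exp_step s hs i).1
    · exact (U.str_step s hs i).1

theorem isSleepingRun (U : UMSCompRun Ω G D r g o a e n)
    (hs : CompositeSetting Ω G D r g o (Finset.Icc a e)) :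
    IsSleepingRun Ω G D r g (fun _ => Finset.univ) (fun _ => a) (fun _ => e)
      (fun _ => Real.log (Fintype.card (UMSExpert n)))
      (fun _ => 1 / (Fintype.card (UMSExpert n) : ℝ)) a e U.u U.out U.x U.L U.p U.m U.ℓ U.ℓbar where
  isMeta := U.isMeta
  G_pos := hs.G_pos
  D_pos := hs.D_pos
  convex := hs.convex
  diam := hs.diam
  grad_le := hs.grad_le
  reg_convex := hs.reg_convex
  mem_active t ht i := by simpa using ht
  active_nonempty t ht := ⟨UMSExpert.cvx, Finset.mem_univ _⟩
  y_mem t ht i _ := by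
    have := Finset.mem_Icc.1 ht
    exact U.u_mem hs.start_mem this.1 (by omega) i
  first_le _ := le_rfl
  κ_pos _ := by
    apply Real.log_pos
    rw [card_umsExpert]
    exact_mod_cast (by omega : 1 < 3 + 2 * gridSize n)
  x₀_pos _ := by
    rw [card_umsExpert]
    positivity

theorem out_mem (U : UMSCompRun Ω G D r g o a e n)
    (hs : CompositeSetting Ω G D r g o (Finset.Icc a e)) {t : ℕ} (ht : t ∈ Finset.Icc a e) :
    U.out t ∈ Ω := (U.isSleepingRun hs).decision_mem ht

theorem log_potential_le {k : ℕ} (U : UMSCompRun Ω G D r g o a e (2 ^ k))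
    (hs : CompositeSetting Ω G D r g o (Finset.Icc a e)) (he : e + 1 = a + 2 ^ k)
    (i : UMSExpert (2 ^ k)) : Real.log (U.x (e + 1) i) ≤ logFactor (2 ^ k) := by
  have h := U.isSleepingRun hs
  have hk : 1 ≤ 2 ^ k := Nat.one_le_two_pow
  apply log_potential_le_logFactor k (h.pos_and_nonneg (i := i) (by omega) le_rfl le_rfl).1
  have h1 := h.potential_le Finset.univ (t := e + 1) (by omega) le_rfl (fun _ _ => by omega)
    (fun _ _ => subset_rfl) (Finset.mem_univ i) (by omega) le_rfl
  rw [Finset.sum_comm] at h1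
  have hcard : (Fintype.card (UMSExpert (2 ^ k)) : ℝ) ≠ 0 := by
    rw [card_umsExpert]; positivity
  have h2 : ∑ _i : UMSExpert (2 ^ k), 1 / (Fintype.card (UMSExpert (2 ^ k)) : ℝ) = 1 := by
    rw [Finset.sum_const, Finset.card_univ, nsmul_eq_mul, mul_one_div_cancel hcard]
  rw [h2] at h1
  refine h1.trans ?_
  have h3 : ∀ j ∈ (Finset.univ : Finset (UMSExpert (2 ^ k))),
      ∑ s ∈ Finset.Ico a (e + 1), (U.L (s + 1) j - U.L s j) / (2 * (1 + U.L s j)) ≤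
        3 / 4 * Real.log (1 + 2 ^ k) := by
    intro j _
    refine (h.sum_decay_le (i := j) (t := e + 1) (by omega) le_rfl le_rfl).trans ?_
    have h4 := h.L_le (i := j) (t := e + 1) (by omega) le_rfl le_rfl
    have h5 := (h.pos_and_nonneg (i := j) (t := e + 1) (by omega) le_rfl le_rfl).2
    have h6 : ((e + 1 : ℕ) : ℝ) - a = 2 ^ k := by rw [he]; push_cast; ring
    rw [h6] at h4
    have := Real.log_le_log (by linarith) (by linarith : 1 + U.L (e + 1) j ≤ 1 + 2 ^ k)
    linarith
  have h4 := Finset.sum_le_sum h3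
  rw [Finset.sum_const, Finset.card_univ, nsmul_eq_mul] at h4
  have h5 := Real.exp_pos 1
  gcongr

/-- The regret of UMS-Comp against each of its experts has the form `G D K + c √V` with `V` the sum
of the squared linearized losses. In games of at most `32` rounds all learning rates are equal to
`1 / 4`, and one can take `c = 0`; in longer games `c` is `metaCoeff`. The first bound on `K` is
used for curved losses, the joint bound on `K` and `c` for convex losses. -/
theorem meta_regret {k : ℕ} (U : UMSCompRun Ω G D r g o a e (2 ^ k))
    (hs : CompositeSetting Ω G D r g o (Finset.Icc a e)) (he : e + 1 = a + 2 ^ k) :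
    ∃ K c : ℝ, 0 ≤ c ∧ (c = 0 ∨ (6 ≤ k ∧ c ^ 2 / 2 ≤ phi1 (2 ^ k) + 12.2)) ∧
      K ≤ 2 * phi2 (2 ^ k) ∧
      K + c * Real.sqrt (2 ^ k) ≤ phi2 (2 ^ k) + 1 +
        (Real.log (expertCount (2 ^ k)) + logFactor (2 ^ k)) * Real.sqrt (2 ^ k) ∧
      ∀ i, ∑ t ∈ Finset.Ico a (e + 1),
        (inner ℝ (g t (U.out t)) (U.out t - U.u t i) + (r (U.out t) - r (U.u t i))) ≤
        G * D * K + c * Real.sqrt (∑ t ∈ Finset.Ico a (e + 1),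
          inner ℝ (g t (U.out t)) (U.out t - U.u t i) ^ 2) := by
  have h := U.isSleepingRun hs
  have hGD : 0 < G * D := mul_pos hs.G_pos hs.D_pos
  have hk1 : 1 ≤ 2 ^ k := Nat.one_le_two_pow
  have hn : (1 : ℝ) ≤ 2 ^ k := by exact_mod_cast hk1
  obtain ⟨ha1, hba, hab⟩ := log_card_umsExpert k
  have hM0 := half_le_logFactor hn
  have hM2 := logFactor_le hn
  have hb1 := one_le_log_expertCount hn
  have hk3 : 1 / (3 + (k : ℝ)) ≤ 1 / 3 := by gcongr; linarith [Nat.cast_nonneg (α := ℝ) k]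
  have hlin : ∀ i, ∑ t ∈ Finset.Ico a (e + 1),
      (inner ℝ (g t (U.out t)) (U.out t - U.u t i) + (r (U.out t) - r (U.u t i))) ≤
      G * D * ∑ t ∈ Finset.Ico a (e + 1), (U.ℓbar t - U.ℓ t i) := by
    intro i
    rw [Finset.mul_sum]
    exact Finset.sum_le_sum fun t ht => h.linearized_le
      (by rw [Finset.mem_Ico] at ht; rw [Finset.mem_Icc]; omega) (Finset.mem_univ i)
  have hreg : ∀ i, ∑ t ∈ Finset.Ico a (e + 1), (U.ℓbar t - U.ℓ t i) ≤
      logFactor (2 ^ k) * (1 / learningRate (Real.log (Fintype.card (UMSExpert (2 ^ k))))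
        (U.L (e + 1) i)) + 4 * Real.log (Fintype.card (UMSExpert (2 ^ k))) +
      ∑ s ∈ Finset.Ico a (e + 1),
        learningRate (Real.log (Fintype.card (UMSExpert (2 ^ k)))) (U.L s i) *
          (U.L (s + 1) i - U.L s i) := by
    intro i
    have h1 := h.sum_regret_eq (i := i) (t := e + 1) (by omega) le_rfl le_rfl
    have h2 := U.log_potential_le hs he i
    have h3 := (h.pos_and_nonneg (i := i) (t := e + 1) (by omega) le_rfl le_rfl).2
    have h4 := learningRate_pos (h.κ_pos i) h3
    have h5 : learningRate (Real.log (Fintype.card (UMSExpert (2 ^ k)))) 0 = 1 / 4 := by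
      unfold learningRate
      apply min_eq_left
      apply Real.le_sqrt_of_sq_le
      rw [add_zero, div_one]; linarith
    rw [h1, h5, Real.log_div (by norm_num) (by rw [card_umsExpert]; positivity), Real.log_one,
      div_eq_mul_one_div (Real.log _)]
    have h6 := mul_le_mul_of_nonneg_right h2 (one_div_pos.2 h4).le
    linarith
  have hLn : ∀ i, U.L (e + 1) i ≤ 2 ^ k := by
    intro i
    have h4 := h.L_le (i := i) (t := e + 1) (by omega) le_rfl le_rfl
    have h6 : ((e + 1 : ℕ) : ℝ) - a = 2 ^ k := by rw [he]; push_cast; ring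
    rwa [h6] at h4
  unfold phi2
  -- for `k ≤ 5` the ratio `κ / (1 + L)` stays above `1 / 16`, so the minimum in the rate is `1 / 4`
  by_cases hk : k ≤ 5
  · have hn32 : (2 : ℝ) ^ k ≤ 32 := by
      calc (2 : ℝ) ^ k ≤ 2 ^ 5 := pow_le_pow_right₀ (by norm_num) hk
        _ = 32 := by norm_num
    have h16 : 1 + (2 : ℝ) ^ k ≤ 16 * Real.log (Fintype.card (UMSExpert (2 ^ k))) := by
      rcases hk.eq_or_lt with rfl | hk
      · have h9 : (9 : ℝ) ≤ Fintype.card (UMSExpert (2 ^ 5)) := by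
          have h2 := (gridSize_two_pow 5).1
          have h1 := card_umsExpert (2 ^ 5)
          exact_mod_cast (by omega : 9 ≤ Fintype.card (UMSExpert (2 ^ 5)))
        have := Real.log_le_log (by norm_num) h9
        norm_num at this ⊢
        linarith [log_nine_ge]
      · have hn16 : (2 : ℝ) ^ k ≤ 16 := by
          calc (2 : ℝ) ^ k ≤ 2 ^ 4 := pow_le_pow_right₀ (by norm_num) (by omega)
            _ = 16 := by norm_num
        have h3 : Real.log 9 = 2 * Real.log 3 := by
          rw [show (9 : ℝ) = 3 ^ 2 by norm_num, Real.log_pow]; norm_num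
        have h4 := Real.log_le_log (by norm_num) (three_le_expertCount hn)
        linarith [log_nine_ge]
    have hsq0 : 0 ≤ Real.sqrt (2 ^ k) := Real.sqrt_nonneg _
    have hsq : (2 : ℝ) ^ k ≤ 5.7 * Real.sqrt (2 ^ k) := by
      have h1 : Real.sqrt (2 ^ k) ≤ 5.7 := by
        rw [Real.sqrt_le_left (by norm_num)]; norm_num; linarith
      have h2 := Real.sq_sqrt (by positivity : (0 : ℝ) ≤ 2 ^ k)
      nlinarith
    set b := Real.log (expertCount (2 ^ k))
    set M := logFactor (2 ^ k)
    refine ⟨4 * Real.log (Fintype.card (UMSExpert (2 ^ k))) + 4 * M + 2 ^ k / 4, 0, le_rfl,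
      Or.inl rfl, by linarith, ?_, fun i => ?_⟩
    · have : 3 / 2 * Real.sqrt (2 ^ k) ≤ (b + M) * Real.sqrt (2 ^ k) := by
        gcongr; linarith
      linarith
    · refine (hlin i).trans ?_
      rw [zero_mul, add_zero]
      gcongr
      refine (hreg i).trans ?_
      have hL0 := (h.pos_and_nonneg (i := i) (t := e + 1) (by omega) le_rfl le_rfl).2
      have hη : learningRate (Real.log (Fintype.card (UMSExpert (2 ^ k)))) (U.L (e + 1) i) =
          1 / 4 := by
        unfold learningRate
        apply min_eq_left
        apply Real.le_sqrt_of_sq_le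
        rw [le_div_iff₀ (by linarith)]
        linarith [hLn i]
      rw [hη]
      have hsum : ∑ s ∈ Finset.Ico a (e + 1),
          learningRate (Real.log (Fintype.card (UMSExpert (2 ^ k)))) (U.L s i) *
          (U.L (s + 1) i - U.L s i) ≤ 2 ^ k / 4 := by
        calc _ ≤ ∑ s ∈ Finset.Ico a (e + 1), (1 / 4 : ℝ) * 1 := by
              refine Finset.sum_le_sum fun s hs' => ?_
              have hs'' : s ∈ Finset.Icc a e := by
                rw [Finset.mem_Ico] at hs'; rw [Finset.mem_Icc]; omega
              obtain ⟨h1, h2⟩ := h.L_step hs'' (Finset.mem_univ i)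
              exact mul_le_mul learningRate_le (by linarith) (by linarith) (by norm_num)
          _ = 2 ^ k / 4 := by
              rw [Finset.sum_const, Nat.card_Ico, he, nsmul_eq_mul, Nat.add_sub_cancel_left]
              push_cast; ring
      linarith
  · have hk6 : 6 ≤ k := by omega
    obtain ⟨hc1, hc2⟩ := metaCoeff_le hk6
    have ha0 : 0 < Real.log (Fintype.card (UMSExpert (2 ^ k))) := by linarith
    have hsa : 1 ≤ Real.sqrt (Real.log (Fintype.card (UMSExpert (2 ^ k)))) :=
      Real.one_le_sqrt.2 ha1
    set al := Real.log (Fintype.card (UMSExpert (2 ^ k)))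
    set b := Real.log (expertCount (2 ^ k))
    set M := logFactor (2 ^ k)
    refine ⟨4 * al + 5 * M, metaCoeff al M, by unfold metaCoeff; positivity,
      Or.inr ⟨hk6, hc2⟩, by linarith, ?_, fun i => ?_⟩
    · have := mul_le_mul_of_nonneg_right hc1 (Real.sqrt_nonneg (2 ^ k))
      linarith
    · refine (hlin i).trans ?_
      have hL0 := (h.pos_and_nonneg (i := i) (t := e + 1) (by omega) le_rfl le_rfl).2
      rw [← h.L_eq (i := i) (t := e + 1) (by omega) le_rfl le_rfl, Real.sqrt_mul (by positivity),
        Real.sqrt_sq hGD.le]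
      have h1 := inv_learningRate_le ha0 hL0
      have h2 := h.sum_learningRate_mul_le (i := i) (t := e + 1) (by omega) le_rfl le_rfl
      have h3 : Real.sqrt ((1 + U.L (e + 1) i) / al) ≤
          1 + Real.sqrt (U.L (e + 1) i) / Real.sqrt al := by
        rw [Real.sqrt_div' _ ha0.le, div_le_iff₀ (by linarith), add_mul,
          div_mul_cancel₀ _ (by linarith), one_mul]
        have h4 : Real.sqrt (1 + U.L (e + 1) i) ≤ 1 + Real.sqrt (U.L (e + 1) i) := by
          apply Real.sqrt_le_iff.2
          refine ⟨by positivity, ?_⟩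
          nlinarith [Real.sq_sqrt hL0, Real.sqrt_nonneg (U.L (e + 1) i)]
        linarith
      have h5 : M * (1 / learningRate al (U.L (e + 1) i)) ≤
          M * (4 + (1 + Real.sqrt (U.L (e + 1) i) / Real.sqrt al)) := by
        gcongr; linarith
      have h6 := hreg i
      have h7 : metaCoeff al M * Real.sqrt (U.L (e + 1) i) =
          M * (Real.sqrt (U.L (e + 1) i) / Real.sqrt al) +
          2 * Real.sqrt al * Real.sqrt (U.L (e + 1) i) := by unfold metaCoeff; ring
      have h8 : ∑ t ∈ Finset.Ico a (e + 1), (U.ℓbar t - U.ℓ t i) ≤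
          4 * al + 5 * M + metaCoeff al M * Real.sqrt (U.L (e + 1) i) := by
        rw [h7]; linarith
      calc _ ≤ G * D * (4 * al + 5 * M + metaCoeff al M * Real.sqrt (U.L (e + 1) i)) := by
            gcongr
        _ = _ := by ring

end UMSCompRun

/-- With `G' = 2 / (5 D)` the parameter of ProxONS does not depend on `D`. -/
theorem surrogateBeta_eq {D : ℝ} (hD : 0 < D) : surrogateBeta D = 5 / 16 := by
  unfold surrogateBeta onsBeta
  have : 1 / (4 * (2 / (5 * D)) * D) = 5 / 8 := by field_simp; norm_num
  rw [this]
  norm_num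

theorem gridEta_pos {G D : ℝ} (hG : 0 < G) (hD : 0 < D) (i : ℕ) : 0 < gridEta G D i := by
  unfold gridEta; positivity

theorem gridEta_mul_le {G D : ℝ} (hG : 0 < G) (hD : 0 < D) (i : ℕ) :
    gridEta G D i * (G * D) ≤ 1 / 5 := by
  have h : gridEta G D i * (G * D) = (2 : ℝ)⁻¹ ^ i / 5 := by
    unfold gridEta; field_simp
  rw [h]
  have : (2 : ℝ)⁻¹ ^ i ≤ 1 := pow_le_one₀ (by norm_num) (by norm_num)
  linarith

/-- The regret of the meta-algorithm on a surrogate: the square root is absorbed by the quadratic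
term of the surrogate. -/
theorem surrogate_meta_le {η c K S : ℝ} (hS : 0 ≤ S) :
    η * (K + c * Real.sqrt S) ≤ η * K + c ^ 2 / 4 + η ^ 2 * S := by
  nlinarith [sq_nonneg (c / 2 - η * Real.sqrt S), Real.sq_sqrt hS]

namespace UMSCompRun

variable {d : ℕ} {Ω : Set (Space d)} {G D : ℝ} {r : Space d → ℝ}
  {g : ℕ → Space d → Space d} {o : Space d} {a e n k : ℕ}

/-- The regret of an instance of ProxONS on its surrogate losses. -/
theorem exp_regret (U : UMSCompRun Ω G D r g o a e n)
    (hs : CompositeSetting Ω G D r g o (Finset.Icc a e)) (hae : a ≤ e + 1)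
    (i : Fin (gridSize n + 1)) {u : Space d} (hu : u ∈ Ω) :
    ∑ t ∈ Finset.Ico a (e + 1),
      (expSurrogate (gridEta G D i) (g t (U.out t)) (U.out t) (U.u t (UMSExpert.exp i)) -
        expSurrogate (gridEta G D i) (g t (U.out t)) (U.out t) u +
        gridEta G D i * (r (U.u t (UMSExpert.exp i)) - r u)) ≤
      8 / 5 * (1 + d * Real.log (1 + (((e + 1 : ℕ) : ℝ) - a) / 64)) +
        gridEta G D i * initGap Ω r o := by
  have hη := gridEta_pos hs.G_pos hs.D_pos i
  have hη' := gridEta_mul_le hs.G_pos hs.D_pos i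
  have hD := hs.D_pos
  have hmem : ∀ t ∈ Finset.Ico a (e + 1), t ∈ Finset.Icc a e := fun t ht => by
    rw [Finset.mem_Ico] at ht; rw [Finset.mem_Icc]; omega
  have hz : ∀ t ∈ Finset.Ico a (e + 1), U.u t (UMSExpert.exp i) ∈ Ω := fun t ht => by
    rw [Finset.mem_Ico] at ht; exact U.u_mem hs.start_mem ht.1 (by omega) _
  have hg : ∀ t ∈ Finset.Ico a (e + 1), ‖g t (U.out t)‖ ≤ G := fun t ht =>
    hs.grad_le t (hmem t ht) _ (U.out_mem hs (hmem t ht))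
  set η := gridEta G D i
  set v : ℕ → Space d := fun t =>
    gradient (expSurrogate η (g t (U.out t)) (U.out t)) (U.u t (UMSExpert.exp i)) with hv
  have hvB : ∀ t ∈ Finset.Ico a (e + 1), ‖v t‖ ^ 2 ≤ 4 / (25 * D ^ 2) := fun t ht =>
    norm_sq_gradient_expSurrogate_le hη hη' hs.diam (hg t ht) (U.out_mem hs (hmem t ht))
      (hz t ht) hD
  have hAinit := U.A_init i
  rw [surrogateBeta_eq hD] at hAinit
  have hc0 : 0 < 1 / ((5 / 16 : ℝ) ^ 2 * D ^ 2) := by positivity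
  have hApos : (U.A a i).PosDef := by rw [hAinit]; exact Matrix.PosDef.one.smul hc0
  have hAn : ∀ t ∈ Finset.Ico a (e + 1), U.A (t + 1) i = U.A t i + outerSelf (v t) :=
    fun t ht => U.A_next t (hmem t ht) i
  have hstep : ∀ t ∈ Finset.Ico a (e + 1), IsProxONSStep Ω (fun v => η * r v) (5 / 16)
      (U.A (t + 1) i) (v t) (U.u t (UMSExpert.exp i)) (U.u (t + 1) (UMSExpert.exp i)) := by
    intro t ht
    have := U.exp_step t (hmem t ht) i
    rwa [surrogateBeta_eq hD] at this
  obtain ⟨hB, hreg⟩ := proxONS_regret (hs.reg_convex.smul hη.le) (by norm_num : (0 : ℝ) < 5 / 16)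
    (v := v) (z := fun t => U.u t (UMSExpert.exp i)) (A := fun t => U.A t i)
    hae hApos hAn hstep hu
  have hquad := quadForm_proxONS_le (A := fun t => U.A t i) hae hAinit hAn hvB
  have hdet := log_det_le hB hquad
  have hdet0 : Real.log (U.A a i).det = d * Real.log (1 / ((5 / 16 : ℝ) ^ 2 * D ^ 2)) := by
    rw [hAinit, Matrix.det_smul, Matrix.det_one, mul_one, Fintype.card_fin, Real.log_pow]
  have hn0 : (0 : ℝ) ≤ ((e + 1 : ℕ) : ℝ) - a := by
    rw [sub_nonneg]; exact_mod_cast hae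
  have hlog : Real.log (1 / ((5 / 16 : ℝ) ^ 2 * D ^ 2) +
      (((e + 1 : ℕ) : ℝ) - a) * (4 / (25 * D ^ 2))) =
      Real.log (1 / ((5 / 16 : ℝ) ^ 2 * D ^ 2)) +
        Real.log (1 + (((e + 1 : ℕ) : ℝ) - a) / 64) := by
    rw [← Real.log_mul hc0.ne' (by positivity)]
    congr 1
    field_simp
    ring
  rw [hlog] at hdet
  have hdiff : Real.log (U.A (e + 1) i).det - Real.log (U.A a i).det ≤
      d * Real.log (1 + (((e + 1 : ℕ) : ℝ) - a) / 64) := by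
    rw [hdet0]; linarith
  have hq0 : 5 / 16 / 2 * quadForm (U.A a i) (u - U.u a (UMSExpert.exp i)) ≤ 8 / 5 := by
    rw [hAinit, quadForm_smul_one, U.u_init]
    have h1 : ‖u - o‖ ^ 2 ≤ D ^ 2 := by
      gcongr; exact hs.diam u hu o hs.start_mem
    calc 5 / 16 / 2 * (1 / ((5 / 16 : ℝ) ^ 2 * D ^ 2) * ‖u - o‖ ^ 2)
        ≤ 5 / 16 / 2 * (1 / ((5 / 16 : ℝ) ^ 2 * D ^ 2) * D ^ 2) := by gcongr
      _ = 8 / 5 := by field_simp; norm_num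
  have hq1 : 0 ≤ quadForm (U.A (e + 1) i) (u - U.u (e + 1) (UMSExpert.exp i)) := by
    have := hB.posSemidef.dotProduct_mulVec_nonneg
      (WithLp.ofLp (u - U.u (e + 1) (UMSExpert.exp i)))
    simpa [quadForm] using this
  have hgap : η * r (U.u a (UMSExpert.exp i)) - η * r (U.u (e + 1) (UMSExpert.exp i)) ≤
      η * initGap Ω r o := by
    rw [← mul_sub, U.u_init]
    exact mul_le_mul_of_nonneg_left
      (hs.sub_le_initGap (U.u_mem hs.start_mem hae le_rfl _)) hη.le
  have hterm := Finset.sum_le_sum fun t ht =>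
    add_le_add_left (expSurrogate_sub_le hη hη' hs.diam (hg t ht) (U.out_mem hs (hmem t ht))
      (hz t ht) (u := u)) (η * (r (U.u t (UMSExpert.exp i)) - r u))
  refine hterm.trans ?_
  simp only [mul_sub] at hgap hreg ⊢
  simp only [smul_eq_mul] at hreg
  refine hreg.trans ?_
  have : 1 / (2 * (5 / 16 : ℝ)) * (Real.log (U.A (e + 1) i).det - Real.log (U.A a i).det) ≤
      8 / 5 * (d * Real.log (1 + (((e + 1 : ℕ) : ℝ) - a) / 64)) := by
    rw [show 1 / (2 * (5 / 16 : ℝ)) = 8 / 5 by norm_num]; linarith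
  linarith

/-- The regret of an instance of FOBOS on its strongly convex surrogate losses. -/
theorem str_regret (U : UMSCompRun Ω G D r g o a e n)
    (hs : CompositeSetting Ω G D r g o (Finset.Icc a e)) (hae : a ≤ e + 1)
    (i : Fin (gridSize n + 1)) {u : Space d} (hu : u ∈ Ω) :
    ∑ t ∈ Finset.Ico a (e + 1),
      (strSurrogate G (gridEta G D i) (g t (U.out t)) (U.out t) (U.u t (UMSExpert.str i)) -
        strSurrogate G (gridEta G D i) (g t (U.out t)) (U.out t) u +
        gridEta G D i * (r (U.u t (UMSExpert.str i)) - r u)) ≤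
      49 / 100 * (1 + Real.log ((e + 1 - a : ℕ) : ℝ)) + gridEta G D i * initGap Ω r o := by
  have hη := gridEta_pos hs.G_pos hs.D_pos i
  have hη' := gridEta_mul_le hs.G_pos hs.D_pos i
  have hG := hs.G_pos
  have hmem : ∀ t ∈ Finset.Ico a (e + 1), t ∈ Finset.Icc a e := fun t ht => by
    rw [Finset.mem_Ico] at ht; rw [Finset.mem_Icc]; omega
  have hz : ∀ t ∈ Finset.Ico a (e + 1), U.u t (UMSExpert.str i) ∈ Ω := fun t ht => by
    rw [Finset.mem_Ico] at ht; exact U.u_mem hs.start_mem ht.1 (by omega) _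
  have hg : ∀ t ∈ Finset.Ico a (e + 1), ‖g t (U.out t)‖ ≤ G := fun t ht =>
    hs.grad_le t (hmem t ht) _ (U.out_mem hs (hmem t ht))
  have hstep0 := fun t ht => U.str_step t (hmem t ht) i
  set η := gridEta G D i
  set v : ℕ → Space d := fun t =>
    gradient (strSurrogate G η (g t (U.out t)) (U.out t)) (U.u t (UMSExpert.str i)) with hv
  have hvB : ∀ t ∈ Finset.Ico a (e + 1), ‖v t‖ ^ 2 ≤ 49 / 25 * (η * G) ^ 2 := fun t ht =>
    norm_sq_gradient_strSurrogate_le hη hη' hs.diam (hg t ht) (U.out_mem hs (hmem t ht))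
      (hz t ht) hG
  have hreg := fobos_strong_regret (hs.reg_convex.smul hη.le)
    (by positivity : 0 < 2 * η ^ 2 * G ^ 2) (v := v) (z := fun t => U.u t (UMSExpert.str i))
    hae hstep0 hvB hu
  have hgap : η * r (U.u a (UMSExpert.str i)) - η * r (U.u (e + 1) (UMSExpert.str i)) ≤
      η * initGap Ω r o := by
    rw [← mul_sub, U.u_init]
    exact mul_le_mul_of_nonneg_left
      (hs.sub_le_initGap (U.u_mem hs.start_mem hae le_rfl _)) hη.le
  have hH := harmonic_le_one_add_log (e + 1 - a)
  have hn0 : (0 : ℝ) ≤ ((e + 1 : ℕ) : ℝ) - a := by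
    rw [sub_nonneg]; exact_mod_cast hae
  have hcoef : 49 / 25 * (η * G) ^ 2 / (2 * (2 * η ^ 2 * G ^ 2)) = 49 / 100 := by
    field_simp; norm_num
  rw [hcoef] at hreg
  have hneg : 0 ≤ 2 * η ^ 2 * G ^ 2 * (((e + 1 : ℕ) : ℝ) - a) / 2 *
      ‖u - U.u (e + 1) (UMSExpert.str i)‖ ^ 2 := by positivity
  simp only [strSurrogate_sub_eq]
  simp only [mul_sub] at hgap hreg ⊢
  simp only [smul_eq_mul] at hreg
  refine hreg.trans ?_
  linarith

theorem sum_inner_sq_le (U : UMSCompRun Ω G D r g o a e (2 ^ k))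
    (hs : CompositeSetting Ω G D r g o (Finset.Icc a e)) (he : e + 1 = a + 2 ^ k)
    {z : ℕ → Space d} (hz : ∀ t ∈ Finset.Icc a e, z t ∈ Ω) :
    ∑ t ∈ Finset.Ico a (e + 1), inner ℝ (g t (U.out t)) (U.out t - z t) ^ 2 ≤
      2 ^ k * (G * D) ^ 2 := by
  calc _ ≤ ∑ _t ∈ Finset.Ico a (e + 1), (G * D) ^ 2 := by
        refine Finset.sum_le_sum fun t ht => ?_
        have ht' : t ∈ Finset.Icc a e := by
          rw [Finset.mem_Ico] at ht; rw [Finset.mem_Icc]; omega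
        rw [← sq_abs]
        have := abs_inner_sub_le hs.diam (hs.grad_le t ht' _ (U.out_mem hs ht'))
          (U.out_mem hs ht') (hz t ht')
        gcongr
    _ = _ := by
        rw [Finset.sum_const, Nat.card_Ico, he, nsmul_eq_mul, Nat.add_sub_cancel_left]
        push_cast; ring

/-- The linearized regret of UMS-Comp, compensated by a multiple of the squared inner products. -/
theorem linearized_regret_exp (U : UMSCompRun Ω G D r g o a e (2 ^ k))
    (hs : CompositeSetting Ω G D r g o (Finset.Icc a e)) (he : e + 1 = a + 2 ^ k)
    (hd : 1 ≤ d) {γ : ℝ} (hγ : 0 < γ) {u : Space d} (hu : u ∈ Ω) :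
    ∑ t ∈ Finset.Ico a (e + 1), (inner ℝ (g t (U.out t)) (U.out t - u) + (r (U.out t) - r u)) -
      γ / 2 * ∑ t ∈ Finset.Ico a (e + 1), inner ℝ (g t (U.out t)) (U.out t - u) ^ 2 ≤
      (9 / (8 * γ) + 10 * G * D) * (4 * d * Real.log (2 ^ k + 1) + phi1 (2 ^ k) + 4) +
        2 * G * D * phi2 (2 ^ k) + initGap Ω r o := by
  obtain ⟨K, c, hc0, hc, hK, -, hmeta⟩ := U.meta_regret hs he
  have hk1 : 1 ≤ 2 ^ k := Nat.one_le_two_pow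
  have hGD : 0 < G * D := mul_pos hs.G_pos hs.D_pos
  have hslack := ons_slack hd hc
  set A := c ^ 2 / 4 + 8 / 5 * (1 + d * Real.log (1 + 2 ^ k / 64)) with hA
  have hlog : 0 ≤ Real.log (1 + (2 : ℝ) ^ k / 64) := Real.log_nonneg (by
    have : (0 : ℝ) < 2 ^ k := by positivity
    linarith)
  have hA1 : 8 / 5 ≤ A := by
    have : 0 ≤ d * Real.log (1 + (2 : ℝ) ^ k / 64) := by positivity
    rw [hA]; nlinarith [sq_nonneg c]
  set S := ∑ t ∈ Finset.Ico a (e + 1), inner ℝ (g t (U.out t)) (U.out t - u) ^ 2 with hS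
  obtain ⟨i, hi⟩ := exists_grid_bound hs.G_pos hs.D_pos (by linarith : 1 / 50 ≤ A) hγ
    (Finset.sum_nonneg fun _ _ => sq_nonneg _ : 0 ≤ S) k
    (U.sum_inner_sq_le hs he fun _ _ => hu)
  have hη := gridEta_pos hs.G_pos hs.D_pos i
  have hONS := U.exp_regret hs (by omega) i hu
  have hm := hmeta (UMSExpert.exp i)
  rw [show ((e + 1 : ℕ) : ℝ) - a = 2 ^ k by rw [he]; push_cast; ring] at hONS
  set η := gridEta G D i
  set Si := ∑ t ∈ Finset.Ico a (e + 1),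
    inner ℝ (g t (U.out t)) (U.out t - U.u t (UMSExpert.exp i)) ^ 2 with hSi
  have hSi0 : 0 ≤ Si := Finset.sum_nonneg fun _ _ => sq_nonneg _
  set R := ∑ t ∈ Finset.Ico a (e + 1),
    (inner ℝ (g t (U.out t)) (U.out t - u) + (r (U.out t) - r u)) with hR
  have hsplit : η * R = ∑ t ∈ Finset.Ico a (e + 1),
      (expSurrogate η (g t (U.out t)) (U.out t) (U.u t (UMSExpert.exp i)) -
        expSurrogate η (g t (U.out t)) (U.out t) u + η * (r (U.u t (UMSExpert.exp i)) - r u)) +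
      η * ∑ t ∈ Finset.Ico a (e + 1),
        (inner ℝ (g t (U.out t)) (U.out t - U.u t (UMSExpert.exp i)) +
          (r (U.out t) - r (U.u t (UMSExpert.exp i)))) - η ^ 2 * Si + η ^ 2 * S := by
    rw [hR, hSi, hS, Finset.mul_sum, Finset.mul_sum, Finset.mul_sum, Finset.mul_sum,
      ← Finset.sum_add_distrib, ← Finset.sum_sub_distrib, ← Finset.sum_add_distrib]
    refine Finset.sum_congr rfl fun t _ => ?_
    unfold expSurrogate
    ring
  have hm2 := mul_le_mul_of_nonneg_left hm hη.le
  have hm3 := surrogate_meta_le (c := c) (K := G * D * K) (η := η) hSi0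
  have hfin : η * R ≤ η * (G * D * K + initGap Ω r o + A / η + η * S) := by
    have : η * (G * D * K + initGap Ω r o + A / η + η * S) =
        η * (G * D * K) + η * initGap Ω r o + A + η ^ 2 * S := by field_simp
    rw [this, hsplit, hA]
    linarith
  have hfin' := le_of_mul_le_mul_left hfin hη
  have hKGD : G * D * K ≤ G * D * (2 * phi2 (2 ^ k)) := by gcongr
  set X := 4 * d * Real.log (2 ^ k + 1) + phi1 (2 ^ k) + 4 with hX
  have hAX : 9 / (4 * γ) * A ≤ 9 / (8 * γ) * X := by
    have : 9 / (4 * γ) * A = 9 / (8 * γ) * (2 * A) := by field_simp; ring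
    rw [this]; gcongr
  have hAX2 : 10 * (G * D) * A ≤ 10 * (G * D) * X := by gcongr; linarith
  linarith

/-- The analogue of `linearized_regret_exp` with squared distances in place of squared inner
products. -/
theorem linearized_regret_str (U : UMSCompRun Ω G D r g o a e (2 ^ k))
    (hs : CompositeSetting Ω G D r g o (Finset.Icc a e)) (he : e + 1 = a + 2 ^ k)
    {lam : ℝ} (hlam : 0 < lam) {u : Space d} (hu : u ∈ Ω) :
    ∑ t ∈ Finset.Ico a (e + 1), (inner ℝ (g t (U.out t)) (U.out t - u) + (r (U.out t) - r u)) -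
      lam / 2 * ∑ t ∈ Finset.Ico a (e + 1), ‖U.out t - u‖ ^ 2 ≤
      (9 * G ^ 2 / lam + 10 * G * D) * (7 * Real.log (2 ^ k) + phi1 (2 ^ k) + 8) +
        2 * G * D * phi2 (2 ^ k) + initGap Ω r o := by
  obtain ⟨K, c, hc0, hc, hK, -, hmeta⟩ := U.meta_regret hs he
  have hk1 : 1 ≤ 2 ^ k := Nat.one_le_two_pow
  have hG := hs.G_pos
  have hGD : 0 < G * D := mul_pos hs.G_pos hs.D_pos
  have hlog : 0 ≤ Real.log ((2 : ℝ) ^ k) := Real.log_nonneg (by exact_mod_cast hk1)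
  have hphi : 0 ≤ phi1 (2 ^ k) := by unfold phi1; positivity
  set A := c ^ 2 / 4 + 49 / 100 * (1 + Real.log (2 ^ k)) with hA
  have hA1 : 1 / 50 ≤ A := by rw [hA]; nlinarith [sq_nonneg c]
  set S := ∑ t ∈ Finset.Ico a (e + 1), ‖U.out t - u‖ ^ 2 with hS
  have hS0 : 0 ≤ S := Finset.sum_nonneg fun _ _ => sq_nonneg _
  have hmem : ∀ t ∈ Finset.Ico a (e + 1), t ∈ Finset.Icc a e := fun t ht => by
    rw [Finset.mem_Ico] at ht; rw [Finset.mem_Icc]; omega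
  have hSle : G ^ 2 * S ≤ 2 ^ k * (G * D) ^ 2 := by
    have h1 : S ≤ ∑ _t ∈ Finset.Ico a (e + 1), D ^ 2 := by
      refine Finset.sum_le_sum fun t ht => ?_
      have := hs.diam _ (U.out_mem hs (hmem t ht)) u hu
      gcongr
    rw [Finset.sum_const, Nat.card_Ico, he, nsmul_eq_mul, Nat.add_sub_cancel_left] at h1
    push_cast at h1
    calc G ^ 2 * S ≤ G ^ 2 * (2 ^ k * D ^ 2) := by gcongr
      _ = _ := by ring
  obtain ⟨i, hi⟩ := exists_grid_bound hs.G_pos hs.D_pos hA1 (by positivity : 0 < lam / G ^ 2)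
    (by positivity : 0 ≤ G ^ 2 * S) k hSle
  have hη := gridEta_pos hs.G_pos hs.D_pos i
  have hF := U.str_regret hs (by omega) i hu
  have hm := hmeta (UMSExpert.str i)
  rw [show e + 1 - a = 2 ^ k by omega] at hF
  push_cast at hF
  set η := gridEta G D i
  set Si := ∑ t ∈ Finset.Ico a (e + 1), ‖U.out t - U.u t (UMSExpert.str i)‖ ^ 2 with hSi
  have hSi0 : 0 ≤ Si := Finset.sum_nonneg fun _ _ => sq_nonneg _
  have hSi' : ∑ t ∈ Finset.Ico a (e + 1),
      inner ℝ (g t (U.out t)) (U.out t - U.u t (UMSExpert.str i)) ^ 2 ≤ G ^ 2 * Si := by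
    rw [hSi, Finset.mul_sum]
    refine Finset.sum_le_sum fun t ht => ?_
    have h1 := abs_real_inner_le_norm (g t (U.out t)) (U.out t - U.u t (UMSExpert.str i))
    have h2 := hs.grad_le t (hmem t ht) _ (U.out_mem hs (hmem t ht))
    rw [← sq_abs, ← mul_pow]
    gcongr
    exact h1.trans (by gcongr)
  set R := ∑ t ∈ Finset.Ico a (e + 1),
    (inner ℝ (g t (U.out t)) (U.out t - u) + (r (U.out t) - r u)) with hR
  have hsplit : η * R = ∑ t ∈ Finset.Ico a (e + 1),
      (strSurrogate G η (g t (U.out t)) (U.out t) (U.u t (UMSExpert.str i)) -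
        strSurrogate G η (g t (U.out t)) (U.out t) u +
          η * (r (U.u t (UMSExpert.str i)) - r u)) +
      η * ∑ t ∈ Finset.Ico a (e + 1),
        (inner ℝ (g t (U.out t)) (U.out t - U.u t (UMSExpert.str i)) +
          (r (U.out t) - r (U.u t (UMSExpert.str i)))) -
        η ^ 2 * G ^ 2 * Si + η ^ 2 * G ^ 2 * S := by
    rw [hR, hSi, hS, Finset.mul_sum, Finset.mul_sum, Finset.mul_sum, Finset.mul_sum,
      ← Finset.sum_add_distrib, ← Finset.sum_sub_distrib, ← Finset.sum_add_distrib]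
    refine Finset.sum_congr rfl fun t _ => ?_
    unfold strSurrogate
    ring
  have hm' := hm.trans (add_le_add_right
    (mul_le_mul_of_nonneg_left (Real.sqrt_le_sqrt hSi') hc0) (G * D * K))
  have hm2 := mul_le_mul_of_nonneg_left hm' hη.le
  have hm3 := surrogate_meta_le (c := c) (K := G * D * K) (η := η) (by positivity : 0 ≤ G ^ 2 * Si)
  have hfin : η * R ≤ η * (G * D * K + initGap Ω r o + A / η + η * (G ^ 2 * S)) := by
    have : η * (G * D * K + initGap Ω r o + A / η + η * (G ^ 2 * S)) =
        η * (G * D * K) + η * initGap Ω r o + A + η ^ 2 * G ^ 2 * S := by field_simp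
    rw [this, hsplit, hA]
    linarith
  have hfin' := le_of_mul_le_mul_left hfin hη
  have hKGD : G * D * K ≤ G * D * (2 * phi2 (2 ^ k)) := by gcongr
  set X := 7 * Real.log (2 ^ k) + phi1 (2 ^ k) + 8 with hX
  have hAX0 : A ≤ X := by
    rcases hc with rfl | ⟨-, hc⟩
    · rw [hA, hX]; linarith
    · rw [hA, hX]; linarith
  have hX0 : 0 ≤ X := by rw [hX]; linarith
  have hAX : 9 / (4 * (lam / G ^ 2)) * A ≤ 9 * G ^ 2 / lam * X := by
    have : 9 / (4 * (lam / G ^ 2)) * A = 9 * G ^ 2 / lam * (A / 4) := by field_simp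
    rw [this]; gcongr; linarith
  have hAX2 : 10 * (G * D) * A ≤ 10 * (G * D) * X := by gcongr
  have hlamS : lam / G ^ 2 / 2 * (G ^ 2 * S) = lam / 2 * S := by field_simp
  rw [hlamS] at hi
  linarith

/-- The regret of UMS-Comp on convex losses. -/
theorem regret_convex (U : UMSCompRun Ω G D r g o a e (2 ^ k))
    (hs : CompositeSetting Ω G D r g o (Finset.Icc a e)) (he : e + 1 = a + 2 ^ k)
    {f : ℕ → Space d → ℝ} (hf : ∀ t ∈ Finset.Icc a e, ConvexOn ℝ Ω (f t))
    (hg : ∀ t ∈ Finset.Icc a e, ∀ x ∈ Ω, HasGradientWithinAt (f t) (g t x) Ω x)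
    {u : Space d} (hu : u ∈ Ω) :
    ∑ t ∈ Finset.Ico a (e + 1), (f t (U.out t) + r (U.out t) - (f t u + r u)) ≤
      G * D * (phi2 (2 ^ k) + 1) + G * D * phi3 (2 ^ k) * Real.sqrt (2 ^ k) +
        initGap Ω r o := by
  obtain ⟨K, c, hc0, hc, -, hK, hmeta⟩ := U.meta_regret hs he
  have hk1 : 1 ≤ 2 ^ k := Nat.one_le_two_pow
  have hG := hs.G_pos
  have hD := hs.D_pos
  have hGD : 0 < G * D := mul_pos hs.G_pos hs.D_pos
  have hmem : ∀ t ∈ Finset.Ico a (e + 1), t ∈ Finset.Icc a e := fun t ht => by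
    rw [Finset.mem_Ico] at ht; rw [Finset.mem_Icc]; omega
  have hz : ∀ t ∈ Finset.Icc a e, U.u t UMSExpert.cvx ∈ Ω := fun t ht => by
    rw [Finset.mem_Icc] at ht; exact U.u_mem hs.start_mem ht.1 (by omega) _
  have hm := hmeta UMSExpert.cvx
  have hS := Real.sqrt_le_sqrt (U.sum_inner_sq_le hs he hz)
  rw [Real.sqrt_mul (by positivity), Real.sqrt_sq hGD.le] at hS
  have hs0 : 0 < D / (G * Real.sqrt (7 * (2 ^ k : ℕ))) := by positivity
  have hF := fobos_regret hs.reg_convex hs0 (v := fun t => g t (U.u t UMSExpert.cvx))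
    (z := fun t => U.u t UMSExpert.cvx) (a := a) (b := e + 1) (by omega)
    (fun t ht => U.cvx_step t (hmem t ht))
    (B := G ^ 2) (fun t ht => by
      have := hs.grad_le t (hmem t ht) _ (hz t (hmem t ht))
      gcongr) hu
  simp only [U.u_init] at hF
  rw [show ((e + 1 : ℕ) : ℝ) - a = 2 ^ k by rw [he]; push_cast; ring] at hF
  have hgap := hs.sub_le_initGap (U.u_mem hs.start_mem (t := e + 1) (by omega) le_rfl
    UMSExpert.cvx)
  have hopt : 1 / (2 * (D / (G * Real.sqrt (7 * (2 ^ k : ℕ))))) *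
      (‖u - o‖ ^ 2 - ‖u - U.u (e + 1) UMSExpert.cvx‖ ^ 2) +
      D / (G * Real.sqrt (7 * (2 ^ k : ℕ))) / 2 * G ^ 2 * 2 ^ k ≤
      G * D * (Real.sqrt 7 * Real.sqrt (2 ^ k)) := by
    have h1 : ‖u - o‖ ^ 2 - ‖u - U.u (e + 1) UMSExpert.cvx‖ ^ 2 ≤ D ^ 2 := by
      have h2 : ‖u - o‖ ^ 2 ≤ D ^ 2 := by
        gcongr; exact hs.diam u hu o hs.start_mem
      nlinarith [sq_nonneg ‖u - U.u (e + 1) UMSExpert.cvx‖]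
    push_cast
    rw [← Real.sqrt_mul (by norm_num)]
    have hq : Real.sqrt (7 * 2 ^ k) ^ 2 = 7 * 2 ^ k := Real.sq_sqrt (by positivity)
    have hq0 : 0 < Real.sqrt (7 * 2 ^ k) := by positivity
    set q := Real.sqrt (7 * 2 ^ k)
    have hk : (2 : ℝ) ^ k = q ^ 2 / 7 := by linarith
    rw [hk]
    calc _ ≤ 1 / (2 * (D / (G * q))) * D ^ 2 + D / (G * q) / 2 * G ^ 2 * (q ^ 2 / 7) := by
          gcongr
      _ = G * D * q * (4 / 7) := by field_simp; ring
      _ ≤ G * D * q := by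
          have : 0 < G * D * q := by positivity
          linarith
  have h1 : ∑ t ∈ Finset.Ico a (e + 1), (f t (U.out t) + r (U.out t) - (f t u + r u)) ≤
      ∑ t ∈ Finset.Ico a (e + 1), (inner ℝ (g t (U.out t)) (U.out t - U.u t UMSExpert.cvx) +
        (r (U.out t) - r (U.u t UMSExpert.cvx))) +
      ∑ t ∈ Finset.Ico a (e + 1), (inner ℝ (g t (U.u t UMSExpert.cvx))
        (U.u t UMSExpert.cvx - u) + (r (U.u t UMSExpert.cvx) - r u)) := by
    rw [← Finset.sum_add_distrib]
    refine Finset.sum_le_sum fun t ht => ?_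
    have ht' := hmem t ht
    have h2 := first_order_of_convexOn (hf t ht') (hg t ht' _ (U.out_mem hs ht'))
      (U.out_mem hs ht') (hz t ht')
    have h3 := first_order_of_convexOn (hf t ht') (hg t ht' _ (hz t ht')) (hz t ht') hu
    linarith
  have h2 : c * Real.sqrt (∑ t ∈ Finset.Ico a (e + 1),
      inner ℝ (g t (U.out t)) (U.out t - U.u t UMSExpert.cvx) ^ 2) ≤
      c * (Real.sqrt (2 ^ k) * (G * D)) := by gcongr
  have h3 := mul_le_mul_of_nonneg_left hK hGD.le
  unfold phi3
  linarith

end UMSCompRun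

/-! ### Geometric covering intervals -/

section Covering

variable {p q : ℕ} {φ B : ℕ → ℝ}

/-- An interval ending at a multiple of `2 ^ k` and shorter than `2 ^ k` is a disjoint union of GC
intervals with distinct lengths. -/
theorem cover_left (hp : 1 ≤ p)
    (H : ∀ k m, 1 ≤ m → p ≤ m * 2 ^ k → (m + 1) * 2 ^ k ≤ q + 1 →
      ∑ t ∈ Finset.Ico (m * 2 ^ k) ((m + 1) * 2 ^ k), φ t ≤ B k)
    (k m l : ℕ) (hl : l < 2 ^ k) (h1 : p + l ≤ m * 2 ^ k) (h2 : m * 2 ^ k ≤ q + 1) :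
    ∃ J : Finset ℕ, (∀ j ∈ J, j < k) ∧ ∑ j ∈ J, 2 ^ j = l ∧
      ∑ t ∈ Finset.Ico (m * 2 ^ k - l) (m * 2 ^ k), φ t ≤ ∑ j ∈ J, B j := by
  induction k generalizing m l with
  | zero =>
    obtain rfl : l = 0 := by simpa using hl
    exact ⟨∅, by simp⟩
  | succ k ih =>
    have e : m * 2 ^ (k + 1) = (2 * m) * 2 ^ k := by ring
    rw [pow_succ] at hl
    rw [e] at h1 h2 ⊢
    by_cases hlk : l < 2 ^ k
    · obtain ⟨J, hJ1, hJ2, hJ3⟩ := ih (2 * m) l hlk h1 h2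
      exact ⟨J, fun j hj => (hJ1 j hj).trans (Nat.lt_succ_self k), hJ2, hJ3⟩
    · have hm : 1 ≤ m := by
        rcases Nat.eq_zero_or_pos m with rfl | h
        · omega
        · exact h
      obtain ⟨m', hm'⟩ : ∃ m', 2 * m = m' + 1 := ⟨2 * m - 1, by omega⟩
      rw [hm'] at h1 h2 ⊢
      have e2 : (m' + 1) * 2 ^ k = m' * 2 ^ k + 2 ^ k := by ring
      obtain ⟨J, hJ1, hJ2, hJ3⟩ := ih m' (l - 2 ^ k) (by omega) (by omega) (by omega)
      have hk : k ∉ J := fun h => lt_irrefl k (hJ1 k h)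
      refine ⟨insert k J, ?_, ?_, ?_⟩
      · intro j hj
        rcases Finset.mem_insert.1 hj with rfl | hj
        · omega
        · exact (hJ1 j hj).trans (Nat.lt_succ_self k)
      · rw [Finset.sum_insert hk, hJ2]; omega
      · rw [Finset.sum_insert hk,
          ← Finset.sum_Ico_consecutive φ (n := m' * 2 ^ k) (by omega) (by omega), add_comm]
        have e3 : (m' + 1) * 2 ^ k - l = m' * 2 ^ k - (l - 2 ^ k) := by omega
        rw [e3]
        exact add_le_add (H k m' (by omega) (by omega) h2) hJ3

/-- An interval starting at a multiple of `2 ^ k` and shorter than `2 ^ k` is a disjoint union of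
GC intervals with distinct lengths. -/
theorem cover_right
    (H : ∀ k m, 1 ≤ m → p ≤ m * 2 ^ k → (m + 1) * 2 ^ k ≤ q + 1 →
      ∑ t ∈ Finset.Ico (m * 2 ^ k) ((m + 1) * 2 ^ k), φ t ≤ B k)
    (k m l : ℕ) (hm : 1 ≤ m) (hl : l < 2 ^ k) (h1 : p ≤ m * 2 ^ k)
    (h2 : m * 2 ^ k + l ≤ q + 1) :
    ∃ J : Finset ℕ, (∀ j ∈ J, j < k) ∧ ∑ j ∈ J, 2 ^ j = l ∧
      ∑ t ∈ Finset.Ico (m * 2 ^ k) (m * 2 ^ k + l), φ t ≤ ∑ j ∈ J, B j := by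
  induction k generalizing m l with
  | zero =>
    obtain rfl : l = 0 := by simpa using hl
    exact ⟨∅, by simp⟩
  | succ k ih =>
    have e : m * 2 ^ (k + 1) = (2 * m) * 2 ^ k := by ring
    rw [pow_succ] at hl
    rw [e] at h1 h2 ⊢
    by_cases hlk : l < 2 ^ k
    · obtain ⟨J, hJ1, hJ2, hJ3⟩ := ih (2 * m) l (by omega) hlk h1 h2
      exact ⟨J, fun j hj => (hJ1 j hj).trans (Nat.lt_succ_self k), hJ2, hJ3⟩
    · have e2 : (2 * m + 1) * 2 ^ k = 2 * m * 2 ^ k + 2 ^ k := by ring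
      obtain ⟨J, hJ1, hJ2, hJ3⟩ := ih (2 * m + 1) (l - 2 ^ k) (by omega) (by omega) (by omega)
        (by omega)
      have hk : k ∉ J := fun h => lt_irrefl k (hJ1 k h)
      refine ⟨insert k J, ?_, ?_, ?_⟩
      · intro j hj
        rcases Finset.mem_insert.1 hj with rfl | hj
        · omega
        · exact (hJ1 j hj).trans (Nat.lt_succ_self k)
      · rw [Finset.sum_insert hk, hJ2]; omega
      · rw [Finset.sum_insert hk,
          ← Finset.sum_Ico_consecutive φ (n := (2 * m + 1) * 2 ^ k) (by omega) (by omega)]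
        have e3 : 2 * m * 2 ^ k + l = (2 * m + 1) * 2 ^ k + (l - 2 ^ k) := by omega
        rw [e3]
        exact add_le_add (H k (2 * m) (by omega) h1 (by omega)) hJ3

/-- Every interval of rounds is a disjoint union of two families of GC intervals, each with
distinct lengths: split at a multiple of the largest possible power of two. -/
theorem exists_cover (hp : 1 ≤ p) (hpq : p ≤ q)
    (H : ∀ k m, 1 ≤ m → p ≤ m * 2 ^ k → (m + 1) * 2 ^ k ≤ q + 1 →
      ∑ t ∈ Finset.Ico (m * 2 ^ k) ((m + 1) * 2 ^ k), φ t ≤ B k) :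
    ∃ J₁ J₂ : Finset ℕ, ∑ j ∈ J₁, 2 ^ j + ∑ j ∈ J₂, 2 ^ j = q + 1 - p ∧
      ∑ t ∈ Finset.Ico p (q + 1), φ t ≤ ∑ j ∈ J₁, B j + ∑ j ∈ J₂, B j := by
  classical
  -- the largest `k` such that a multiple of `2 ^ k` lies in `[p, q + 1]`; two consecutive multiples
  -- would contain an even one, so both remaining parts are shorter than `2 ^ k`
  let P : ℕ → Prop := fun k => ∃ m, p ≤ m * 2 ^ k ∧ m * 2 ^ k ≤ q + 1
  have hP0 : P 0 := ⟨p, by simp, by simp; omega⟩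
  have hbound : ∀ k, P k → k ≤ q + 1 := by
    rintro k ⟨m, h1, h2⟩
    have hm : 1 ≤ m := by
      rcases Nat.eq_zero_or_pos m with rfl | h
      · omega
      · exact h
    have := Nat.lt_two_pow_self (n := k)
    nlinarith
  have hspec : P (Nat.findGreatest P (q + 1)) :=
    Nat.findGreatest_spec (m := 0) (Nat.zero_le _) hP0
  set k := Nat.findGreatest P (q + 1) with hk
  have hmax : ¬ P (k + 1) := fun h => by
    have := Nat.le_findGreatest (hbound _ h) h
    omega
  obtain ⟨m, h1, h2⟩ := hspec
  have hm : 1 ≤ m := by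
    rcases Nat.eq_zero_or_pos m with rfl | h
    · omega
    · exact h
  have hpar : ∀ m', p ≤ m' * 2 ^ k → m' * 2 ^ k ≤ q + 1 → ¬ Even m' := by
    rintro m' h3 h4 ⟨c, rfl⟩
    refine hmax ⟨c, ?_, ?_⟩ <;> rw [pow_succ] <;> linarith
  have hodd := hpar m h1 h2
  have hleft : m * 2 ^ k - p < 2 ^ k := by
    by_contra! h
    obtain ⟨m', rfl⟩ : ∃ m', m = m' + 1 := ⟨m - 1, by omega⟩
    have e : (m' + 1) * 2 ^ k = m' * 2 ^ k + 2 ^ k := by ring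
    have hpos : 0 < 2 ^ k := Nat.two_pow_pos k
    rw [Nat.even_add_one, not_not] at hodd
    exact hpar m' (by omega) (by omega) hodd
  have hright : q + 1 - m * 2 ^ k < 2 ^ k := by
    by_contra! h
    have e : (m + 1) * 2 ^ k = m * 2 ^ k + 2 ^ k := by ring
    exact hpar (m + 1) (by omega) (by omega) (by rwa [Nat.even_add_one])
  obtain ⟨J₁, -, h3, h4⟩ := cover_left hp H k m (m * 2 ^ k - p) hleft (by omega) h2
  obtain ⟨J₂, -, h5, h6⟩ := cover_right H k m (q + 1 - m * 2 ^ k) hm hright h1 (by omega)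
  refine ⟨J₁, J₂, by omega, ?_⟩
  rw [show m * 2 ^ k - (m * 2 ^ k - p) = p by omega] at h4
  rw [show m * 2 ^ k + (q + 1 - m * 2 ^ k) = q + 1 by omega] at h6
  rw [← Finset.sum_Ico_consecutive φ h1 h2]
  exact add_le_add h4 h6

end Covering

/-- A family of powers of two with distinct exponents has few members compared with its sum. -/
theorem two_pow_card_le (J : Finset ℕ) : 2 ^ J.card ≤ ∑ j ∈ J, 2 ^ j + 1 := by
  induction J using Finset.induction_on_max with
  | empty => simp
  | insert a J ha ih =>
    have haJ : a ∉ J := fun h => lt_irrefl a (ha a h)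
    have hcard : J.card ≤ a := by
      have : J ⊆ Finset.range a := fun j hj => Finset.mem_range.2 (ha j hj)
      simpa using Finset.card_le_card this
    have := Nat.pow_le_pow_right (n := 2) (by norm_num) hcard
    rw [Finset.card_insert_of_notMem haJ, Finset.sum_insert haJ, pow_succ]
    omega

/-- The square roots of the lengths form a geometric progression, dominated by the largest one. -/
theorem sum_sqrt_two_pow_le (J : Finset ℕ) :
    ∑ j ∈ J, Real.sqrt (2 ^ j) ≤ 7 / 2 * Real.sqrt (∑ j ∈ J, (2 : ℝ) ^ j) := by
  have hs1 : 1.414 ≤ Real.sqrt 2 := Real.le_sqrt_of_sq_le (by norm_num)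
  have hgeom : ∀ k, ∑ j ∈ Finset.range k, Real.sqrt (2 ^ j) ≤ 2.42 * Real.sqrt (2 ^ k) := by
    intro k
    induction k with
    | zero => simp; norm_num
    | succ k ih =>
      rw [Finset.sum_range_succ, pow_succ, Real.sqrt_mul (by positivity)]
      nlinarith [Real.sqrt_nonneg (2 ^ k)]
  rcases J.eq_empty_or_nonempty with rfl | hJ
  · simp
  set a := J.max' hJ
  have hsub : J ⊆ Finset.range (a + 1) := fun j hj =>
    Finset.mem_range.2 (Nat.lt_succ_of_le (J.le_max' j hj))
  have h1 : ∑ j ∈ J, Real.sqrt (2 ^ j) ≤ ∑ j ∈ Finset.range (a + 1), Real.sqrt (2 ^ j) :=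
    Finset.sum_le_sum_of_subset_of_nonneg hsub fun _ _ _ => Real.sqrt_nonneg _
  rw [Finset.sum_range_succ] at h1
  have h2 : Real.sqrt (2 ^ a) ≤ Real.sqrt (∑ j ∈ J, (2 : ℝ) ^ j) :=
    Real.sqrt_le_sqrt (Finset.single_le_sum (f := fun j => (2 : ℝ) ^ j)
      (fun _ _ => by positivity) (J.max'_mem hJ))
  have := hgeom a
  linarith [Real.sqrt_nonneg (2 ^ a)]

/-- The number of GC intervals in the covering of an interval of rounds. -/
theorem card_cover_le {p q : ℕ} (hpq : p ≤ q) {J₁ J₂ : Finset ℕ}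
    (h : ∑ j ∈ J₁, 2 ^ j + ∑ j ∈ J₂, 2 ^ j = q + 1 - p) :
    (J₁.card : ℝ) + J₂.card ≤ boundB p q := by
  have key : ∀ J : Finset ℕ, ∑ j ∈ J, 2 ^ j ≤ q + 1 - p →
      (J.card : ℝ) ≤ ⌈Real.logb 2 ((q : ℝ) - p + 2)⌉ := by
    intro J hJ
    refine le_trans ?_ (Int.le_ceil _)
    rw [Real.le_logb_iff_rpow_le (by norm_num) (by
      have : (p : ℝ) ≤ q := by exact_mod_cast hpq
      linarith), Real.rpow_natCast]
    have h1 : 2 ^ J.card + p ≤ q + 2 := by have := two_pow_card_le J; omega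
    have h2 : (2 : ℝ) ^ J.card + p ≤ q + 2 := by exact_mod_cast h1
    linarith
  have h1 := key J₁ (by omega)
  have h2 := key J₂ (by omega)
  unfold boundB
  linarith

/-- At most one interval of each length contains round `t`, and its length is at most `t`. -/
theorem card_gcActive_le (t : ℕ) : (gcActive t).card ≤ t := by
  have h : Set.InjOn Prod.fst (gcActive t : Set GCInterval) := by
    rintro ⟨k, i⟩ h1 ⟨k', j⟩ h2 (rfl : k = k')
    rw [Finset.mem_coe, mem_gcActive] at h1 h2
    simp only [gcStart, gcEnd] at h1 h2
    have hpos : 0 < 2 ^ k := by positivity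
    have h3 : (i + 1) * 2 ^ k < (j + 2) * 2 ^ k := by
      have : 0 < (j + 2) * 2 ^ k := by positivity
      omega
    have h4 : (j + 1) * 2 ^ k < (i + 2) * 2 ^ k := by
      have : 0 < (i + 2) * 2 ^ k := by positivity
      omega
    have h5 := Nat.lt_of_mul_lt_mul_right h3
    have h6 := Nat.lt_of_mul_lt_mul_right h4
    have : i = j := by omega
    rw [this]
  have := Finset.card_le_card_of_injOn (t := Finset.range t) Prod.fst (fun I hI => by
    simp only [gcActive, Finset.coe_filter, Finset.mem_product, Set.mem_ofPred_eq] at hI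
    exact hI.1.1) h
  simpa using this

theorem one_le_gcStart (I : GCInterval) : 1 ≤ gcStart I := by
  unfold gcStart
  exact Nat.succ_le_of_lt (by positivity)

theorem gcEnd_add_one (I : GCInterval) : gcEnd I + 1 = gcStart I + 2 ^ I.1 := by
  unfold gcEnd gcStart
  have : 0 < (I.2 + 2) * 2 ^ I.1 := by positivity
  have e : (I.2 + 2) * 2 ^ I.1 = (I.2 + 1) * 2 ^ I.1 + 2 ^ I.1 := by ring
  omega

theorem gcStart_le_gcEnd (I : GCInterval) : gcStart I ≤ gcEnd I := by
  have := gcEnd_add_one I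
  have : 1 ≤ 2 ^ I.1 := Nat.one_le_two_pow
  omega

/-! ### Regret of UMA-Comp on a geometric covering interval -/

namespace UMACompRun

variable {d T : ℕ} {Ω : Set (Space d)} {G D : ℝ} {r : Space d → ℝ}
  {g : ℕ → Space d → Space d} {o : Space d}

theorem expert_setting (hs : CompositeSetting Ω G D r g o (Finset.Icc 1 T)) (I : GCInterval) :
    CompositeSetting Ω G D r g o (Finset.Icc (gcStart I) (min (gcEnd I) T)) :=
  hs.mono (Finset.Icc_subset_Icc (one_le_gcStart I) (min_le_right _ _))

theorem isSleepingRun (run : UMACompRun Ω G D r g o T)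
    (hs : CompositeSetting Ω G D r g o (Finset.Icc 1 T)) :
    IsSleepingRun Ω G D r g gcActive gcStart gcEnd
      (fun I => Real.log (4 * (gcEnd I : ℝ) ^ 2)) (fun _ => 1) 1 T
      (fun t I => (run.expert I).out t) run.w run.x run.L run.p run.m run.ℓ run.ℓbar where
  isMeta := run.isMeta
  G_pos := hs.G_pos
  D_pos := hs.D_pos
  convex := hs.convex
  diam := hs.diam
  grad_le := hs.grad_le
  reg_convex := hs.reg_convex
  mem_active t ht i := mem_gcActive
  active_nonempty t ht := ⟨(0, t - 1), by
    have := (Finset.mem_Icc.1 ht).1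
    rw [mem_gcActive]
    simp only [gcStart, gcEnd, pow_zero, mul_one]
    omega⟩
  y_mem t ht I hI := (run.expert I).out_mem (expert_setting hs I) (by
    rw [mem_gcActive] at hI
    rw [Finset.mem_Icc] at ht ⊢
    omega)
  first_le := one_le_gcStart
  κ_pos I := by
    apply Real.log_pos
    have : (1 : ℝ) ≤ gcEnd I := by
      exact_mod_cast (one_le_gcStart I).trans (gcStart_le_gcEnd I)
    nlinarith
  x₀_pos _ := one_pos

/-- At the end of a GC interval that ends in round `s`, the total potential is at most `4 s ^ 2`. -/
theorem log_potential_le (run : UMACompRun Ω G D r g o T)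
    (hs : CompositeSetting Ω G D r g o (Finset.Icc 1 T)) {I : GCInterval} (hI : gcEnd I ≤ T) :
    Real.log (run.x (gcEnd I + 1) I) ≤ Real.log (4 * (gcEnd I : ℝ) ^ 2) := by
  classical
  have h := run.isSleepingRun hs
  have h1 := one_le_gcStart I
  have h2 := gcStart_le_gcEnd I
  have hx := (h.pos_and_nonneg (i := I) (t := gcEnd I + 1) (by omega) le_rfl (by omega)).1
  apply Real.log_le_log hx
  set e := gcEnd I with he
  have hpot := h.potential_le ((Finset.Ico 1 (e + 1)).biUnion gcActive) (t := e + 1) (by omega)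
    (by omega) (fun I _ => gcStart_le_gcEnd I)
    (fun s hs => Finset.subset_biUnion_of_mem gcActive hs) (i := I)
    (Finset.mem_biUnion.2 ⟨e, by rw [Finset.mem_Ico]; omega, mem_gcActive.2 ⟨h2, le_rfl⟩⟩)
    (by omega) le_rfl
  have hcard : ((Finset.Ico 1 (e + 1)).biUnion gcActive).card ≤ e * e := by
    refine (Finset.card_biUnion_le_card_mul _ _ e fun t ht => ?_).trans (by simp)
    have := card_gcActive_le t
    rw [Finset.mem_Ico] at ht
    omega
  have hcard' : (((Finset.Ico 1 (e + 1)).biUnion gcActive).card : ℝ) ≤ e * e := by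
    exact_mod_cast hcard
  have hdecay : ∑ s ∈ Finset.Ico 1 (e + 1), ∑ i ∈ gcActive s,
      (run.L (s + 1) i - run.L s i) / (2 * (1 + run.L s i)) ≤
      ∑ s ∈ Finset.Ico 1 (e + 1), (e : ℝ) := by
    refine Finset.sum_le_sum fun s hs' => ?_
    have hs'' : s ∈ Finset.Icc 1 T := by rw [Finset.mem_Ico] at hs'; rw [Finset.mem_Icc]; omega
    calc _ ≤ ∑ i ∈ gcActive s, (1 : ℝ) := by
          refine Finset.sum_le_sum fun i hi => ?_
          have h3 := (h.pos_and_nonneg_of_active hs'' hi).2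
          have h4 := (h.L_step hs'' hi).2
          rw [div_le_one (by positivity)]
          linarith
      _ ≤ e := by
          rw [Finset.sum_const, nsmul_eq_mul, mul_one]
          have := card_gcActive_le s
          rw [Finset.mem_Ico] at hs'
          exact_mod_cast (by omega : (gcActive s).card ≤ e)
  rw [Finset.sum_const, Nat.card_Ico, nsmul_eq_mul, Nat.add_sub_cancel] at hdecay
  rw [Finset.sum_const, nsmul_eq_mul, mul_one] at hpot
  refine hpot.trans ?_
  have he1 : 1 / Real.exp 1 ≤ 1 := by
    rw [div_le_one (Real.exp_pos 1)]; linarith [Real.exp_one_gt_d9]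
  have h5 : 1 / Real.exp 1 * ∑ s ∈ Finset.Ico 1 (e + 1), ∑ i ∈ gcActive s,
      (run.L (s + 1) i - run.L s i) / (2 * (1 + run.L s i)) ≤ 1 * ((e : ℝ) * e) := by
    have : (0 : ℝ) < 1 / Real.exp 1 := by positivity
    calc _ ≤ 1 / Real.exp 1 * ((e : ℝ) * e) := by gcongr
      _ ≤ _ := by gcongr
  nlinarith [sq_nonneg (e : ℝ)]

/-- The regret of UMA-Comp against its instance of UMS-Comp on a GC interval. -/
theorem meta_regret (run : UMACompRun Ω G D r g o T)
    (hs : CompositeSetting Ω G D r g o (Finset.Icc 1 T)) {I : GCInterval} {q : ℕ}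
    (hIq : gcEnd I ≤ q) (hqT : q ≤ T) :
    ∑ t ∈ Finset.Ico (gcStart I) (gcEnd I + 1),
      (inner ℝ (g t (run.w t)) (run.w t - (run.expert I).out t) +
        (r (run.w t) - r ((run.expert I).out t))) ≤
      G * D * boundC q + Real.sqrt (boundC q) *
        Real.sqrt (∑ t ∈ Finset.Ico (gcStart I) (gcEnd I + 1),
          inner ℝ (g t (run.w t)) (run.w t - (run.expert I).out t) ^ 2) := by
  have h := run.isSleepingRun hs
  have hGD : 0 < G * D := mul_pos hs.G_pos hs.D_pos
  have h1 := one_le_gcStart I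
  have h2 := gcStart_le_gcEnd I
  have hlin : ∑ t ∈ Finset.Ico (gcStart I) (gcEnd I + 1),
      (inner ℝ (g t (run.w t)) (run.w t - (run.expert I).out t) +
        (r (run.w t) - r ((run.expert I).out t))) ≤
      G * D * ∑ t ∈ Finset.Ico (gcStart I) (gcEnd I + 1), (run.ℓbar t - run.ℓ t I) := by
    rw [Finset.mul_sum]
    refine Finset.sum_le_sum fun t ht => ?_
    rw [Finset.mem_Ico] at ht
    exact h.linearized_le (by rw [Finset.mem_Icc]; omega) (mem_gcActive.2 (by omega))
  have hreg := h.sum_regret_eq (i := I) (t := gcEnd I + 1) (by omega) le_rfl (by omega)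
  have hpot := run.log_potential_le hs (hIq.trans hqT)
  have hL0 := (h.pos_and_nonneg (i := I) (t := gcEnd I + 1) (by omega) le_rfl (by omega)).2
  have hsum := h.sum_learningRate_mul_le (i := I) (t := gcEnd I + 1) (by omega) le_rfl (by omega)
  have hinv := inv_learningRate_le (h.κ_pos I) hL0
  have hη := learningRate_pos (h.κ_pos I) hL0
  rw [← h.L_eq (i := I) (t := gcEnd I + 1) (by omega) le_rfl (by omega),
    Real.sqrt_mul (by positivity), Real.sqrt_sq hGD.le]
  have he1 : (1 : ℝ) ≤ gcEnd I := by exact_mod_cast h1.trans h2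
  have hκ1 : 1 ≤ Real.log (4 * (gcEnd I : ℝ) ^ 2) :=
    one_le_log_three.trans (Real.log_le_log (by norm_num) (by nlinarith))
  have hκc : 16 * Real.log (4 * (gcEnd I : ℝ) ^ 2) ≤ boundC q := by
    have h3 : Real.log (4 * (gcEnd I : ℝ) ^ 2) = 2 * Real.log (2 * gcEnd I) := by
      rw [show 4 * (gcEnd I : ℝ) ^ 2 = (2 * gcEnd I) ^ 2 by ring, Real.log_pow]
      norm_num
    have h4 : (gcEnd I : ℝ) ≤ q := by exact_mod_cast hIq
    have h5 : Real.log (2 * (gcEnd I : ℝ)) ≤ Real.log (2 * q) :=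
      Real.log_le_log (by linarith) (by linarith)
    unfold boundC
    linarith
  set κ := Real.log (4 * (gcEnd I : ℝ) ^ 2)
  set V := run.L (gcEnd I + 1) I
  have hκs : Real.sqrt κ * 4 ≤ Real.sqrt (boundC q) := by
    rw [show (4 : ℝ) = Real.sqrt (4 ^ 2) by rw [Real.sqrt_sq (by norm_num)],
      ← Real.sqrt_mul (by linarith)]
    exact Real.sqrt_le_sqrt (by linarith)
  have hκs1 : Real.sqrt κ ≤ κ := by
    rw [Real.sqrt_le_left (by linarith)]; nlinarith
  have hkey : κ * Real.sqrt ((1 + V) / κ) ≤ κ + Real.sqrt κ * Real.sqrt V := by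
    have h3 : κ * Real.sqrt ((1 + V) / κ) = Real.sqrt κ * Real.sqrt (1 + V) := by
      rw [Real.sqrt_div' _ (by linarith), mul_div_assoc', div_eq_iff (by positivity)]
      rw [mul_right_comm, Real.mul_self_sqrt (by linarith)]
    have h4 : Real.sqrt (1 + V) ≤ 1 + Real.sqrt V := by
      apply Real.sqrt_le_iff.2
      exact ⟨by positivity, by nlinarith [Real.sq_sqrt hL0, Real.sqrt_nonneg V]⟩
    rw [h3]
    nlinarith [Real.sqrt_nonneg κ]
  have hR : ∑ t ∈ Finset.Ico (gcStart I) (gcEnd I + 1), (run.ℓbar t - run.ℓ t I) ≤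
      boundC q + Real.sqrt (boundC q) * Real.sqrt V := by
    have h3 : Real.log (run.x (gcEnd I + 1) I) / learningRate κ V ≤
        κ * (4 + Real.sqrt ((1 + V) / κ)) := by
      rw [div_eq_mul_one_div]
      calc _ ≤ κ * (1 / learningRate κ V) := by
            gcongr
        _ ≤ _ := by gcongr
    have h4 : Real.sqrt κ * 4 * Real.sqrt V ≤ Real.sqrt (boundC q) * Real.sqrt V := by
      gcongr
    have h5 : 0 ≤ Real.sqrt κ * Real.sqrt V := by positivity
    rw [hreg, Real.log_one, zero_div, sub_zero]
    linarith
  refine hlin.trans ((mul_le_mul_of_nonneg_left hR hGD.le).trans (le_of_eq (by ring)))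

end UMACompRun

/-! ### Regret on a covering interval for each class of losses -/

theorem boundC_nonneg {q : ℕ} (hq : 1 ≤ q) : 0 ≤ boundC q := by
  unfold boundC
  have h1 : (1 : ℝ) ≤ q := by exact_mod_cast hq
  have := Real.log_nonneg (by linarith : (1 : ℝ) ≤ 2 * q)
  linarith

theorem onsBeta_pos {G D : ℝ} (hG : 0 < G) (hD : 0 < D) {α : ℝ} (hα : 0 < α) :
    0 < onsBeta G D α := by
  unfold onsBeta
  have : 0 < min (1 / (4 * G * D)) α := lt_min (by positivity) hα
  positivity

/-- A quadratic gain absorbs a linear loss; with `a = √c` this turns the second-order meta bound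
`√c * √S` into a constant. -/
theorem mul_sub_sq_le (a b : ℝ) {γ : ℝ} (hγ : 0 < γ) :
    a * b - γ / 2 * b ^ 2 ≤ 1 / (2 * γ) * a ^ 2 := by
  have h : 1 / (2 * γ) * a ^ 2 - (a * b - γ / 2 * b ^ 2) = 1 / (2 * γ) * (a - γ * b) ^ 2 := by
    field_simp
    ring
  have : 0 ≤ 1 / (2 * γ) * (a - γ * b) ^ 2 := by positivity
  linarith

namespace UMACompRun

variable {d T : ℕ} {Ω : Set (Space d)} {G D : ℝ} {r : Space d → ℝ}
  {g : ℕ → Space d → Space d} {o : Space d}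

theorem w_mem (run : UMACompRun Ω G D r g o T)
    (hs : CompositeSetting Ω G D r g o (Finset.Icc 1 T)) {t : ℕ} (ht : t ∈ Finset.Icc 1 T) :
    run.w t ∈ Ω := (run.isSleepingRun hs).decision_mem ht

theorem mem_rounds {I : GCInterval} (hI : gcEnd I ≤ T) {t : ℕ}
    (ht : t ∈ Finset.Ico (gcStart I) (gcEnd I + 1)) :
    t ∈ Finset.Icc 1 T ∧ t ∈ Finset.Icc (gcStart I) (min (gcEnd I) T) ∧
      t ∈ Finset.Icc (gcStart I) (gcEnd I) := by
  have := one_le_gcStart I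
  simp only [Finset.mem_Ico, Finset.mem_Icc] at ht ⊢
  omega

/-- The regret of UMA-Comp on a GC interval, for exp-concave losses. -/
theorem interval_regret_exp (run : UMACompRun Ω G D r g o T)
    (hs : CompositeSetting Ω G D r g o (Finset.Icc 1 T)) {I : GCInterval} {q : ℕ}
    (hIq : gcEnd I ≤ q) (hqT : q ≤ T) {f : ℕ → Space d → ℝ}
    (hf : ∀ t ∈ Finset.Icc 1 T, ∀ x ∈ Ω, HasGradientWithinAt (f t) (g t x) Ω x)
    (hd : 1 ≤ d) {α : ℝ} (hα : 0 < α)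
    (hexp : ∀ t ∈ Finset.Icc (gcStart I) (gcEnd I), ExpConcaveOn α Ω (f t))
    {v : Space d} (hv : v ∈ Ω) :
    ∑ t ∈ Finset.Ico (gcStart I) (gcEnd I + 1),
      (f t (run.w t) + r (run.w t) - (f t v + r v)) ≤
      (G * D + 1 / (2 * onsBeta G D α)) * boundC q +
      ((9 / (8 * onsBeta G D α) + 10 * G * D) *
        (4 * d * Real.log (2 ^ I.1 + 1) + phi1 (2 ^ I.1) + 4) +
        2 * G * D * phi2 (2 ^ I.1)) + initGap Ω r o := by
  have hG := hs.G_pos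
  have hD := hs.D_pos
  have hmem := fun t => mem_rounds (t := t) (hIq.trans hqT)
  have hend : Finset.Ico (gcStart I) (min (gcEnd I) T + 1) =
      Finset.Ico (gcStart I) (gcEnd I + 1) := by rw [min_eq_left (hIq.trans hqT)]
  have hβ : 0 < onsBeta G D α := onsBeta_pos hG hD hα
  have hmeta := run.meta_regret hs hIq hqT
  have hU : ∑ t ∈ Finset.Ico (gcStart I) (min (gcEnd I) T + 1),
      (inner ℝ (g t ((run.expert I).out t)) ((run.expert I).out t - v) +
        (r ((run.expert I).out t) - r v)) -
      onsBeta G D α / 2 * ∑ t ∈ Finset.Ico (gcStart I) (min (gcEnd I) T + 1),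
        inner ℝ (g t ((run.expert I).out t)) ((run.expert I).out t - v) ^ 2 ≤ _ :=
    UMSCompRun.linearized_regret_exp (k := I.1) (run.expert I) (expert_setting hs I)
      (by rw [min_eq_left (hIq.trans hqT), gcEnd_add_one]) hd hβ hv
  have hout := fun t ht => (run.expert I).out_mem (expert_setting hs I) (t := t) ht
  rw [hend] at hU
  set y := fun t => (run.expert I).out t with hy
  change ∀ t, t ∈ _ → y t ∈ Ω at hout
  set β := onsBeta G D α with hβdef
  set S := ∑ t ∈ Finset.Ico (gcStart I) (gcEnd I + 1),
    inner ℝ (g t (run.w t)) (run.w t - y t) ^ 2 with hS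
  have hS0 : 0 ≤ S := Finset.sum_nonneg fun _ _ => sq_nonneg _
  have hsplit : ∑ t ∈ Finset.Ico (gcStart I) (gcEnd I + 1),
      (f t (run.w t) + r (run.w t) - (f t v + r v)) ≤
      (∑ t ∈ Finset.Ico (gcStart I) (gcEnd I + 1),
        (inner ℝ (g t (run.w t)) (run.w t - y t) + (r (run.w t) - r (y t))) - β / 2 * S) +
      (∑ t ∈ Finset.Ico (gcStart I) (gcEnd I + 1),
        (inner ℝ (g t (y t)) (y t - v) + (r (y t) - r v)) -
        β / 2 * ∑ t ∈ Finset.Ico (gcStart I) (gcEnd I + 1),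
          inner ℝ (g t (y t)) (y t - v) ^ 2) := by
    rw [hS, Finset.mul_sum, Finset.mul_sum, ← Finset.sum_sub_distrib, ← Finset.sum_sub_distrib,
      ← Finset.sum_add_distrib]
    refine Finset.sum_le_sum fun t ht => ?_
    obtain ⟨h1, h2, h3⟩ := hmem t ht
    have hw := run.w_mem hs h1
    have h4 := first_order_of_expConcaveOn hα hG hD (hexp t h3) hs.diam (hf t h1 _ hw)
      (hs.grad_le t h1 _ hw) hw (hout t h2)
    have h5 := first_order_of_expConcaveOn hα hG hD (hexp t h3) hs.diam (hf t h1 _ (hout t h2))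
      (hs.grad_le t h1 _ (hout t h2)) (hout t h2) hv
    linarith
  have hc0 : 0 ≤ boundC q :=
    boundC_nonneg ((one_le_gcStart I).trans ((gcStart_le_gcEnd I).trans hIq))
  have hsq : Real.sqrt (boundC q) * Real.sqrt S - β / 2 * S ≤ 1 / (2 * β) * boundC q := by
    have h := mul_sub_sq_le (Real.sqrt (boundC q)) (Real.sqrt S) hβ
    rwa [Real.sq_sqrt hc0, Real.sq_sqrt hS0] at h
  change _ ≤ G * D * boundC q + Real.sqrt (boundC q) * Real.sqrt S at hmeta
  change _ - _ ≤ _ at hU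
  have hfin := add_le_add hmeta hU
  refine hsplit.trans ?_
  linarith

/-- The regret of UMA-Comp on a GC interval, for strongly convex losses. -/
theorem interval_regret_str (run : UMACompRun Ω G D r g o T)
    (hs : CompositeSetting Ω G D r g o (Finset.Icc 1 T)) {I : GCInterval} {q : ℕ}
    (hIq : gcEnd I ≤ q) (hqT : q ≤ T) {f : ℕ → Space d → ℝ} {lam : ℝ} (hlam : 0 < lam)
    (hstr : ∀ t ∈ Finset.Icc (gcStart I) (gcEnd I), StronglyConvexWith lam Ω (f t) (g t))
    {v : Space d} (hv : v ∈ Ω) :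
    ∑ t ∈ Finset.Ico (gcStart I) (gcEnd I + 1),
      (f t (run.w t) + r (run.w t) - (f t v + r v)) ≤
      (G * D + G ^ 2 / (2 * lam)) * boundC q +
      ((9 * G ^ 2 / lam + 10 * G * D) * (7 * Real.log (2 ^ I.1) + phi1 (2 ^ I.1) + 8) +
        2 * G * D * phi2 (2 ^ I.1)) + initGap Ω r o := by
  have hG := hs.G_pos
  have hD := hs.D_pos
  have hmem := fun t => mem_rounds (t := t) (hIq.trans hqT)
  have hend : Finset.Ico (gcStart I) (min (gcEnd I) T + 1) =
      Finset.Ico (gcStart I) (gcEnd I + 1) := by rw [min_eq_left (hIq.trans hqT)]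
  have hmeta := run.meta_regret hs hIq hqT
  have hU : ∑ t ∈ Finset.Ico (gcStart I) (min (gcEnd I) T + 1),
      (inner ℝ (g t ((run.expert I).out t)) ((run.expert I).out t - v) +
        (r ((run.expert I).out t) - r v)) -
      lam / 2 * ∑ t ∈ Finset.Ico (gcStart I) (min (gcEnd I) T + 1),
        ‖(run.expert I).out t - v‖ ^ 2 ≤ _ :=
    UMSCompRun.linearized_regret_str (k := I.1) (run.expert I) (expert_setting hs I)
      (by rw [min_eq_left (hIq.trans hqT), gcEnd_add_one]) hlam hv
  have hout := fun t ht => (run.expert I).out_mem (expert_setting hs I) (t := t) ht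
  rw [hend] at hU
  set y := fun t => (run.expert I).out t with hy
  change ∀ t, t ∈ _ → y t ∈ Ω at hout
  set S := ∑ t ∈ Finset.Ico (gcStart I) (gcEnd I + 1), ‖run.w t - y t‖ ^ 2 with hS
  have hS0 : 0 ≤ S := Finset.sum_nonneg fun _ _ => sq_nonneg _
  have hfirst : ∀ {h : Space d → ℝ} {h' : Space d → Space d}, StronglyConvexWith lam Ω h h' →
      ∀ x ∈ Ω, ∀ z ∈ Ω, h x - h z ≤ inner ℝ (h' x) (x - z) - lam / 2 * ‖x - z‖ ^ 2 := by
    intro h h' hc x hx z hz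
    have := hc x hx z hz
    rw [← neg_sub x z, inner_neg_right, norm_neg] at this
    linarith
  have hsplit : ∑ t ∈ Finset.Ico (gcStart I) (gcEnd I + 1),
      (f t (run.w t) + r (run.w t) - (f t v + r v)) ≤
      (∑ t ∈ Finset.Ico (gcStart I) (gcEnd I + 1),
        (inner ℝ (g t (run.w t)) (run.w t - y t) + (r (run.w t) - r (y t))) - lam / 2 * S) +
      (∑ t ∈ Finset.Ico (gcStart I) (gcEnd I + 1),
        (inner ℝ (g t (y t)) (y t - v) + (r (y t) - r v)) -
        lam / 2 * ∑ t ∈ Finset.Ico (gcStart I) (gcEnd I + 1), ‖y t - v‖ ^ 2) := by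
    rw [hS, Finset.mul_sum, Finset.mul_sum, ← Finset.sum_sub_distrib, ← Finset.sum_sub_distrib,
      ← Finset.sum_add_distrib]
    refine Finset.sum_le_sum fun t ht => ?_
    obtain ⟨h1, h2, h3⟩ := hmem t ht
    have h4 := hfirst (hstr t h3) _ (run.w_mem hs h1) _ (hout t h2)
    have h5 := hfirst (hstr t h3) _ (hout t h2) _ hv
    linarith
  have hSi : ∑ t ∈ Finset.Ico (gcStart I) (gcEnd I + 1),
      inner ℝ (g t (run.w t)) (run.w t - y t) ^ 2 ≤ G ^ 2 * S := by
    rw [hS, Finset.mul_sum]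
    refine Finset.sum_le_sum fun t ht => ?_
    obtain ⟨h1, -, -⟩ := hmem t ht
    have h2 := abs_real_inner_le_norm (g t (run.w t)) (run.w t - y t)
    have h3 := hs.grad_le t h1 _ (run.w_mem hs h1)
    rw [← sq_abs, ← mul_pow]
    gcongr
    exact h2.trans (by gcongr)
  have hc0 : 0 ≤ boundC q :=
    boundC_nonneg ((one_le_gcStart I).trans ((gcStart_le_gcEnd I).trans hIq))
  have hsq : Real.sqrt (boundC q) * Real.sqrt (G ^ 2 * S) - lam / 2 * S ≤
      G ^ 2 / (2 * lam) * boundC q := by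
    rw [Real.sqrt_mul (by positivity), Real.sqrt_sq hG.le]
    have h := mul_sub_sq_le (G * Real.sqrt (boundC q)) (Real.sqrt S) hlam
    rw [mul_pow, Real.sq_sqrt hc0, Real.sq_sqrt hS0] at h
    refine le_trans (le_of_eq ?_) (h.trans (le_of_eq ?_)) <;> ring
  have hmeta' := hmeta.trans (add_le_add_right
    (mul_le_mul_of_nonneg_left (Real.sqrt_le_sqrt hSi) (Real.sqrt_nonneg _)) _)
  have hfin := add_le_add hmeta' hU
  refine hsplit.trans ?_
  linarith

/-- The regret of UMA-Comp on a GC interval, for convex losses. -/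
theorem interval_regret_convex (run : UMACompRun Ω G D r g o T)
    (hs : CompositeSetting Ω G D r g o (Finset.Icc 1 T)) {I : GCInterval} {q : ℕ}
    (hIq : gcEnd I ≤ q) (hqT : q ≤ T) {f : ℕ → Space d → ℝ}
    (hf : ∀ t ∈ Finset.Icc 1 T, ∀ x ∈ Ω, HasGradientWithinAt (f t) (g t x) Ω x)
    (hcvx : ∀ t ∈ Finset.Icc (gcStart I) (gcEnd I), ConvexOn ℝ Ω (f t))
    {v : Space d} (hv : v ∈ Ω) :
    ∑ t ∈ Finset.Ico (gcStart I) (gcEnd I + 1),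
      (f t (run.w t) + r (run.w t) - (f t v + r v)) ≤
      G * D * (boundC q + phi2 (2 ^ I.1) + 1) + initGap Ω r o +
      G * D * (Real.sqrt (boundC q) + phi3 (2 ^ I.1)) * Real.sqrt (2 ^ I.1) := by
  have hG := hs.G_pos
  have hD := hs.D_pos
  have hGD : 0 < G * D := mul_pos hG hD
  have hmem := fun t => mem_rounds (t := t) (hIq.trans hqT)
  have hend : Finset.Ico (gcStart I) (min (gcEnd I) T + 1) =
      Finset.Ico (gcStart I) (gcEnd I + 1) := by rw [min_eq_left (hIq.trans hqT)]
  have hmeta := run.meta_regret hs hIq hqT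
  have hU : ∑ t ∈ Finset.Ico (gcStart I) (min (gcEnd I) T + 1),
      (f t ((run.expert I).out t) + r ((run.expert I).out t) - (f t v + r v)) ≤ _ :=
    UMSCompRun.regret_convex (k := I.1) (run.expert I) (expert_setting hs I)
      (by rw [min_eq_left (hIq.trans hqT), gcEnd_add_one])
      (f := f) (fun t ht => hcvx t (by rwa [min_eq_left (hIq.trans hqT)] at ht))
      (fun t ht => hf t (Finset.Icc_subset_Icc (one_le_gcStart I) (min_le_right _ _) ht)) hv
  have hout := fun t ht => (run.expert I).out_mem (expert_setting hs I) (t := t) ht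
  rw [hend] at hU
  set y := fun t => (run.expert I).out t with hy
  change ∀ t, t ∈ _ → y t ∈ Ω at hout
  have hsplit : ∑ t ∈ Finset.Ico (gcStart I) (gcEnd I + 1),
      (f t (run.w t) + r (run.w t) - (f t v + r v)) ≤
      ∑ t ∈ Finset.Ico (gcStart I) (gcEnd I + 1),
        (inner ℝ (g t (run.w t)) (run.w t - y t) + (r (run.w t) - r (y t))) +
      ∑ t ∈ Finset.Ico (gcStart I) (gcEnd I + 1), (f t (y t) + r (y t) - (f t v + r v)) := by
    rw [← Finset.sum_add_distrib]
    refine Finset.sum_le_sum fun t ht => ?_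
    obtain ⟨h1, h2, h3⟩ := hmem t ht
    have h4 := first_order_of_convexOn (hcvx t h3) (hf t h1 _ (run.w_mem hs h1))
      (run.w_mem hs h1) (hout t h2)
    linarith
  have hSi : ∑ t ∈ Finset.Ico (gcStart I) (gcEnd I + 1),
      inner ℝ (g t (run.w t)) (run.w t - y t) ^ 2 ≤ (G * D) ^ 2 * 2 ^ I.1 := by
    calc _ ≤ ∑ _t ∈ Finset.Ico (gcStart I) (gcEnd I + 1), (G * D) ^ 2 := by
          refine Finset.sum_le_sum fun t ht => ?_
          obtain ⟨h1, h2, -⟩ := hmem t ht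
          rw [← sq_abs]
          have := abs_inner_sub_le hs.diam (hs.grad_le t h1 _ (run.w_mem hs h1))
            (run.w_mem hs h1) (hout t h2)
          gcongr
      _ = _ := by
          rw [Finset.sum_const, Nat.card_Ico, gcEnd_add_one, nsmul_eq_mul,
            Nat.add_sub_cancel_left]
          push_cast; ring
  have hsq := Real.sqrt_le_sqrt hSi
  rw [Real.sqrt_mul (by positivity), Real.sqrt_sq hGD.le] at hsq
  have hmeta' := hmeta.trans (add_le_add_right
    (mul_le_mul_of_nonneg_left hsq (Real.sqrt_nonneg _)) _)
  have hfin := add_le_add hmeta' hU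
  refine hsplit.trans ?_
  linarith

end UMACompRun

/-! ### From geometric covering intervals to arbitrary intervals -/

/-- A bound `X + Y √|I|` on every GC interval gives `X b + O(Y √n)` on an interval of length `n`. -/
theorem sum_le_of_interval_bounds {p q : ℕ} {φ : ℕ → ℝ} (hp : 1 ≤ p) (hpq : p ≤ q)
    {X Y : ℝ} (hX : 0 ≤ X) (hY : 0 ≤ Y)
    (H : ∀ I : GCInterval, p ≤ gcStart I → gcEnd I ≤ q →
      ∑ t ∈ Finset.Ico (gcStart I) (gcEnd I + 1), φ t ≤ X + Y * Real.sqrt (2 ^ I.1)) :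
    ∑ t ∈ Finset.Ico p (q + 1), φ t ≤ X * boundB p q + 7 * Y * Real.sqrt ((q : ℝ) - p + 1) := by
  obtain ⟨J₁, J₂, h1, h2⟩ := exists_cover (B := fun k => X + Y * Real.sqrt (2 ^ k)) hp hpq (by
    intro k m hm h1 h2
    obtain ⟨i, rfl⟩ : ∃ i, m = i + 1 := ⟨m - 1, by omega⟩
    have e : gcEnd (k, i) + 1 = (i + 1 + 1) * 2 ^ k := by
      rw [gcEnd_add_one]; simp only [gcStart]; ring
    have := H (k, i) h1 (by omega)
    rwa [e] at this)
  have hcard := card_cover_le hpq h1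
  have hn : (0 : ℝ) ≤ (q : ℝ) - p := by rw [sub_nonneg]; exact_mod_cast hpq
  have key : ∀ J : Finset ℕ, ∑ j ∈ J, 2 ^ j ≤ q + 1 - p →
      ∑ j ∈ J, (X + Y * Real.sqrt (2 ^ j)) ≤
        X * J.card + Y * (7 / 2 * Real.sqrt ((q : ℝ) - p + 1)) := by
    intro J hJ
    rw [Finset.sum_add_distrib, Finset.sum_const, nsmul_eq_mul, ← Finset.mul_sum]
    have h3 : ∑ j ∈ J, (2 : ℝ) ^ j ≤ (q : ℝ) - p + 1 := by
      have h4 : ∑ j ∈ J, 2 ^ j + p ≤ q + 1 := by omega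
      have h5 : ∑ j ∈ J, (2 : ℝ) ^ j + p ≤ q + 1 := by exact_mod_cast h4
      linarith
    have h6 := sum_sqrt_two_pow_le J
    have h7 := Real.sqrt_le_sqrt h3
    have h8 : Y * ∑ j ∈ J, Real.sqrt (2 ^ j) ≤ Y * (7 / 2 * Real.sqrt ((q : ℝ) - p + 1)) := by
      gcongr; linarith
    linarith
  have h3 := key J₁ (by omega)
  have h4 := key J₂ (by omega)
  have h5 := mul_le_mul_of_nonneg_left hcard hX
  linarith

theorem compositeRegret_eq {d : ℕ} (f : ℕ → Space d → ℝ) (r : Space d → ℝ) (w : ℕ → Space d)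
    (p q : ℕ) (v : Space d) :
    compositeRegret f r w p q v =
      ∑ t ∈ Finset.Ico p (q + 1), (f t (w t) + r (w t) - (f t v + r v)) := by
  unfold compositeRegret
  rw [← Finset.sum_sub_distrib]
  refine Finset.sum_congr ?_ fun _ _ => rfl
  ext t; simp only [Finset.mem_Icc, Finset.mem_Ico]; omega

theorem phi1_mono {n n' : ℝ} (hn : 1 ≤ n) (h : n ≤ n') : phi1 n ≤ phi1 n' := by
  unfold phi1
  have h1 := one_le_log_expertCount hn
  have h2 := half_le_logFactor hn
  have h3 := log_expertCount_mono hn h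
  have h4 := logFactor_mono hn h
  gcongr

theorem phi2_mono {n n' : ℝ} (hn : 1 ≤ n) (h : n ≤ n') : phi2 n ≤ phi2 n' := by
  unfold phi2
  linarith [log_expertCount_mono hn h, logFactor_mono hn h]

theorem phi3_mono {n n' : ℝ} (hn : 1 ≤ n) (h : n ≤ n') : phi3 n ≤ phi3 n' := by
  unfold phi3
  linarith [log_expertCount_mono hn h, logFactor_mono hn h]

theorem two_pow_le_length {p q : ℕ} {I : GCInterval} (h1 : p ≤ gcStart I) (h2 : gcEnd I ≤ q) :
    (1 : ℝ) ≤ 2 ^ I.1 ∧ (2 : ℝ) ^ I.1 ≤ (q : ℝ) - p + 1 := by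
  have h3 := gcEnd_add_one I
  have h4 : 2 ^ I.1 + p ≤ q + 1 := by omega
  have h5 : (2 : ℝ) ^ I.1 + p ≤ q + 1 := by exact_mod_cast h4
  exact ⟨one_le_pow₀ (by norm_num), by linarith⟩

theorem phi1_nonneg (n : ℝ) : 0 ≤ phi1 n := by unfold phi1; positivity

theorem phi2_nonneg {n : ℝ} (hn : 1 ≤ n) : 0 ≤ phi2 n := by
  unfold phi2
  linarith [one_le_log_expertCount hn, half_le_logFactor hn]

theorem phi3_nonneg {n : ℝ} (hn : 1 ≤ n) : 0 ≤ phi3 n := by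
  unfold phi3
  linarith [one_le_log_expertCount hn, half_le_logFactor hn, Real.sqrt_nonneg 7]

section Bounds

variable {d T : ℕ} {Ω : Set (Space d)} {G D : ℝ} {r : Space d → ℝ}
  {g : ℕ → Space d → Space d} {o : Space d}

theorem initGap_nonneg (hs : CompositeSetting Ω G D r g o (Finset.Icc 1 T)) :
    0 ≤ initGap Ω r o := by
  simpa using hs.sub_le_initGap hs.start_mem

theorem boundExp_nonneg (d : ℕ) {β : ℝ} (hG : 0 < G) (hD : 0 < D) (hβ : 0 < β) {p q : ℕ}
    (hpq : p ≤ q) : 0 ≤ boundExp d G D β p q := by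
  have hn : (0 : ℝ) ≤ (q : ℝ) - p := by rw [sub_nonneg]; exact_mod_cast hpq
  have h1 := phi1_nonneg ((q : ℝ) - p + 1)
  have h2 := phi2_nonneg (by linarith : (1 : ℝ) ≤ (q : ℝ) - p + 1)
  have h3 := Real.log_nonneg (by linarith : (1 : ℝ) ≤ (q : ℝ) - p + 2)
  unfold boundExp
  positivity

theorem boundStr_nonneg {lam : ℝ} (hG : 0 < G) (hD : 0 < D) (hlam : 0 < lam) {p q : ℕ}
    (hpq : p ≤ q) : 0 ≤ boundStr G D lam p q := by
  have hn : (0 : ℝ) ≤ (q : ℝ) - p := by rw [sub_nonneg]; exact_mod_cast hpq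
  have h1 := phi1_nonneg ((q : ℝ) - p + 1)
  have h2 := phi2_nonneg (by linarith : (1 : ℝ) ≤ (q : ℝ) - p + 1)
  have h3 := Real.log_nonneg (by linarith : (1 : ℝ) ≤ (q : ℝ) - p + 1)
  unfold boundStr
  positivity

/-- The quadratic terms of exp-concavity absorb the second-order parts of both meta bounds. -/
theorem regret_exp_le (run : UMACompRun Ω G D r g o T)
    (hs : CompositeSetting Ω G D r g o (Finset.Icc 1 T)) {f : ℕ → Space d → ℝ}
    (hf : ∀ t ∈ Finset.Icc 1 T, ∀ x ∈ Ω, HasGradientWithinAt (f t) (g t x) Ω x)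
    {p q : ℕ} (hp : 1 ≤ p) (hpq : p ≤ q) (hqT : q ≤ T) (hd : 1 ≤ d) {α : ℝ} (hα : 0 < α)
    (hexp : ∀ t ∈ Finset.Icc p q, ExpConcaveOn α Ω (f t)) {v : Space d} (hv : v ∈ Ω) :
    compositeRegret f r run.w p q v ≤
      (G * D + 1 / (2 * onsBeta G D α)) * boundC q * boundB p q +
      boundExp d G D (onsBeta G D α) p q * boundB p q + initGap Ω r o * boundB p q := by
  have hG := hs.G_pos
  have hD := hs.D_pos
  have hβ := onsBeta_pos hG hD hα
  have hc := boundC_nonneg (hp.trans hpq)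
  have hρ := initGap_nonneg hs
  have hE := boundExp_nonneg d hG hD hβ hpq
  rw [compositeRegret_eq]
  have key := sum_le_of_interval_bounds (φ := fun t => f t (run.w t) + r (run.w t) - (f t v + r v))
    (X := (G * D + 1 / (2 * onsBeta G D α)) * boundC q + boundExp d G D (onsBeta G D α) p q +
      initGap Ω r o) (Y := 0) hp hpq (by positivity) le_rfl (by
    intro I h1 h2
    obtain ⟨h3, h4⟩ := two_pow_le_length h1 h2
    refine (run.interval_regret_exp hs h2 hqT hf hd hα
      (fun t ht => hexp t (Finset.Icc_subset_Icc h1 h2 ht)) hv).trans ?_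
    have h5 := phi1_mono h3 h4
    have h6 := phi2_mono h3 h4
    have h7 : Real.log ((2 : ℝ) ^ I.1 + 1) ≤ Real.log ((q : ℝ) - p + 2) :=
      Real.log_le_log (by linarith) (by linarith)
    rw [zero_mul, add_zero]
    unfold boundExp
    gcongr)
  refine key.trans (le_of_eq (by ring))

theorem regret_str_le (run : UMACompRun Ω G D r g o T)
    (hs : CompositeSetting Ω G D r g o (Finset.Icc 1 T)) {f : ℕ → Space d → ℝ}
    {p q : ℕ} (hp : 1 ≤ p) (hpq : p ≤ q) (hqT : q ≤ T) {lam : ℝ} (hlam : 0 < lam)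
    (hstr : ∀ t ∈ Finset.Icc p q, StronglyConvexWith lam Ω (f t) (g t)) {v : Space d}
    (hv : v ∈ Ω) :
    compositeRegret f r run.w p q v ≤
      (G * D + G ^ 2 / (2 * lam)) * boundC q * boundB p q +
      boundStr G D lam p q * boundB p q + initGap Ω r o * boundB p q := by
  have hG := hs.G_pos
  have hD := hs.D_pos
  have hc := boundC_nonneg (hp.trans hpq)
  have hρ := initGap_nonneg hs
  have hE := boundStr_nonneg hG hD hlam hpq
  rw [compositeRegret_eq]
  have key := sum_le_of_interval_bounds (φ := fun t => f t (run.w t) + r (run.w t) - (f t v + r v))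
    (X := (G * D + G ^ 2 / (2 * lam)) * boundC q + boundStr G D lam p q +
      initGap Ω r o) (Y := 0) hp hpq (by positivity) le_rfl (by
    intro I h1 h2
    obtain ⟨h3, h4⟩ := two_pow_le_length h1 h2
    refine (run.interval_regret_str hs h2 hqT hlam
      (fun t ht => hstr t (Finset.Icc_subset_Icc h1 h2 ht)) hv).trans ?_
    have h5 := phi1_mono h3 h4
    have h6 := phi2_mono h3 h4
    have h7 : Real.log ((2 : ℝ) ^ I.1) ≤ Real.log ((q : ℝ) - p + 1) :=
      Real.log_le_log (by linarith) (by linarith)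
    rw [zero_mul, add_zero]
    unfold boundStr
    gcongr)
  refine key.trans (le_of_eq (by ring))

theorem regret_convex_le (run : UMACompRun Ω G D r g o T)
    (hs : CompositeSetting Ω G D r g o (Finset.Icc 1 T)) {f : ℕ → Space d → ℝ}
    (hf : ∀ t ∈ Finset.Icc 1 T, ∀ x ∈ Ω, HasGradientWithinAt (f t) (g t x) Ω x)
    {p q : ℕ} (hp : 1 ≤ p) (hpq : p ≤ q) (hqT : q ≤ T)
    (hcvx : ∀ t ∈ Finset.Icc p q, ConvexOn ℝ Ω (f t)) {v : Space d} (hv : v ∈ Ω) :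
    compositeRegret f r run.w p q v ≤
      G * D * (boundC q + phi2 ((q : ℝ) - p + 1) + 1) * boundB p q +
      7 * (G * D) * (Real.sqrt (boundC q) + phi3 ((q : ℝ) - p + 1)) *
        Real.sqrt ((q : ℝ) - p + 1) + initGap Ω r o * boundB p q := by
  have hGD : 0 < G * D := mul_pos hs.G_pos hs.D_pos
  have hc := boundC_nonneg (hp.trans hpq)
  have hρ := initGap_nonneg hs
  have hn : (1 : ℝ) ≤ (q : ℝ) - p + 1 := by
    have : (p : ℝ) ≤ q := by exact_mod_cast hpq
    linarith
  have h2 := phi2_nonneg hn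
  have h3 := phi3_nonneg hn
  rw [compositeRegret_eq]
  have key := sum_le_of_interval_bounds (φ := fun t => f t (run.w t) + r (run.w t) - (f t v + r v))
    (X := G * D * (boundC q + phi2 ((q : ℝ) - p + 1) + 1) + initGap Ω r o)
    (Y := G * D * (Real.sqrt (boundC q) + phi3 ((q : ℝ) - p + 1))) hp hpq (by positivity)
    (by positivity) (by
    intro I h1 h2
    obtain ⟨h3, h4⟩ := two_pow_le_length h1 h2
    refine (run.interval_regret_convex hs h2 hqT hf
      (fun t ht => hcvx t (Finset.Icc_subset_Icc h1 h2 ht)) hv).trans ?_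
    have h5 := phi2_mono h3 h4
    have h6 := phi3_mono h3 h4
    gcongr)
  refine key.trans (le_of_eq (by ring))

end Bounds

/-! ### Asymptotic form of the bounds -/

theorem log_le_two_mul_sqrt {x : ℝ} (hx : 0 < x) : Real.log x ≤ 2 * Real.sqrt x := by
  have h := Real.log_le_sub_one_of_pos (Real.sqrt_pos.2 hx)
  rw [Real.log_sqrt hx.le] at h
  linarith

theorem logb_two_le {x : ℝ} (hx : 1 ≤ x) : Real.logb 2 x ≤ 1.443 * Real.log x := by
  have h1 := Real.log_two_gt_d9
  have h2 := Real.log_nonneg hx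
  unfold Real.logb
  rw [div_le_iff₀ (by linarith)]
  nlinarith

theorem boundC_le {q : ℕ} (hq : 2 ≤ q) : boundC q ≤ 64 * Real.log q := by
  have h1 : (2 : ℝ) ≤ q := by exact_mod_cast hq
  have h2 := Real.log_le_log (by norm_num) h1
  unfold boundC
  rw [Real.log_mul (by norm_num) (by linarith)]
  linarith

theorem boundB_nonneg {p q : ℕ} (hpq : p ≤ q) : 0 ≤ boundB p q := by
  have hn : (0 : ℝ) ≤ (q : ℝ) - p := by rw [sub_nonneg]; exact_mod_cast hpq
  have h : (0 : ℤ) ≤ ⌈Real.logb 2 ((q : ℝ) - p + 2)⌉ :=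
    Int.ceil_nonneg (Real.logb_nonneg (by norm_num) (by linarith))
  unfold boundB
  positivity

theorem boundB_le {p q : ℕ} (hpq : p + 2 ≤ q) : boundB p q ≤ 9 * Real.log ((q : ℝ) - p) := by
  have hm : (2 : ℝ) ≤ (q : ℝ) - p := by
    have : (p : ℝ) + 2 ≤ q := by exact_mod_cast hpq
    linarith
  have h1 := Real.log_two_gt_d9
  have h2 := Real.log_le_log (by norm_num) hm
  have h3 : Real.logb 2 ((q : ℝ) - p + 2) ≤ 1 + Real.logb 2 ((q : ℝ) - p) := by
    calc _ ≤ Real.logb 2 (2 * ((q : ℝ) - p)) :=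
          Real.logb_le_logb_of_le (by norm_num) (by linarith) (by linarith)
      _ = _ := by
          rw [Real.logb_mul (by norm_num) (by linarith), Real.logb_self_eq_one (by norm_num)]
  have h4 := logb_two_le (by linarith : (1 : ℝ) ≤ (q : ℝ) - p)
  have h5 := Int.ceil_lt_add_one (Real.logb 2 ((q : ℝ) - p + 2))
  unfold boundB
  linarith

theorem one_le_log_of_three_le {x : ℝ} (hx : 3 ≤ x) : 1 ≤ Real.log x :=
  one_le_log_three.trans (Real.log_le_log (by norm_num) hx)

theorem expertCount_le {n x : ℝ} (hn : 1 ≤ n) (h : n ≤ x) (hx : 3 ≤ x) :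
    expertCount n ≤ 5.5 * Real.log x := by
  have h1 := one_le_log_of_three_le hx
  have h2 := Int.ceil_lt_add_one (Real.logb 2 n)
  have h3 := logb_two_le hn
  have h4 := Real.log_le_log (by linarith) h
  unfold expertCount
  linarith

theorem phi1_le {n x : ℝ} (hn : 1 ≤ n) (h : n ≤ x) (hx : 3 ≤ x) : phi1 n ≤ 50 * Real.log x := by
  have h1 := expertCount_le hn h hx
  have h2 := three_le_expertCount hn
  have h3 := one_le_log_expertCount hn
  have h4 := half_le_logFactor hn
  have h5 := logFactor_le hn
  have h6 := log_le_two_mul_sqrt (by linarith : 0 < expertCount n)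
  have h7 : (Real.log (expertCount n) + logFactor n) ^ 2 ≤ (6 * Real.sqrt (expertCount n)) ^ 2 := by
    gcongr; linarith
  rw [mul_pow, Real.sq_sqrt (by linarith)] at h7
  have h8 := one_le_log_of_three_le hx
  unfold phi1
  linarith

theorem phi2_le {n x : ℝ} (hn : 1 ≤ n) (h : n ≤ x) (hx : 3 ≤ x) : phi2 n ≤ 108 * Real.log x := by
  have h1 := expertCount_le hn h hx
  have h2 := three_le_expertCount hn
  have h5 := logFactor_le hn
  have h6 := Real.log_le_sub_one_of_pos (by linarith : 0 < expertCount n)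
  have h8 := one_le_log_of_three_le hx
  unfold phi2
  linarith

theorem one_div_onsBeta_le {G D α : ℝ} (hG : 0 < G) (hD : 0 < D) (hα : 0 < α) :
    1 / (2 * onsBeta G D α) ≤ 4 * (G * D) + 1 / α := by
  have hGD : 0 < G * D := mul_pos hG hD
  have e : 2 * onsBeta G D α = min (1 / (4 * G * D)) α := by unfold onsBeta; ring
  have hα' : 0 < 1 / α := by positivity
  rw [e]
  rcases min_choice (1 / (4 * G * D)) α with h | h <;> rw [h]
  · rw [one_div_one_div]; linarith
  · linarith

section Asymptotic

variable {p q : ℕ} {G D C ρ : ℝ}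

theorem bound_exp_asymptotic (hp : 1 ≤ p) (hpq : p + 2 ≤ q) (hG : 0 < G) (hD : 0 < D)
    (hC : 0 ≤ C) (hρ : ρ ≤ C) {d : ℕ} (hd : 1 ≤ d) {α : ℝ} (hα : 0 < α) :
    (G * D + 1 / (2 * onsBeta G D α)) * boundC q * boundB p q +
      boundExp d G D (onsBeta G D α) p q * boundB p q + ρ * boundB p q ≤
      20000 * (G * D + C + 1 / α) * d * Real.log q * Real.log ((q : ℝ) - p) := by
  have hGD : 0 < G * D := mul_pos hG hD
  have hα' : 0 < 1 / α := by positivity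
  have hp' : (1 : ℝ) ≤ p := by exact_mod_cast hp
  have hpq' : (p : ℝ) + 2 ≤ q := by exact_mod_cast hpq
  have hd' : (1 : ℝ) ≤ d := by exact_mod_cast hd
  have hq3 : (3 : ℝ) ≤ q := by linarith
  have hlq := one_le_log_of_three_le hq3
  set lq := Real.log q
  set Y := G * D + C + 1 / α with hY
  have hYp : 0 < Y := by positivity
  have hβ := one_div_onsBeta_le hG hD hα
  have hβ2 : 9 / (8 * onsBeta G D α) = 9 / 4 * (1 / (2 * onsBeta G D α)) := by
    rw [div_mul_div_comm, mul_one, ← mul_assoc]; norm_num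
  have hβp := onsBeta_pos hG hD hα
  have hc0 := boundC_nonneg (by omega : 1 ≤ q)
  have hc := boundC_le (by omega : 2 ≤ q)
  have hn1 : (1 : ℝ) ≤ (q : ℝ) - p + 1 := by linarith
  have hn2 : (q : ℝ) - p + 1 ≤ q := by linarith
  have h1 := phi1_le hn1 hn2 hq3
  have h1' := phi1_nonneg ((q : ℝ) - p + 1)
  have h2 := phi2_le hn1 hn2 hq3
  have h2' := phi2_nonneg hn1
  have h3 : Real.log ((q : ℝ) - p + 2) ≤ 2 * lq := by
    have : Real.log ((q : ℝ) ^ 2) = 2 * lq := by rw [Real.log_pow]; norm_num [lq]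
    rw [← this]
    exact Real.log_le_log (by linarith) (by nlinarith)
  have h3' := Real.log_nonneg (by linarith : (1 : ℝ) ≤ (q : ℝ) - p + 2)
  have t1 : (G * D + 1 / (2 * onsBeta G D α)) * boundC q ≤ (5 * Y) * (64 * lq) := by
    gcongr; linarith
  have t2 : boundExp d G D (onsBeta G D α) p q ≤
      (19 * Y) * (4 * d * (2 * lq) + 50 * lq + 4 * lq) + 2 * Y * (108 * lq) := by
    unfold boundExp
    rw [hβ2, mul_assoc 2 G D]
    gcongr
    · linarith
    · linarith
    · linarith
  have hYl : 0 ≤ Y * lq := by positivity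
  have hYd : Y * lq ≤ Y * lq * d := le_mul_of_one_le_right hYl hd'
  have t3 : ρ ≤ Y * lq := by nlinarith
  have hB := boundB_le hpq
  have hB0 := boundB_nonneg (by omega : p ≤ q)
  have hsum : (G * D + 1 / (2 * onsBeta G D α)) * boundC q +
      boundExp d G D (onsBeta G D α) p q + ρ ≤ 2000 * (Y * lq * d) := by
    have e : (19 * Y) * (4 * d * (2 * lq) + 50 * lq + 4 * lq) + 2 * Y * (108 * lq) =
      152 * (Y * lq * d) + 1242 * (Y * lq) := by ring
    rw [e] at t2
    linarith
  have hfin := mul_le_mul hsum hB hB0 (by positivity)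
  have hpos : 0 ≤ Y * lq * d * Real.log ((q : ℝ) - p) := by
    have := Real.log_nonneg (by linarith : (1 : ℝ) ≤ (q : ℝ) - p)
    positivity
  have e2 : 2000 * (Y * lq * d) * (9 * Real.log ((q : ℝ) - p)) =
    18000 * (Y * lq * d * Real.log ((q : ℝ) - p)) := by ring
  have e3 : 20000 * Y * d * lq * Real.log ((q : ℝ) - p) =
    20000 * (Y * lq * d * Real.log ((q : ℝ) - p)) := by ring
  rw [e2] at hfin
  rw [e3]
  linarith

theorem bound_str_asymptotic (hp : 1 ≤ p) (hpq : p + 2 ≤ q) (hG : 0 < G) (hD : 0 < D)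
    (hC : 0 ≤ C) (hρ : ρ ≤ C) {lam : ℝ} (hlam : 0 < lam) :
    (G * D + G ^ 2 / (2 * lam)) * boundC q * boundB p q +
      boundStr G D lam p q * boundB p q + ρ * boundB p q ≤
      20000 * (G * D + C + G ^ 2 / lam) * Real.log q * Real.log ((q : ℝ) - p) := by
  have hGD : 0 < G * D := mul_pos hG hD
  have hGl : 0 < G ^ 2 / lam := by positivity
  have hp' : (1 : ℝ) ≤ p := by exact_mod_cast hp
  have hpq' : (p : ℝ) + 2 ≤ q := by exact_mod_cast hpq
  have hq3 : (3 : ℝ) ≤ q := by linarith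
  have hlq := one_le_log_of_three_le hq3
  set lq := Real.log q
  set Y := G * D + C + G ^ 2 / lam with hY
  have hYp : 0 < Y := by positivity
  have e1 : G ^ 2 / (2 * lam) = 1 / 2 * (G ^ 2 / lam) := by rw [div_mul_div_comm, one_mul]
  have e2 : 9 * G ^ 2 / lam = 9 * (G ^ 2 / lam) := mul_div_assoc _ _ _
  have hc0 := boundC_nonneg (by omega : 1 ≤ q)
  have hc := boundC_le (by omega : 2 ≤ q)
  have hn1 : (1 : ℝ) ≤ (q : ℝ) - p + 1 := by linarith
  have hn2 : (q : ℝ) - p + 1 ≤ q := by linarith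
  have h1 := phi1_le hn1 hn2 hq3
  have h1' := phi1_nonneg ((q : ℝ) - p + 1)
  have h2 := phi2_le hn1 hn2 hq3
  have h2' := phi2_nonneg hn1
  have h3 : Real.log ((q : ℝ) - p + 1) ≤ lq := Real.log_le_log (by linarith) hn2
  have h3' := Real.log_nonneg hn1
  have t1 : (G * D + G ^ 2 / (2 * lam)) * boundC q ≤ Y * (64 * lq) := by
    rw [e1]
    gcongr; linarith
  have t2 : boundStr G D lam p q ≤
      (10 * Y) * (7 * lq + 50 * lq + 8 * lq) + 2 * Y * (108 * lq) := by
    unfold boundStr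
    rw [e2, mul_assoc 2 G D]
    gcongr
    · linarith
    · linarith
    · linarith
  have t3 : ρ ≤ Y * lq := by nlinarith
  have hB := boundB_le hpq
  have hB0 := boundB_nonneg (by omega : p ≤ q)
  have hYl : 0 ≤ Y * lq := by positivity
  have hsum : (G * D + G ^ 2 / (2 * lam)) * boundC q +
      boundStr G D lam p q + ρ ≤ 2000 * (Y * lq) := by
    have e : (10 * Y) * (7 * lq + 50 * lq + 8 * lq) + 2 * Y * (108 * lq) =
      866 * (Y * lq) := by ring
    rw [e] at t2
    linarith
  have hfin := mul_le_mul hsum hB hB0 (by positivity)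
  have hpos : 0 ≤ Y * lq * Real.log ((q : ℝ) - p) := by
    have := Real.log_nonneg (by linarith : (1 : ℝ) ≤ (q : ℝ) - p)
    positivity
  have e3 : 2000 * (Y * lq) * (9 * Real.log ((q : ℝ) - p)) =
    18000 * (Y * lq * Real.log ((q : ℝ) - p)) := by ring
  have e4 : 20000 * Y * lq * Real.log ((q : ℝ) - p) =
    20000 * (Y * lq * Real.log ((q : ℝ) - p)) := by ring
  rw [e3] at hfin
  rw [e4]
  linarith

end Asymptotic

theorem CompositeSetting.initGap_le {d : ℕ} {Ω : Set (Space d)} {G D C : ℝ} {r : Space d → ℝ}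
    {g : ℕ → Space d → Space d} {o : Space d} {s : Finset ℕ}
    (hs : CompositeSetting Ω G D r g o s) (hrC : ∀ x ∈ Ω, r x ≤ C) : initGap Ω r o ≤ C := by
  have h1 : 0 ≤ sInf (r '' Ω) := Real.sInf_nonneg (by
    rintro _ ⟨x, hx, rfl⟩; exact hs.reg_nonneg x hx)
  have h2 := hrC o hs.start_mem
  unfold initGap
  linarith

section Convex

variable {d T : ℕ} {Ω : Set (Space d)} {G D C : ℝ} {r : Space d → ℝ}
  {g : ℕ → Space d → Space d} {o : Space d}

/-- On a short GC interval the meta regret bound is useless and the regret is bounded by the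
length of the interval times the range of the losses. -/
theorem UMACompRun.interval_regret_trivial (run : UMACompRun Ω G D r g o T)
    (hs : CompositeSetting Ω G D r g o (Finset.Icc 1 T)) (hrC : ∀ x ∈ Ω, r x ≤ C)
    {I : GCInterval} (hIT : gcEnd I ≤ T) {f : ℕ → Space d → ℝ}
    (hf : ∀ t ∈ Finset.Icc 1 T, ∀ x ∈ Ω, HasGradientWithinAt (f t) (g t x) Ω x)
    (hcvx : ∀ t ∈ Finset.Icc (gcStart I) (gcEnd I), ConvexOn ℝ Ω (f t))
    {v : Space d} (hv : v ∈ Ω) :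
    ∑ t ∈ Finset.Ico (gcStart I) (gcEnd I + 1),
      (f t (run.w t) + r (run.w t) - (f t v + r v)) ≤ 2 ^ I.1 * (G * D + C) := by
  calc _ ≤ ∑ _t ∈ Finset.Ico (gcStart I) (gcEnd I + 1), (G * D + C) := by
        refine Finset.sum_le_sum fun t ht => ?_
        obtain ⟨h1, -, h3⟩ := mem_rounds hIT ht
        have hw := run.w_mem hs h1
        have h4 := first_order_of_convexOn (hcvx t h3) (hf t h1 _ hw) hw hv
        have h5 := abs_inner_sub_le hs.diam (hs.grad_le t h1 _ hw) hw hv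
        linarith [le_abs_self (inner ℝ (g t (run.w t)) (run.w t - v)), hrC _ hw,
          hs.reg_nonneg v hv]
    _ = _ := by
        rw [Finset.sum_const, Nat.card_Ico, gcEnd_add_one, nsmul_eq_mul,
          Nat.add_sub_cancel_left]
        push_cast; ring

/-- On a GC interval of length `x = 2 ^ k`, the meta regret contributes a term of order `log q`,
which is of order `√(x log q)` once `x` exceeds `c(q)`; for shorter intervals the trivial bound
is at least as good. -/
theorem UMACompRun.interval_regret_sqrt (run : UMACompRun Ω G D r g o T)
    (hs : CompositeSetting Ω G D r g o (Finset.Icc 1 T)) (hrC : ∀ x ∈ Ω, r x ≤ C)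
    {I : GCInterval} {q : ℕ} (hq : 2 ≤ q) (hIq : gcEnd I ≤ q) (hqT : q ≤ T)
    {f : ℕ → Space d → ℝ}
    (hf : ∀ t ∈ Finset.Icc 1 T, ∀ x ∈ Ω, HasGradientWithinAt (f t) (g t x) Ω x)
    (hcvx : ∀ t ∈ Finset.Icc (gcStart I) (gcEnd I), ConvexOn ℝ Ω (f t))
    {v : Space d} (hv : v ∈ Ω) :
    ∑ t ∈ Finset.Ico (gcStart I) (gcEnd I + 1),
      (f t (run.w t) + r (run.w t) - (f t v + r v)) ≤
      131 * (G * D + C) * Real.sqrt (Real.log q) * Real.sqrt (2 ^ I.1) := by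
  have hGD : 0 < G * D := mul_pos hs.G_pos hs.D_pos
  have hC : 0 ≤ C := (hs.reg_nonneg o hs.start_mem).trans (hrC o hs.start_mem)
  have hρ := hs.initGap_le hrC
  have hq' : (2 : ℝ) ≤ q := by exact_mod_cast hq
  have hlq : 0.693 ≤ Real.log q := by
    have := Real.log_le_log (by norm_num) hq'
    linarith [Real.log_two_gt_d9]
  set lq := Real.log q
  set L := Real.sqrt lq
  set x : ℝ := 2 ^ I.1 with hx
  set s := Real.sqrt x
  have hx1 : 1 ≤ x := one_le_pow₀ (by norm_num)
  have hxq : x ≤ q := by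
    have h1 := gcEnd_add_one I
    have h2 := one_le_gcStart I
    rw [hx]
    exact_mod_cast (by omega : 2 ^ I.1 ≤ q)
  have hL : 0.83 ≤ L := Real.le_sqrt_of_sq_le (by norm_num; linarith)
  have hs1 : 1 ≤ s := Real.one_le_sqrt.2 hx1
  have hss : s * s = x := Real.mul_self_sqrt (by linarith)
  have hsL : 0.83 * s ≤ s * L := by nlinarith
  have hc0 := boundC_nonneg (by omega : 1 ≤ q)
  have hc : Real.sqrt (boundC q) ≤ 8 * L := by
    have h := Real.sqrt_le_sqrt (boundC_le hq)
    rwa [Real.sqrt_mul (by norm_num), show (64 : ℝ) = 8 ^ 2 by norm_num,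
      Real.sqrt_sq (by norm_num)] at h
  rcases le_total x (boundC q) with hxc | hxc
  · refine (run.interval_regret_trivial hs hrC (hIq.trans hqT) hf hcvx hv).trans ?_
    have h1 : s ≤ 8 * L := (Real.sqrt_le_sqrt hxc).trans hc
    have h2 : x ≤ 8 * L * s := by rw [← hss]; gcongr
    have h3 : 0 ≤ L * s := by positivity
    calc x * (G * D + C) ≤ (131 * (L * s)) * (G * D + C) := by
          gcongr; linarith
      _ = _ := by ring
  · refine (run.interval_regret_convex hs hIq hqT hf hcvx hv).trans ?_
    have h1 : boundC q ≤ 8 * (s * L) := by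
      calc boundC q = Real.sqrt (boundC q) * Real.sqrt (boundC q) := (Real.mul_self_sqrt hc0).symm
        _ ≤ 8 * L * s := mul_le_mul hc (Real.sqrt_le_sqrt hxc) (Real.sqrt_nonneg _) (by positivity)
        _ = _ := by ring
    have hN := expertCount_two_pow I.1
    rw [← hx] at hN
    have hN0 : 0 < expertCount x := by rw [hN]; positivity
    have hlog := log_le_two_mul_sqrt hN0
    have hLF := logFactor_le hx1
    have hkx : (I.1 : ℝ) ≤ x := by
      rw [hx]; exact_mod_cast (Nat.lt_two_pow_self (n := I.1)).le
    have hsqrt1 : Real.sqrt (expertCount x) ≤ 2 * s := by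
      apply Real.sqrt_le_iff.2 ⟨by positivity, ?_⟩
      rw [hN]; nlinarith
    have hsqrt2 : Real.sqrt (expertCount x) ≤ 2.41 * L := by
      apply Real.sqrt_le_iff.2 ⟨by positivity, ?_⟩
      have hk : (I.1 : ℝ) ≤ 1.443 * lq := by
        have h2 := logb_two_le (by linarith : (1 : ℝ) ≤ q)
        have h3 := Real.logb_le_logb_of_le (by norm_num : (1 : ℝ) < 2) (by linarith) hxq
        rw [hx, Real.logb_pow, Real.logb_self_eq_one (by norm_num), mul_one] at h3
        linarith
      have hLL : L ^ 2 = lq := Real.sq_sqrt (by linarith)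
      rw [hN, mul_pow, hLL]
      norm_num
      linarith
    have h7 : Real.sqrt 7 ≤ 2.65 := Real.sqrt_le_iff.2 ⟨by norm_num, by norm_num⟩
    have h2 : phi2 x + 1 ≤ 96 * (s * L) := by unfold phi2; linarith
    have h3 : phi3 x ≤ 18 * L := by unfold phi3; linarith
    have hCs : C ≤ 131 * C * (s * L) := by
      have : 1 ≤ 131 * (s * L) := by linarith
      nlinarith
    calc _ ≤ G * D * (8 * (s * L) + 96 * (s * L)) + C + G * D * (8 * L + 18 * L) * s := by
          rw [add_assoc (boundC q)]
          gcongr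
      _ ≤ _ := by
          have e : 131 * (G * D + C) * L * s = 131 * (G * D * (s * L)) + 131 * C * (s * L) := by
            ring
          have : 0 ≤ G * D * (s * L) := by positivity
          rw [e]
          linarith

/-- This does not follow from `regret_convex_le`, where the constant part of the meta bound is
counted once per interval and gives `log q log (q - p)`. -/
theorem regret_convex_asymptotic (run : UMACompRun Ω G D r g o T)
    (hs : CompositeSetting Ω G D r g o (Finset.Icc 1 T)) (hrC : ∀ x ∈ Ω, r x ≤ C)
    {f : ℕ → Space d → ℝ}
    (hf : ∀ t ∈ Finset.Icc 1 T, ∀ x ∈ Ω, HasGradientWithinAt (f t) (g t x) Ω x)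
    {p q : ℕ} (hp : 1 ≤ p) (hpq : p + 1 ≤ q) (hqT : q ≤ T)
    (hcvx : ∀ t ∈ Finset.Icc p q, ConvexOn ℝ Ω (f t)) {v : Space d} (hv : v ∈ Ω) :
    compositeRegret f r run.w p q v ≤
      20000 * (G * D + C) * Real.sqrt (((q : ℝ) - p) * Real.log q) := by
  have hGD : 0 < G * D := mul_pos hs.G_pos hs.D_pos
  have hC : 0 ≤ C := (hs.reg_nonneg o hs.start_mem).trans (hrC o hs.start_mem)
  have hn : (1 : ℝ) ≤ (q : ℝ) - p := by
    have : (p : ℝ) + 1 ≤ q := by exact_mod_cast hpq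
    linarith
  rw [compositeRegret_eq, Real.sqrt_mul (by linarith)]
  have key := sum_le_of_interval_bounds (φ := fun t => f t (run.w t) + r (run.w t) - (f t v + r v))
    (X := 0) (Y := 131 * (G * D + C) * Real.sqrt (Real.log q)) hp (by omega : p ≤ q) le_rfl
    (by positivity) (by
    intro I h1 h2
    rw [zero_add]
    exact run.interval_regret_sqrt hs hrC (by omega) h2 hqT hf
      (fun t ht => hcvx t (Finset.Icc_subset_Icc h1 h2 ht)) hv)
  rw [zero_mul, zero_add] at key
  have h1 : Real.sqrt ((q : ℝ) - p + 1) ≤ 1.5 * Real.sqrt ((q : ℝ) - p) := by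
    apply Real.sqrt_le_iff.2 ⟨by positivity, ?_⟩
    rw [mul_pow, Real.sq_sqrt (by linarith)]
    linarith
  have hpos : 0 ≤ (G * D + C) * (Real.sqrt ((q : ℝ) - p) * Real.sqrt (Real.log q)) := by
    positivity
  calc _ ≤ _ := key
    _ ≤ 7 * (131 * (G * D + C) * Real.sqrt (Real.log q)) * (1.5 * Real.sqrt ((q : ℝ) - p)) := by
        gcongr
    _ = 1375.5 * ((G * D + C) * (Real.sqrt ((q : ℝ) - p) * Real.sqrt (Real.log q))) := by ring
    _ ≤ 20000 * ((G * D + C) * (Real.sqrt ((q : ℝ) - p) * Real.sqrt (Real.log q))) := by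
        gcongr; norm_num
    _ = _ := by ring

end Convex

/-- In dimension zero all points coincide. -/
theorem compositeRegret_dim_zero (f : ℕ → Space 0 → ℝ) (r : Space 0 → ℝ) (w : ℕ → Space 0)
    (p q : ℕ) (v : Space 0) : compositeRegret f r w p q v = 0 := by
  rw [compositeRegret_eq]
  refine Finset.sum_eq_zero fun t _ => ?_
  have : w t = v := by ext i; exact i.elim0
  rw [this, sub_self]

end UMAComp

end

theorem mainTheorem5 :
    ∃ K : ℝ, 0 < K ∧
    ∀ (d T : ℕ) (Ω : Set (UMAComp.Space d)) (G D C : ℝ) (r : UMAComp.Space d → ℝ)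
      (f : ℕ → UMAComp.Space d → ℝ) (g : ℕ → UMAComp.Space d → UMAComp.Space d)
      (o : UMAComp.Space d) (run : UMAComp.UMACompRun Ω G D r g o T),
      0 < G → 0 < D → Convex ℝ Ω → o ∈ Ω →
      (∀ x ∈ Ω, ∀ y ∈ Ω, ‖x - y‖ ≤ D) →
      (∀ t ∈ Finset.Icc 1 T, ∀ x ∈ Ω, HasGradientWithinAt (f t) (g t x) Ω x) →
      (∀ t ∈ Finset.Icc 1 T, ∀ x ∈ Ω, ‖g t x‖ ≤ G) →
      ConvexOn ℝ Ω r →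
      (∀ x ∈ Ω, 0 ≤ r x ∧ r x ≤ C) →
      ∀ p q : ℕ, 1 ≤ p → p ≤ q → q ≤ T → ∀ v ∈ Ω,
        (∀ α : ℝ, 0 < α → (∀ t ∈ Finset.Icc p q, UMAComp.ExpConcaveOn α Ω (f t)) →
          UMAComp.compositeRegret f r run.w p q v ≤
            (G * D + 1 / (2 * UMAComp.onsBeta G D α)) * UMAComp.boundC q * UMAComp.boundB p q +
            UMAComp.boundExp d G D (UMAComp.onsBeta G D α) p q * UMAComp.boundB p q +
            UMAComp.initGap Ω r o * UMAComp.boundB p q ∧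
          (p + 2 ≤ q →
            UMAComp.compositeRegret f r run.w p q v ≤
              K * (G * D + C + 1 / α) * d * Real.log q * Real.log ((q : ℝ) - p))) ∧
        (∀ lam : ℝ, 0 < lam →
          (∀ t ∈ Finset.Icc p q, UMAComp.StronglyConvexWith lam Ω (f t) (g t)) →
          UMAComp.compositeRegret f r run.w p q v ≤
            (G * D + G ^ 2 / (2 * lam)) * UMAComp.boundC q * UMAComp.boundB p q +
            UMAComp.boundStr G D lam p q * UMAComp.boundB p q +
            UMAComp.initGap Ω r o * UMAComp.boundB p q ∧
          (p + 2 ≤ q →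
            UMAComp.compositeRegret f r run.w p q v ≤
              K * (G * D + C + G ^ 2 / lam) * Real.log q * Real.log ((q : ℝ) - p))) ∧
        ((∀ t ∈ Finset.Icc p q, ConvexOn ℝ Ω (f t)) →
          UMAComp.compositeRegret f r run.w p q v ≤
            G * D * (UMAComp.boundC q + UMAComp.phi2 ((q : ℝ) - p + 1) + 1) *
              UMAComp.boundB p q +
            7 * (G * D) * (Real.sqrt (UMAComp.boundC q) + UMAComp.phi3 ((q : ℝ) - p + 1)) *
              Real.sqrt ((q : ℝ) - p + 1) +
            UMAComp.initGap Ω r o * UMAComp.boundB p q ∧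
          (p + 1 ≤ q →
            UMAComp.compositeRegret f r run.w p q v ≤
              K * (G * D + C) * Real.sqrt (((q : ℝ) - p) * Real.log q))) := by
  refine ⟨20000, by norm_num, ?_⟩
  intro d T Ω G D C r f g o run hG hD hΩ ho hdiam hf hg hr hrC p q hp hpq hqT v hv
  have hs : UMAComp.CompositeSetting Ω G D r g o (Finset.Icc 1 T) :=
    ⟨hG, hD, hΩ, ho, hdiam, hg, hr, fun x hx => (hrC x hx).1⟩
  have hC : 0 ≤ C := (hrC o ho).1.trans (hrC o ho).2
  have hρ : UMAComp.initGap Ω r o ≤ C := hs.initGap_le fun x hx => (hrC x hx).2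
  refine ⟨fun α hα hexp => ?_, fun lam hlam hstr => ?_, fun hcvx => ?_⟩
  · rcases Nat.eq_zero_or_pos d with rfl | hd
    · rw [UMAComp.compositeRegret_dim_zero]
      have hβ := UMAComp.onsBeta_pos hG hD hα
      have h1 := UMAComp.boundC_nonneg (hp.trans hpq)
      have h2 := UMAComp.boundB_nonneg hpq
      have h3 := UMAComp.boundExp_nonneg 0 hG hD hβ hpq
      have h4 := UMAComp.initGap_nonneg hs
      exact ⟨by positivity, fun _ => by simp⟩
    · have h := UMAComp.regret_exp_le run hs hf hp hpq hqT hd hα hexp hv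
      exact ⟨h, fun h2 => h.trans (UMAComp.bound_exp_asymptotic hp h2 hG hD hC hρ hd hα)⟩
  · have h := UMAComp.regret_str_le run hs hp hpq hqT hlam hstr hv
    exact ⟨h, fun h2 => h.trans (UMAComp.bound_str_asymptotic hp h2 hG hD hC hρ hlam)⟩
  · exact ⟨UMAComp.regret_convex_le run hs hf hp hpq hqT hcvx hv, fun h2 =>
      UMAComp.regret_convex_asymptotic run hs (fun x hx => (hrC x hx).2) hf hp h2 hqT hcvx hv⟩
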